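/- Let $k$ be a field; all algebras, modules and tensor products are over $k$. Groups and index sets are arbitrary (possibly infinite) unless something else is said, $Z(G)$ is the center of $G$, $\widehat G$ the group of homomorphisms $G\to k^\times$, $Z_g$ the centralizer of $g$, and $\mathcal K(G)$ the set of conjugacy classes of $G$. **Definitions.** *Element systems.* An element system with characters (ESC) $(G,g_i,\chi_i;i\in J)$ consists of a group $G$, a set $J$, elements $g_i\in Z(G)$ and characters $\chi_i\in\widehat G$ ($i\in J$). $(G,g_i,\chi_i;i\in J)$ and $(G',g'_i,\chi'_i;i\in J')$ are isomorphic if there are a group isomorphism $\phi:G\to G'$ and a bijection $\sigma:J\to J'$ with $\phi(g_i)=g'_{\sigma(i)}$ and $\chi'_{\sigma(i)}\phi=\chi_i$ for all $i\in J$. *Ramification systems.* A ramification system with characters (RSC) $(G,r,\vec\chi,u)$ consists of a group $G$, sets $I_C(r)$ (possibly empty, $C\in\mathcal K(G)$), elements $u(C)\in C$, and characters $\chi_C^{(i)}\in\widehat{Z_{u(C)}}$ ($i\in I_C(r)$). $(G,r,\vec\chi,u)$ and $(G',r',\vec\chi',u')$ are isomorphic if there are a group isomorphism $\phi:G\to G'$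 and, for all $C\in\mathcal K(G)$, an element $h_C\in G$ with $\phi(h_C^{-1}u(C)h_C)=u'(\phi(C))$ and a bijection $\phi_C:I_C(r)\to I_{\phi(C)}(r')$ with $\chi'^{(\phi_C(i))}_{\phi(C)}(\phi(h_C^{-1}hh_C))=\chi_C^{(i)}(h)$ for all $h\in Z_{u(C)}$ and $i\in I_C(r)$. An RSC is central (a CRSC) if every $C$ with $I_C(r)\ne\emptyset$ has only one element. An ESC $(G,g_i,\chi_i;i\in J)$ and a map $u$ with $u(C)\in C$ determine the RSC with $I_C(r)=\{j\in J: g_j\in C\}$ and $\chi_C^{(j)}=\chi_j|_{Z_{u(C)}}$. *Yetter-Drinfeld modules.* A YD $kG$-module is a left $kG$-module and left $kG$-comodule $V$ with $(h\cdot v)_{(-1)}\otimes(h\cdot v)_{(0)}=h_{(1)}v_{(-1)}S(h_{(3)})\otimes h_{(2)}\cdot v_{(0)}$. It is pointed if it is zero or a direct sum of one-dimensional YD submodules. $V(G,g_i,\chi_i;i\in J)$ has the basis $\{x_i\}_{i\in J}$ with $h\cdot x_i=\chi_i(h)x_i$ ($h\in G$) and coaction $x_i\mapsto g_i\otimes x_i$.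 For a Hopf algebra isomorphism $\phi:kG\to kG'$ and a YD $kG'$-module $N$, the YD $kG$-module ${}^{\phi^{-1}}_{\phi}N$ is $N$ with the action pulled back along $\phi$ and the coaction pushed forward along $\phi^{-1}$. $\mathcal B(V)$ is the Nichols algebra of $V$: the quotient of the braided tensor Hopf algebra $T(V)$ (with $V$ primitive) by the largest two-sided ideal which is generated by homogeneous elements of degree $\ge 2$ and is a coideal and a YD submodule; it is a graded braided Hopf algebra. *Quivers and multiple Taft algebras.* Let $(G,r,\vec\chi,u)$ be an RSC. For each $C\in\mathcal K(G)$ choose representatives of the right cosets of $Z_{u(C)}$ in $G$, the coset $Z_{u(C)}$ itself being represented by $1$, so that each $c\in C$ is $c=g_c^{-1}u(C)g_c$ for exactly one representative $g_c$. The Hopf quiver $Q$ has the set of vertices $G$ and, for $x\in G$, $C\in\mathcal K(G)$, $c\in C$ and $i\in I_C(r)$, one arrow $a^{(i)}_{xc,x}$ from $x$ to $xc$. The space $kQ_1$ spanned by the arrows is a $kG$-Hopf bimodule, $kQ_1^c$, in which an arrow from $x$ to $y$ has the left coaction $a\mapsto y\otimes a$ and the right coaction $a\mapsto a\otimes x$,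 and $$h\cdot a^{(i)}_{xc,x}=a^{(i)}_{hxc,hx},\qquad a^{(i)}_{xc,x}\cdot h=\chi_C^{(i)}\bigl(g_c\,h\,g_{h^{-1}ch}^{-1}\bigr)\,a^{(i)}_{xch,xh}\qquad(h\in G).$$ The path coalgebra $kQ^c$, which is the cotensor coalgebra of $kQ_1^c$ over $kG$, is a graded Hopf algebra, with the multiplication that extends that of $kG$ and the two actions on $kQ_1^c$. $kG[kQ_1^c]$ is its subalgebra generated by the vertices and the arrows, a graded Hopf subalgebra; if the RSC is central, it is called a multiple Taft algebra. $(kQ_1^1,ad)$ is the YD $kG$-module spanned by the arrows with source $1$, with the action $h\triangleright a=h\cdot a\cdot h^{-1}$ ($h\in G$) and the left coaction of $kQ_1^c$. For the RSC of an ESC these are written $kG[kQ_1^c,G,g_i,\chi_i;i\in J]$ and $(kQ_1^1,ad(G,g_i,\chi_i;i\in J))$. **Theorem.** Let $(G,g_i,\chi_i;i\in J)$ and $(G',g'_i,\chi'_i;i\in J')$ be ESCs, and let maps $u$, $u'$ and coset representatives as above be chosen for $G$ and $G'$. The following are equivalent: (i) the two ESCs are isomorphic; (ii) the RSCs of the two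 ESCs are isomorphic; (iii) there is a Hopf algebra isomorphism $\phi:kG\to kG'$ with $V(G,g_i,\chi_i;i\in J)\cong{}^{\phi^{-1}}_{\phi}V(G',g'_i,\chi'_i;i\in J')$ as YD $kG$-modules; (iv) there is a Hopf algebra isomorphism $\phi:kG\to kG'$ with $\mathcal B(V(G,g_i,\chi_i;i\in J))\cong{}^{\phi^{-1}}_{\phi}\mathcal B(V(G',g'_i,\chi'_i;i\in J'))$ as graded braided Hopf algebras in the category of YD $kG$-modules; (v) there is a Hopf algebra isomorphism $\phi:kG\to kG'$ with $(kQ_1^1,ad(G,g_i,\chi_i;i\in J))\cong{}^{\phi^{-1}}_{\phi}(kQ'^1_1,ad(G',g'_i,\chi'_i;i\in J'))$ as YD $kG$-modules; (vi) $kG[kQ_1^c,G,g_i,\chi_i;i\in J]\cong kG'[kQ'^c_1,G',g'_i,\chi'_i;i\in J']$ as graded Hopf algebras. These equivalences classify pointed YD modules, their Nichols algebras and multiple Taft algebras, because: (a) the RSC of an ESC is central; (b) a YD $kG$-module is pointed if and only if it is isomorphic to $V(G,g_i,\chi_i;i\in J)$ for some ESC over $G$, and consequently the Nichols algebra of a pointed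 YD $kG$-module is isomorphic, as a graded braided Hopf algebra in the category of YD $kG$-modules, to $\mathcal B(V(G,g_i,\chi_i;i\in J))$ for some ESC over $G$; (c) for every CRSC $(G,r,\vec\chi,u)$ there is an ESC $(G,g_i,\chi_i;i\in J)$ over $G$ whose RSC (formed with $u$) is isomorphic to it, and such that the multiple Taft algebra of the CRSC is isomorphic, as a graded Hopf algebra, to $kG[kQ_1^c,G,g_i,\chi_i;i\in J]$; (d) if $G$ is finite abelian and $k$ contains a primitive root of unity whose order is the exponent of $G$ (for example, if $k=\mathbb C$), then every YD $kG$-module is pointed and every RSC over $G$ is central. -/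

import Mathlib

open scoped TensorProduct

universe uk uG uG' uJ uJ' uV uI

noncomputable section

section YetterDrinfeld

variable {k H V W : Type*} [Field k] [Ring H] [HopfAlgebra k H]
  [AddCommGroup V] [Module k V] [AddCommGroup W] [Module k W]

/-- Given a left action of `H` on `V`, the linear map which sends `x ⊗ (y ⊗ z)` to the endomorphism
`a ⊗ v ↦ x * a * S(z) ⊗ y • v` of `H ⊗ V`. -/
def ydConj (act : H →ₐ[k] Module.End k V) :
    H ⊗[k] (H ⊗[k] H) →ₗ[k] Module.End k (H ⊗[k] V) :=
  TensorProduct.lift <| LinearMap.mk₂ k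
    (fun x t => (LinearMap.mulLeft k x).rTensor V ∘ₗ
      (TensorProduct.lift <| LinearMap.mk₂ k
        (fun y z => TensorProduct.map (LinearMap.mulRight k (HopfAlgebra.antipode k z)) (act y))
        (fun y y' z => by simp [TensorProduct.map_add_right])
        (fun c y z => by simp [TensorProduct.map_smul_right])
        (fun y z z' => by ext; simp [mul_add, TensorProduct.add_tmul])
        (fun c y z => by ext; simp [TensorProduct.smul_tmul'])) t)
    (fun x x' t => by
      have : LinearMap.mulLeft k (x + x') = LinearMap.mulLeft k x + LinearMap.mulLeft k x' := by
        ext; simp [add_mul]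
      rw [this, LinearMap.rTensor_add, LinearMap.add_comp])
    (fun c x t => by
      have : LinearMap.mulLeft k (c • x) = c • LinearMap.mulLeft k x := by ext; simp
      rw [this, LinearMap.rTensor_smul, LinearMap.smul_comp])
    (fun x t t' => by rw [map_add, LinearMap.comp_add])
    (fun c x t => by rw [map_smul, LinearMap.comp_smul])

@[simp]
theorem ydConj_tmul (act : H →ₐ[k] Module.End k V) (x y z a : H) (v : V) :
    ydConj act (x ⊗ₜ (y ⊗ₜ z)) (a ⊗ₜ v) =
      (x * (a * HopfAlgebra.antipode k z)) ⊗ₜ[k] act y v := by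
  simp [ydConj]

variable (k H V) in
/-- A (left-left) Yetter-Drinfeld module structure over the Hopf algebra `H` on the vector space
`V`: an action and a coaction of `H` with
`(h • v)₍₋₁₎ ⊗ (h • v)₍₀₎ = h₍₁₎ v₍₋₁₎ S(h₍₃₎) ⊗ h₍₂₎ • v₍₀₎`. -/
structure YDModule where
  /-- the left action of `H` -/
  act : H →ₐ[k] Module.End k V
  /-- the left coaction of `H` -/
  coact : V →ₗ[k] H ⊗[k] V
  coassoc : (TensorProduct.assoc k H H V).toLinearMap ∘ₗ
    (Coalgebra.comul (R := k) (A := H)).rTensor V ∘ₗ coact = coact.lTensor H ∘ₗ coact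
  rTensor_counit : (Coalgebra.counit (R := k) (A := H)).rTensor V ∘ₗ coact =
    TensorProduct.mk k k V 1
  compat : ∀ (h : H) (v : V), coact (act h v) =
    ydConj act ((Coalgebra.comul (R := k) (A := H)).lTensor H (Coalgebra.comul (R := k) h))
      (coact v)


namespace YDModule

/-- A Yetter-Drinfeld submodule: `W` is stable under the action, and its coaction lands in
`H ⊗ W`. -/
structure IsSub (M : YDModule k H V) (W : Submodule k V) : Prop where
  act_mem : ∀ (h : H), ∀ v ∈ W, M.act h v ∈ W
  coact_mem : ∀ v ∈ W, M.coact v ∈ LinearMap.range (W.subtype.lTensor H)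

/-- A Yetter-Drinfeld module is pointed if it is zero or the direct sum of one-dimensional
Yetter-Drinfeld submodules (for the zero module the family is empty). -/
def IsPointed (M : YDModule k H V) : Prop :=
  ∃ S : Set (Submodule k V), (∀ W ∈ S, M.IsSub W ∧ Module.finrank k W = 1) ∧
    sSupIndep S ∧ sSup S = ⊤

end YDModule

section Descend

variable {X : Type*} [AddCommGroup X] [Module k X]

/-- The linear map induced on the target of a surjective linear map `π`. -/
def LinearMap.descend (π : V →ₗ[k] W) (hπ : Function.Surjective π) (f : V →ₗ[k] X)
    (h : LinearMap.ker π ≤ LinearMap.ker f) : W →ₗ[k] X :=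
  (LinearMap.ker π).liftQ f h ∘ₗ (π.quotKerEquivOfSurjective hπ).symm.toLinearMap

@[simp]
theorem LinearMap.descend_apply (π : V →ₗ[k] W) (hπ : Function.Surjective π) (f : V →ₗ[k] X)
    (h : LinearMap.ker π ≤ LinearMap.ker f) (v : V) :
    LinearMap.descend π hπ f h (π v) = f v := by
  have : (π.quotKerEquivOfSurjective hπ).symm (π v) = Submodule.Quotient.mk v := by
    rw [LinearEquiv.symm_apply_eq]; rfl
  simp [LinearMap.descend, this]

theorem LinearMap.range_lTensor_ker_le (π : V →ₗ[k] W) :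
    LinearMap.range ((LinearMap.ker π).subtype.lTensor H) ≤ LinearMap.ker (π.lTensor H) := by
  rintro _ ⟨t, rfl⟩
  have : π ∘ₗ (LinearMap.ker π).subtype = 0 := by ext v; simp
  rw [LinearMap.mem_ker, ← LinearMap.comp_apply, ← LinearMap.lTensor_comp, this]
  simp

theorem ydConj_naturality (act : H →ₐ[k] Module.End k V) (act' : H →ₐ[k] Module.End k W)
    (π : V →ₗ[k] W) (hact : ∀ h v, act' h (π v) = π (act h v)) (t : H ⊗[k] (H ⊗[k] H))
    (u : H ⊗[k] V) :
    ydConj act' t (π.lTensor H u) = π.lTensor H (ydConj act t u) := by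
  induction t with
  | zero => simp
  | add a b ha hb => simp [ha, hb]
  | tmul x t =>
    induction t with
    | zero => simp
    | add a b ha hb => simp [TensorProduct.tmul_add, ha, hb]
    | tmul y z =>
      induction u with
      | zero => simp
      | add a b ha hb => simp [ha, hb]
      | tmul a v => simp [hact]

namespace YDModule

/-- The action induced on the quotient of a Yetter-Drinfeld module by a Yetter-Drinfeld submodule,
the kernel of a surjective linear map `π`. -/
def quotientAct (M : YDModule k H V) (π : V →ₗ[k] W) (hπ : Function.Surjective π)
    (hs : M.IsSub (LinearMap.ker π)) (h : H) : Module.End k W :=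
  LinearMap.descend π hπ (π ∘ₗ M.act h)
    (fun v hv => LinearMap.mem_ker.2 (LinearMap.mem_ker.1 (hs.act_mem h v hv)))

@[simp]
theorem quotientAct_apply (M : YDModule k H V) (π : V →ₗ[k] W) (hπ : Function.Surjective π)
    (hs : M.IsSub (LinearMap.ker π)) (h : H) (v : V) :
    M.quotientAct π hπ hs h (π v) = π (M.act h v) := by
  simp [quotientAct]

/-- The coaction induced on the quotient of a Yetter-Drinfeld module by a Yetter-Drinfeld
submodule, the kernel of a surjective linear map `π`. -/
def quotientCoact (M : YDModule k H V) (π : V →ₗ[k] W) (hπ : Function.Surjective π)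
    (hs : M.IsSub (LinearMap.ker π)) : W →ₗ[k] H ⊗[k] W :=
  LinearMap.descend π hπ (π.lTensor H ∘ₗ M.coact) (fun v hv =>
    LinearMap.mem_ker.2 (LinearMap.mem_ker.1
      (LinearMap.range_lTensor_ker_le π (hs.coact_mem v hv))))

@[simp]
theorem quotientCoact_apply (M : YDModule k H V) (π : V →ₗ[k] W) (hπ : Function.Surjective π)
    (hs : M.IsSub (LinearMap.ker π)) (v : V) :
    M.quotientCoact π hπ hs (π v) = π.lTensor H (M.coact v) := by
  simp [quotientCoact]

/-- The quotient of a Yetter-Drinfeld module by a Yetter-Drinfeld submodule, here the kernel of a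
surjective linear map `π`. -/
def quotient (M : YDModule k H V) (π : V →ₗ[k] W) (hπ : Function.Surjective π)
    (hs : M.IsSub (LinearMap.ker π)) : YDModule k H W where
  act := AlgHom.ofLinearMap
    { toFun := M.quotientAct π hπ hs
      map_add' := fun a b => by
        ext w; obtain ⟨v, rfl⟩ := hπ w; simp
      map_smul' := fun a b => by
        ext w; obtain ⟨v, rfl⟩ := hπ w; simp }
    (by ext w; obtain ⟨v, rfl⟩ := hπ w; simp)
    (fun a b => by ext w; obtain ⟨v, rfl⟩ := hπ w; simp)
  coact := M.quotientCoact π hπ hs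
  coassoc := by
    ext w; obtain ⟨v, rfl⟩ := hπ w
    have h1 := LinearMap.congr_fun M.coassoc v
    have h2 : ∀ u : H ⊗[k] V, (TensorProduct.assoc k H H W).toLinearMap
        ((Coalgebra.comul (R := k) (A := H)).rTensor W (π.lTensor H u)) =
        (π.lTensor H).lTensor H ((TensorProduct.assoc k H H V).toLinearMap
          ((Coalgebra.comul (R := k) (A := H)).rTensor V u)) := fun u => by
      induction u with
      | zero => simp
      | add a b ha hb => simp only [map_add, ha, hb]
      | tmul a v =>
        simp only [LinearMap.lTensor_tmul, LinearMap.rTensor_tmul]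
        induction (Coalgebra.comul (R := k) a) with
        | zero => simp
        | add a b ha hb => simp only [map_add, TensorProduct.add_tmul, ha, hb]
        | tmul a v => simp
    have h3 : ∀ u : H ⊗[k] V, (M.quotientCoact π hπ hs).lTensor H (π.lTensor H u) =
        (π.lTensor H).lTensor H (M.coact.lTensor H u) := fun u => by
      induction u with
      | zero => simp
      | add a b ha hb => simp only [map_add, ha, hb]
      | tmul a v => simp
    simp only [LinearMap.comp_apply, quotientCoact_apply] at h1 ⊢
    rw [h2, h3, h1]
  rTensor_counit := by
    ext w; obtain ⟨v, rfl⟩ := hπ w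
    have h1 := LinearMap.congr_fun M.rTensor_counit v
    have h2 : ∀ u : H ⊗[k] V, (Coalgebra.counit (R := k) (A := H)).rTensor W (π.lTensor H u) =
        π.lTensor k ((Coalgebra.counit (R := k) (A := H)).rTensor V u) := fun u => by
      induction u with
      | zero => simp
      | add a b ha hb => simp only [map_add, ha, hb]
      | tmul a v => simp
    simp only [LinearMap.comp_apply, quotientCoact_apply] at h1 ⊢
    rw [h2, h1]
    simp
  compat := fun h w => by
    obtain ⟨v, rfl⟩ := hπ w
    rw [quotientCoact_apply, ydConj_naturality M.act _ π (fun h v => by simp), ← M.compat]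
    simp

end YDModule

end Descend

section Iso

variable {H' V' : Type*} [Ring H'] [HopfAlgebra k H'] [AddCommGroup V'] [Module k V']

/-- An isomorphism of Yetter-Drinfeld modules from `M` to the pullback `^{φ⁻¹}_φ N` of `N` along a
Hopf algebra isomorphism `φ`, on which `h` acts as `φ h` and whose coaction is
`(φ⁻¹ ⊗ id) ∘ N.coact`. -/
structure YDIso (φ : H ≃ₐc[k] H') (M : YDModule k H V) (N : YDModule k H' V') extends
    V ≃ₗ[k] V' where
  map_act : ∀ (h : H) (v : V), toFun (M.act h v) = N.act (φ h) (toFun v)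
  map_coact : ∀ v : V, TensorProduct.map (φ : H →ₗ[k] H') toLinearMap (M.coact v) =
    N.coact (toFun v)

end Iso

end YetterDrinfeld

section GroupAlgebra

variable {k G V : Type*} [Field k] [Group G] [AddCommGroup V] [Module k V]

/-- A Yetter-Drinfeld module over the group algebra `kG` from an action of the group `G`. -/
def YDModule.ofGroup (ρ : G →* Module.End k V) (δ : V →ₗ[k] MonoidAlgebra k G ⊗[k] V)
    (coassoc : (TensorProduct.assoc k _ _ V).toLinearMap ∘ₗ
      (Coalgebra.comul (R := k) (A := MonoidAlgebra k G)).rTensor V ∘ₗ δ = δ.lTensor _ ∘ₗ δ)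
    (rTensor_counit : (Coalgebra.counit (R := k) (A := MonoidAlgebra k G)).rTensor V ∘ₗ δ =
      TensorProduct.mk k k V 1)
    (compat : ∀ (g : G) (v : V), δ (ρ g v) = TensorProduct.map
      (LinearMap.mulLeft k (MonoidAlgebra.single g 1) ∘ₗ
        LinearMap.mulRight k (MonoidAlgebra.single g⁻¹ 1)) (ρ g) (δ v)) :
    YDModule k (MonoidAlgebra k G) V where
  act := MonoidAlgebra.lift k (Module.End k V) G ρ
  coact := δ
  coassoc := coassoc
  rTensor_counit := rTensor_counit
  compat := fun h v => by
    induction h using MonoidAlgebra.induction_linear with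
    | zero => simp
    | add a b ha hb => simp only [map_add, LinearMap.add_apply, ha, hb]
    | single g r =>
      have h1 : (MonoidAlgebra.single g r : MonoidAlgebra k G) =
        r • MonoidAlgebra.single g 1 := by simp
      rw [h1]
      simp only [map_smul, LinearMap.smul_apply]
      congr 1
      have h2 : MonoidAlgebra.lift k (Module.End k V) G ρ (MonoidAlgebra.single g 1) = ρ g := by
        simp
      rw [h2, compat]
      generalize δ v = u
      induction u with
      | zero => simp
      | add a b ha hb => simp only [map_add, ha, hb]
      | tmul a v => simp [MonoidAlgebra.antipode_single]

/-- The Yetter-Drinfeld module over `kG` with basis `X`, where `g` sends the basis vector `x` to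
`c g x` times the basis vector `a g x`, and the coaction is `x ↦ deg x ⊗ x`. -/
def YDModule.monomial {X : Type*} (deg : X → G) (a : G → X → X) (c : G → X → k)
    (a_one : ∀ x, a 1 x = x) (a_mul : ∀ g h x, a (g * h) x = a g (a h x))
    (c_one : ∀ x, c 1 x = 1) (c_mul : ∀ g h x, c (g * h) x = c h x * c g (a h x))
    (deg_a : ∀ g x, deg (a g x) = g * deg x * g⁻¹) :
    YDModule k (MonoidAlgebra k G) (X →₀ k) :=
  YDModule.ofGroup
    { toFun := fun g => Finsupp.linearCombination k fun x => Finsupp.single (a g x) (c g x)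
      map_one' := by ext x; simp [a_one, c_one]
      map_mul' := fun g h => by ext x; simp [a_mul, c_mul] }
    (Finsupp.linearCombination k fun x => MonoidAlgebra.single (deg x) 1 ⊗ₜ Finsupp.single x 1)
    (by ext x; simp)
    (by ext x; simp)
    (fun g v => by
      induction v using Finsupp.induction_linear with
      | zero => simp
      | add u v hu hv => simp only [map_add, hu, hv]
      | single x r =>
        simp only [MonoidHom.coe_mk, OneHom.coe_mk, Finsupp.linearCombination_single, map_smul]
        congr 1
        have : (Finsupp.single (a g x) (c g x) : X →₀ k) = c g x • Finsupp.single (a g x) 1 := by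
          rw [Finsupp.smul_single, smul_eq_mul, mul_one]
        simp only [TensorProduct.map_tmul, Finsupp.linearCombination_single, one_smul]
        rw [this, TensorProduct.tmul_smul]
        simp [deg_a, mul_assoc])

end GroupAlgebra

section Nichols

section Braiding

variable {k H V W A : Type*} [Field k] [Ring H] [HopfAlgebra k H]
  [AddCommGroup V] [Module k V] [AddCommGroup W] [Module k W] [Ring A] [Algebra k A]

/-- The braiding `v ⊗ w ↦ v₍₋₁₎ • w ⊗ v₍₀₎` of Yetter-Drinfeld modules. -/
def YDModule.braiding (M : YDModule k H V) (N : YDModule k H W) : V ⊗[k] W →ₗ[k] W ⊗[k] V :=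
  (TensorProduct.lift N.act.toLinearMap).rTensor V ∘ₗ
    (TensorProduct.assoc k H W V).symm.toLinearMap ∘ₗ
    (TensorProduct.comm k V W).toLinearMap.lTensor H ∘ₗ
    (TensorProduct.assoc k H V W).toLinearMap ∘ₗ M.coact.rTensor W

/-- The product `(a ⊗ b)(a' ⊗ b') = a (b₍₋₁₎ • a') ⊗ b₍₀₎ b'` of the braided tensor product
`A ⊗ A`, for an algebra `A` with a Yetter-Drinfeld module structure. -/
def YDModule.braidedMul (M : YDModule k H A) :
    A ⊗[k] A →ₗ[k] A ⊗[k] A →ₗ[k] A ⊗[k] A :=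
  TensorProduct.curry <|
    TensorProduct.map (LinearMap.mul' k A) (LinearMap.mul' k A) ∘ₗ
    (TensorProduct.assoc k A A (A ⊗[k] A)).symm.toLinearMap ∘ₗ
    ((TensorProduct.assoc k A A A).toLinearMap ∘ₗ (M.braiding M).rTensor A ∘ₗ
      (TensorProduct.assoc k A A A).symm.toLinearMap).lTensor A ∘ₗ
    (TensorProduct.assoc k A A (A ⊗[k] A)).toLinearMap

end Braiding

variable {k G V : Type*} [Field k] [Group G] [AddCommGroup V] [Module k V]

namespace YDModule

/-- The action of `g ∈ G` on the tensor algebra by algebra automorphisms. -/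
def tensorAct (M : YDModule k (MonoidAlgebra k G) V) (g : G) :
    TensorAlgebra k V →ₐ[k] TensorAlgebra k V :=
  TensorAlgebra.lift k (TensorAlgebra.ι k ∘ₗ M.act (MonoidAlgebra.single g 1))

/-- The coaction on the tensor algebra, the algebra map which extends the coaction on `V`. -/
def tensorCoact (M : YDModule k (MonoidAlgebra k G) V) :
    TensorAlgebra k V →ₐ[k] MonoidAlgebra k G ⊗[k] TensorAlgebra k V :=
  TensorAlgebra.lift k ((TensorAlgebra.ι k).lTensor (MonoidAlgebra k G) ∘ₗ M.coact)

/-- The tensor algebra of a Yetter-Drinfeld module over `kG`, as a Yetter-Drinfeld module. -/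
def tensor (M : YDModule k (MonoidAlgebra k G) V) :
    YDModule k (MonoidAlgebra k G) (TensorAlgebra k V) :=
  YDModule.ofGroup
    { toFun := fun g => (M.tensorAct g).toLinearMap
      map_one' := by
        have : M.tensorAct 1 = AlgHom.id k _ := by
          ext v
          have : (MonoidAlgebra.single 1 1 : MonoidAlgebra k G) = 1 := rfl
          simp [tensorAct, this]
        rw [this]; rfl
      map_mul' := fun g h => by
        have : M.tensorAct (g * h) = (M.tensorAct g).comp (M.tensorAct h) := by
          ext v
          have : (MonoidAlgebra.single (g * h) 1 : MonoidAlgebra k G) =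
            MonoidAlgebra.single g 1 * MonoidAlgebra.single h 1 := by simp
          simp only [tensorAct, LinearMap.comp_apply, AlgHom.toLinearMap_apply, AlgHom.comp_apply,
            TensorAlgebra.lift_ι_apply]
          rw [this, map_mul]
          rfl
        rw [this]; rfl }
    M.tensorCoact.toLinearMap
    (by
      have : ((Algebra.TensorProduct.assoc k k k (MonoidAlgebra k G) (MonoidAlgebra k G)
            (TensorAlgebra k V)).toAlgHom.comp (Algebra.TensorProduct.map
            (Bialgebra.comulAlgHom k (MonoidAlgebra k G)) (AlgHom.id k _))).comp M.tensorCoact =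
          (Algebra.TensorProduct.map (AlgHom.id k _) M.tensorCoact).comp M.tensorCoact := by
        ext v
        have h1 := LinearMap.congr_fun M.coassoc v
        have h2 : ∀ u : MonoidAlgebra k G ⊗[k] V,
            Algebra.TensorProduct.assoc k k k (MonoidAlgebra k G) (MonoidAlgebra k G)
              (TensorAlgebra k V) (Algebra.TensorProduct.map
                (Bialgebra.comulAlgHom k (MonoidAlgebra k G)) (AlgHom.id k _)
                ((TensorAlgebra.ι k).lTensor (MonoidAlgebra k G) u)) =
            ((TensorAlgebra.ι k).lTensor (MonoidAlgebra k G)).lTensor (MonoidAlgebra k G)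
              ((TensorProduct.assoc k _ _ V).toLinearMap
                ((Coalgebra.comul (R := k) (A := MonoidAlgebra k G)).rTensor V u)) := fun u => by
          induction u with
          | zero => simp
          | add a b ha hb => simp only [map_add, ha, hb]
          | tmul a v =>
            simp only [LinearMap.lTensor_tmul, LinearMap.rTensor_tmul,
              Algebra.TensorProduct.map_tmul, Bialgebra.comulAlgHom_apply]
            induction (Coalgebra.comul (R := k) a) with
            | zero => simp
            | add a b ha hb => simp only [map_add, TensorProduct.add_tmul, ha, hb]
            | tmul a v => simp
        have h3 : ∀ u : MonoidAlgebra k G ⊗[k] V,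
            Algebra.TensorProduct.map (AlgHom.id k _) M.tensorCoact
              ((TensorAlgebra.ι k).lTensor (MonoidAlgebra k G) u) =
            ((TensorAlgebra.ι k).lTensor (MonoidAlgebra k G)).lTensor (MonoidAlgebra k G)
              (M.coact.lTensor (MonoidAlgebra k G) u) := fun u => by
          induction u with
          | zero => simp
          | add a b ha hb => simp only [map_add, ha, hb]
          | tmul a v => simp [tensorCoact]
        have h4 : M.tensorCoact (TensorAlgebra.ι k v) =
            (TensorAlgebra.ι k).lTensor (MonoidAlgebra k G) (M.coact v) := by simp [tensorCoact]
        simp only [LinearMap.comp_apply] at h1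
        have h5 := (h2 (M.coact v)).trans ((congrArg _ h1).trans (h3 (M.coact v)).symm)
        simp only [LinearMap.comp_apply, AlgHom.toLinearMap_apply, AlgHom.comp_apply]
        rw [h4]
        exact h5
      exact congrArg AlgHom.toLinearMap this)
    (by
      have : (Algebra.TensorProduct.map (Bialgebra.counitAlgHom k (MonoidAlgebra k G))
            (AlgHom.id k _)).comp M.tensorCoact = Algebra.TensorProduct.includeRight := by
        ext v
        have h1 := LinearMap.congr_fun M.rTensor_counit v
        have h2 : ∀ u : MonoidAlgebra k G ⊗[k] V, Algebra.TensorProduct.map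
            (Bialgebra.counitAlgHom k (MonoidAlgebra k G)) (AlgHom.id k _)
              ((TensorAlgebra.ι k).lTensor (MonoidAlgebra k G) u) =
            (TensorAlgebra.ι k).lTensor k
              ((Coalgebra.counit (R := k) (A := MonoidAlgebra k G)).rTensor V u) := fun u => by
          induction u with
          | zero => simp
          | add a b ha hb => simp only [map_add, ha, hb]
          | tmul a v => simp
        have h4 : M.tensorCoact (TensorAlgebra.ι k v) =
            (TensorAlgebra.ι k).lTensor (MonoidAlgebra k G) (M.coact v) := by simp [tensorCoact]
        simp only [LinearMap.comp_apply] at h1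
        have h5 := (h2 (M.coact v)).trans (congrArg _ h1)
        simp only [LinearMap.comp_apply, AlgHom.toLinearMap_apply, AlgHom.comp_apply]
        rw [h4]
        exact h5
      exact congrArg AlgHom.toLinearMap this)
    (fun g x => by
      have hg : (MonoidAlgebra.single g 1 : MonoidAlgebra k G) * MonoidAlgebra.single g⁻¹ 1 = 1 :=
        by simp [MonoidAlgebra.one_def]
      have hg' : (MonoidAlgebra.single g⁻¹ 1 : MonoidAlgebra k G) * MonoidAlgebra.single g 1 = 1 :=
        by simp [MonoidAlgebra.one_def]
      let conj : MonoidAlgebra k G →ₐ[k] MonoidAlgebra k G := AlgHom.ofLinearMap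
        (LinearMap.mulLeft k (MonoidAlgebra.single g 1) ∘ₗ
          LinearMap.mulRight k (MonoidAlgebra.single g⁻¹ 1)) (by simp [hg])
        (fun a b => by
          simp only [LinearMap.comp_apply, LinearMap.mulLeft_apply, LinearMap.mulRight_apply]
          calc _ = MonoidAlgebra.single g 1 * (a * 1 * b * MonoidAlgebra.single g⁻¹ 1) := by
                rw [mul_one]
            _ = _ := by rw [← hg']; simp only [mul_assoc])
      have : M.tensorCoact.comp (M.tensorAct g) =
          (Algebra.TensorProduct.map conj (M.tensorAct g)).comp M.tensorCoact := by
        ext v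
        have h1 := M.compat (MonoidAlgebra.single g 1) v
        have h2 : ∀ u : MonoidAlgebra k G ⊗[k] V, Algebra.TensorProduct.map conj (M.tensorAct g)
            ((TensorAlgebra.ι k).lTensor (MonoidAlgebra k G) u) =
            (TensorAlgebra.ι k).lTensor (MonoidAlgebra k G) (ydConj M.act
              ((Coalgebra.comul (R := k) (A := MonoidAlgebra k G)).lTensor (MonoidAlgebra k G)
                (Coalgebra.comul (R := k) (MonoidAlgebra.single g 1))) u) := fun u => by
          induction u with
          | zero => simp
          | add a b ha hb => simp only [map_add, ha, hb]
          | tmul a v => simp [tensorAct, conj, MonoidAlgebra.antipode_single]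
        have h4 : ∀ v, M.tensorCoact (TensorAlgebra.ι k v) =
            (TensorAlgebra.ι k).lTensor (MonoidAlgebra k G) (M.coact v) := by simp [tensorCoact]
        have h5 : M.tensorAct g (TensorAlgebra.ι k v) =
            TensorAlgebra.ι k (M.act (MonoidAlgebra.single g 1) v) := by simp [tensorAct]
        simp only [LinearMap.comp_apply, AlgHom.toLinearMap_apply, AlgHom.comp_apply]
        rw [h5, h4, h4, h2, h1]
      exact DFunLike.congr_fun this x)

/-- The braided comultiplication of the tensor algebra: it is multiplicative for the braided
product on `T(V) ⊗ T(V)` and `v ↦ v ⊗ 1 + 1 ⊗ v` on `V`, that is, `v₁ ⋯ vₙ` is sent to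
`Δ(v₁)(Δ(v₂)( ⋯ (Δ(vₙ)(1 ⊗ 1))))`. -/
def tensorComul (M : YDModule k (MonoidAlgebra k G) V) :
    TensorAlgebra k V →ₗ[k] TensorAlgebra k V ⊗[k] TensorAlgebra k V :=
  LinearMap.applyₗ (1 ⊗ₜ[k] 1) ∘ₗ
    (TensorAlgebra.lift k (A := Module.End k (TensorAlgebra k V ⊗[k] TensorAlgebra k V))
      (M.tensor.braidedMul ∘ₗ
        ((TensorProduct.mk k (TensorAlgebra k V) (TensorAlgebra k V)).flip 1 +
          TensorProduct.mk k (TensorAlgebra k V) (TensorAlgebra k V) 1) ∘ₗ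
        TensorAlgebra.ι k)).toLinearMap

/-- The ideals over whose sum the tensor algebra is divided to obtain the Nichols algebra:
two-sided ideals which are generated by homogeneous elements of degree at least two (they are
homogeneous and contained in the span of the degrees `≥ 2`), which are Yetter-Drinfeld submodules
and coideals. -/
structure IsNicholsRelation (M : YDModule k (MonoidAlgebra k G) V)
    (I : Ideal (TensorAlgebra k V)) : Prop where
  isTwoSided : I.IsTwoSided
  homogeneous : I.IsHomogeneous fun n : ℕ => (LinearMap.range (TensorAlgebra.ι k (M := V))) ^ n
  two_le_degree : I.restrictScalars k ≤
    ⨆ n : ℕ, (LinearMap.range (TensorAlgebra.ι k (M := V))) ^ (n + 2)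
  isSub : M.tensor.IsSub (I.restrictScalars k)
  coideal : ∀ x ∈ I, M.tensorComul x ∈
    LinearMap.range ((I.restrictScalars k).subtype.rTensor (TensorAlgebra k V)) ⊔
    LinearMap.range ((I.restrictScalars k).subtype.lTensor (TensorAlgebra k V))

/-- The defining ideal of the Nichols algebra, the sum of all the ideals as above. -/
def nicholsIdeal (M : YDModule k (MonoidAlgebra k G) V) : Ideal (TensorAlgebra k V) :=
  sSup {I | M.IsNicholsRelation I}

theorem le_nicholsIdeal (M : YDModule k (MonoidAlgebra k G) V) {I : Ideal (TensorAlgebra k V)}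
    (hI : M.IsNicholsRelation I) : I ≤ M.nicholsIdeal :=
  le_sSup hI

theorem nicholsIdeal_le (M : YDModule k (MonoidAlgebra k G) V)
    (P : Submodule k (TensorAlgebra k V))
    (h : ∀ I : Ideal (TensorAlgebra k V), M.IsNicholsRelation I → I.restrictScalars k ≤ P) :
    M.nicholsIdeal.restrictScalars k ≤ P := by
  intro x hx
  have hx : x ∈ sSup {I | M.IsNicholsRelation I} := hx
  rw [Submodule.mem_sSup_iff_exists_finset] at hx
  obtain ⟨s, hs, hx⟩ := hx
  clear * - h hs hx
  induction s using Finset.induction_on generalizing x with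
  | empty => simp at hx; rw [hx]; exact P.zero_mem
  | insert I s _ ih =>
    rw [Finset.iSup_insert, Submodule.mem_sup] at hx
    obtain ⟨y, hy, z, hz, rfl⟩ := hx
    have hI : M.IsNicholsRelation I := hs (by simp)
    exact P.add_mem (h I hI hy) (ih (fun J hJ => hs (by simp at hJ ⊢; exact Or.inr hJ)) hz)

theorem isNicholsRelation_nicholsIdeal (M : YDModule k (MonoidAlgebra k G) V) :
    M.IsNicholsRelation M.nicholsIdeal where
  isTwoSided := ⟨fun {a} b ha => by
    have := M.nicholsIdeal_le
      ((M.nicholsIdeal.restrictScalars k).comap (LinearMap.mulRight k b)) (fun I hI x hx => by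
        have := hI.isTwoSided
        exact M.le_nicholsIdeal hI (I.mul_mem_right b hx))
    exact this ha⟩
  homogeneous := Ideal.IsHomogeneous.sSup fun I hI => hI.homogeneous
  two_le_degree := M.nicholsIdeal_le _ fun I hI => hI.two_le_degree
  isSub :=
    { act_mem := fun h v hv => by
        have := M.nicholsIdeal_le ((M.nicholsIdeal.restrictScalars k).comap (M.tensor.act h))
          (fun I hI x hx => M.le_nicholsIdeal hI (hI.isSub.act_mem h x hx))
        exact this hv
      coact_mem := fun v hv => by
        have := M.nicholsIdeal_le ((LinearMap.range ((M.nicholsIdeal.restrictScalars k).subtype.lTensor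
          (MonoidAlgebra k G))).comap M.tensor.coact)
          (fun I hI x hx => by
            have hle : I.restrictScalars k ≤ M.nicholsIdeal.restrictScalars k :=
              M.le_nicholsIdeal hI
            obtain ⟨t, ht⟩ := hI.isSub.coact_mem x hx
            refine ⟨(Submodule.inclusion hle).lTensor _ t, ?_⟩
            rw [← ht, ← LinearMap.comp_apply, ← LinearMap.lTensor_comp]
            rfl)
        exact this hv }
  coideal := fun x hx => by
    have := M.nicholsIdeal_le ((LinearMap.range
        ((M.nicholsIdeal.restrictScalars k).subtype.rTensor (TensorAlgebra k V)) ⊔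
      LinearMap.range ((M.nicholsIdeal.restrictScalars k).subtype.lTensor
        (TensorAlgebra k V))).comap M.tensorComul)
      (fun I hI x hx => by
        have hle : I.restrictScalars k ≤ M.nicholsIdeal.restrictScalars k := M.le_nicholsIdeal hI
        refine SetLike.le_def.1 (sup_le_sup ?_ ?_) (hI.coideal x hx)
        · rintro _ ⟨t, rfl⟩
          refine ⟨(Submodule.inclusion hle).rTensor _ t, ?_⟩
          rw [← LinearMap.comp_apply, ← LinearMap.rTensor_comp]
          rfl
        · rintro _ ⟨t, rfl⟩
          refine ⟨(Submodule.inclusion hle).lTensor _ t, ?_⟩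
          rw [← LinearMap.comp_apply, ← LinearMap.lTensor_comp]
          rfl)
    exact this hx

instance (M : YDModule k (MonoidAlgebra k G) V) : M.nicholsIdeal.IsTwoSided :=
  M.isNicholsRelation_nicholsIdeal.isTwoSided

/-- The Nichols algebra of a Yetter-Drinfeld module over `kG`, as an algebra. -/
abbrev Nichols (M : YDModule k (MonoidAlgebra k G) V) : Type _ :=
  TensorAlgebra k V ⧸ M.nicholsIdeal

/-- The projection from the tensor algebra onto the Nichols algebra. -/
def toNichols (M : YDModule k (MonoidAlgebra k G) V) : TensorAlgebra k V →ₐ[k] M.Nichols :=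
  Ideal.Quotient.mkₐ k M.nicholsIdeal

theorem toNichols_surjective (M : YDModule k (MonoidAlgebra k G) V) :
    Function.Surjective M.toNichols :=
  Ideal.Quotient.mkₐ_surjective k M.nicholsIdeal

theorem ker_toNichols (M : YDModule k (MonoidAlgebra k G) V) :
    LinearMap.ker M.toNichols.toLinearMap = M.nicholsIdeal.restrictScalars k := by
  ext x
  exact Ideal.Quotient.eq_zero_iff_mem

/-- The Yetter-Drinfeld module structure of the Nichols algebra. -/
def nichols (M : YDModule k (MonoidAlgebra k G) V) : YDModule k (MonoidAlgebra k G) M.Nichols :=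
  M.tensor.quotient M.toNichols.toLinearMap M.toNichols_surjective
    (M.ker_toNichols ▸ M.isNicholsRelation_nicholsIdeal.isSub)

/-- The comultiplication of the Nichols algebra. -/
def nicholsComul (M : YDModule k (MonoidAlgebra k G) V) :
    M.Nichols →ₗ[k] M.Nichols ⊗[k] M.Nichols :=
  LinearMap.descend M.toNichols.toLinearMap M.toNichols_surjective
    (TensorProduct.map M.toNichols.toLinearMap M.toNichols.toLinearMap ∘ₗ M.tensorComul) (by
      rw [ker_toNichols]
      intro x hx
      rw [LinearMap.mem_ker, LinearMap.comp_apply]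
      refine (?_ : _ ⊔ _ ≤ LinearMap.ker (TensorProduct.map M.toNichols.toLinearMap
        M.toNichols.toLinearMap)) (M.isNicholsRelation_nicholsIdeal.coideal x hx)
      rw [← M.ker_toNichols]
      refine sup_le ?_ ?_
      · rintro _ ⟨t, rfl⟩
        rw [LinearMap.mem_ker]
        induction t with
        | zero => simp
        | add a b ha hb => simp only [map_add, ha, hb, add_zero]
        | tmul a b =>
          have : M.toNichols.toLinearMap a = 0 := a.2
          rw [LinearMap.rTensor_tmul, TensorProduct.map_tmul, Submodule.subtype_apply, this,
            TensorProduct.zero_tmul]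
      · rintro _ ⟨t, rfl⟩
        rw [LinearMap.mem_ker]
        induction t with
        | zero => simp
        | add a b ha hb => simp only [map_add, ha, hb, add_zero]
        | tmul a b =>
          have : M.toNichols.toLinearMap b = 0 := b.2
          rw [LinearMap.lTensor_tmul, TensorProduct.map_tmul, Submodule.subtype_apply, this,
            TensorProduct.tmul_zero])

/-- The counit of the Nichols algebra, induced by `T(V) → k`, `v ↦ 0` on `V`. -/
def nicholsCounit (M : YDModule k (MonoidAlgebra k G) V) : M.Nichols →ₗ[k] k :=
  LinearMap.descend M.toNichols.toLinearMap M.toNichols_surjective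
    (TensorAlgebra.algebraMapInv (R := k) (M := V)).toLinearMap (by
      rw [ker_toNichols]
      refine M.isNicholsRelation_nicholsIdeal.two_le_degree.trans (iSup_le fun n => ?_)
      rw [pow_succ]
      refine Submodule.mul_le.2 ?_
      rintro a _ _ ⟨v, rfl⟩
      simp [TensorAlgebra.algebraMapInv])

/-- The homogeneous components of the Nichols algebra. -/
def nicholsGrading (M : YDModule k (MonoidAlgebra k G) V) (n : ℕ) : Submodule k M.Nichols :=
  ((LinearMap.range (TensorAlgebra.ι k (M := V))) ^ n).map M.toNichols.toLinearMap

end YDModule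

/-- An isomorphism of graded braided Hopf algebras from the Nichols algebra of `M` to the pullback
`^{φ⁻¹}_φ` of the Nichols algebra of `N` along a Hopf algebra isomorphism `φ : kG → kG'`. -/
structure NicholsIso {G' V' : Type*} [Group G'] [AddCommGroup V'] [Module k V']
    (φ : MonoidAlgebra k G ≃ₐc[k] MonoidAlgebra k G') (M : YDModule k (MonoidAlgebra k G) V)
    (N : YDModule k (MonoidAlgebra k G') V') extends YDIso φ M.nichols N.nichols where
  map_one : toFun 1 = 1
  map_mul : ∀ x y, toFun (x * y) = toFun x * toFun y
  map_comul : ∀ x, TensorProduct.map toLinearMap toLinearMap (M.nicholsComul x) =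
    N.nicholsComul (toFun x)
  map_counit : ∀ x, N.nicholsCounit (toFun x) = M.nicholsCounit x
  map_grading : ∀ n, (M.nicholsGrading n).map toLinearMap = N.nicholsGrading n

end Nichols

section SubBialgebra

variable {k A : Type*} [Field k] [Ring A] [Bialgebra k A]

/-- The inclusion `S ⊗ S → A ⊗ A`. -/
def Subalgebra.tensorVal (S : Subalgebra k A) : S ⊗[k] S →ₐ[k] A ⊗[k] A :=
  Algebra.TensorProduct.map S.val S.val

theorem Subalgebra.tensorVal_injective (S : Subalgebra k A) :
    Function.Injective S.tensorVal :=
  TensorProduct.map_injective_of_flat_flat _ _ Subtype.val_injective Subtype.val_injective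

/-- The comultiplication of a subalgebra `S` with `Δ(S) ⊆ S ⊗ S`. -/
def Subalgebra.comulOfLE (S : Subalgebra k A)
    (h : S ≤ S.tensorVal.range.comap (Bialgebra.comulAlgHom k A)) : S →ₐ[k] S ⊗[k] S :=
  (AlgEquiv.ofInjective S.tensorVal S.tensorVal_injective).symm.toAlgHom.comp
    (((Bialgebra.comulAlgHom k A).comp S.val).codRestrict S.tensorVal.range fun x => h x.2)

theorem Subalgebra.tensorVal_comulOfLE (S : Subalgebra k A)
    (h : S ≤ S.tensorVal.range.comap (Bialgebra.comulAlgHom k A)) (x : S) :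
    S.tensorVal (S.comulOfLE h x) = Coalgebra.comul (R := k) (x : A) := by
  have := congrArg Subtype.val ((AlgEquiv.ofInjective S.tensorVal S.tensorVal_injective).apply_symm_apply
    ((((Bialgebra.comulAlgHom k A).comp S.val).codRestrict S.tensorVal.range fun x => h x.2) x))
  exact this

/-- The bialgebra structure on an algebra `B` which embeds into a bialgebra `A`, where the
comultiplication of `A` restricts to `B`. -/
abbrev bialgebraOfInjective {B : Type*} [Ring B] [Algebra k B] (i : B →ₐ[k] A)
    (hi : Function.Injective i) (c : B →ₐ[k] B ⊗[k] B)
    (hc : ∀ x, Algebra.TensorProduct.map i i (c x) = Coalgebra.comul (R := k) (i x)) :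
    Bialgebra k B :=
  Bialgebra.ofAlgHom c ((Bialgebra.counitAlgHom k A).comp i)
    (by
      ext x
      have hinj : Function.Injective (TensorProduct.map i.toLinearMap
          (TensorProduct.map i.toLinearMap i.toLinearMap)) :=
        TensorProduct.map_injective_of_flat_flat _ _ hi
          (TensorProduct.map_injective_of_flat_flat _ _ hi hi)
      apply hinj
      have hx := Coalgebra.coassoc_apply (R := k) (i x)
      rw [← hc] at hx
      have h1 : ∀ t : B ⊗[k] B, TensorProduct.map i.toLinearMap
          (TensorProduct.map i.toLinearMap i.toLinearMap)
          (TensorProduct.assoc k B B B (c.toLinearMap.rTensor B t)) =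
          TensorProduct.assoc k A A A ((Coalgebra.comul (R := k) (A := A)).rTensor A
            (Algebra.TensorProduct.map i i t)) := fun t => by
        induction t with
        | zero => simp
        | add t u ht hu => simp only [map_add, ht, hu]
        | tmul a b =>
          rw [Algebra.TensorProduct.map_tmul, LinearMap.rTensor_tmul, LinearMap.rTensor_tmul, ← hc]
          simp only [AlgHom.toLinearMap_apply]
          generalize c a = u
          induction u with
          | zero => simp
          | add t u ht hu => simp only [map_add, TensorProduct.add_tmul, ht, hu]
          | tmul c d => rfl
      have h2 : ∀ t : B ⊗[k] B, TensorProduct.map i.toLinearMap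
          (TensorProduct.map i.toLinearMap i.toLinearMap) (c.toLinearMap.lTensor B t) =
            (Coalgebra.comul (R := k) (A := A)).lTensor A
              (Algebra.TensorProduct.map i i t) := fun t => by
        induction t with
        | zero => simp
        | add t u ht hu => simp only [map_add, ht, hu]
        | tmul a b =>
          rw [Algebra.TensorProduct.map_tmul, LinearMap.lTensor_tmul, LinearMap.lTensor_tmul, ← hc]
          rfl
      exact (h1 _).trans (hx.trans (h2 _).symm))
    (by
      ext x
      have hinj : Function.Injective (i.toLinearMap.lTensor k) :=
        Module.Flat.lTensor_preserves_injective_linearMap _ hi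
      apply hinj
      have hx := Coalgebra.rTensor_counit_comul (R := k) (i x)
      rw [← hc] at hx
      have h1 : ∀ t : B ⊗[k] B, i.toLinearMap.lTensor k
          (((Bialgebra.counitAlgHom k A).comp i).toLinearMap.rTensor B t) =
          (Coalgebra.counit (R := k) (A := A)).rTensor A
            (Algebra.TensorProduct.map i i t) := fun t => by
        induction t with
        | zero => simp
        | add t u ht hu => simp only [map_add, ht, hu]
        | tmul a b => rfl
      exact (h1 _).trans hx)
    (by
      ext x
      have hinj : Function.Injective (i.toLinearMap.rTensor k) :=
        Module.Flat.rTensor_preserves_injective_linearMap _ hi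
      apply hinj
      have hx := Coalgebra.lTensor_counit_comul (R := k) (i x)
      rw [← hc] at hx
      have h1 : ∀ t : B ⊗[k] B, i.toLinearMap.rTensor k
          (((Bialgebra.counitAlgHom k A).comp i).toLinearMap.lTensor B t) =
          (Coalgebra.counit (R := k) (A := A)).lTensor A
            (Algebra.TensorProduct.map i i t) := fun t => by
        induction t with
        | zero => simp
        | add t u ht hu => simp only [map_add, ht, hu]
        | tmul a b => rfl
      exact (h1 _).trans hx)

/-- A subalgebra `S` of a bialgebra with `Δ(S) ⊆ S ⊗ S` is a bialgebra. -/
abbrev Subalgebra.bialgebraOfLE (S : Subalgebra k A)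
    (h : S ≤ S.tensorVal.range.comap (Bialgebra.comulAlgHom k A)) : Bialgebra k S :=
  bialgebraOfInjective S.val Subtype.val_injective (S.comulOfLE h) (S.tensorVal_comulOfLE h)

end SubBialgebra

section Paths

/-- A quiver on the vertex set `G` with a `kG`-Hopf bimodule structure on the arrow comodule, in
which group elements send arrows to multiples of arrows. For every vertex `x` the arrows with
source `x` are labelled by `L`; the arrow `(x, ℓ)` goes from `x` to `x * deg ℓ`. The coactions
are `δ⁻(a) = t(a) ⊗ a` and `δ⁺(a) = a ⊗ s(a)`, and the actions are `h · (x, ℓ) = (h * x, ℓ)` and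
`(x, ℓ) · h = coef ℓ h (x * h, shift ℓ h)`. -/
structure ArrowBimodule (k G L : Type*) [Field k] [Group G] where
  deg : L → G
  shift : L → G → L
  coef : L → G → k
  shift_one : ∀ a, shift a 1 = a
  shift_mul : ∀ a g h, shift a (g * h) = shift (shift a g) h
  coef_one : ∀ a, coef a 1 = 1
  coef_mul : ∀ a g h, coef a (g * h) = coef a g * coef (shift a g) h
  deg_shift : ∀ a h, deg (shift a h) = h⁻¹ * deg a * h

namespace ArrowBimodule

variable {k G L : Type*} [Field k] [Group G]

/-- The linear map on words which puts the letter `a` in front. -/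
def cons (k : Type*) {L : Type*} [Field k] (a : L) : (List L →₀ k) →ₗ[k] (List L →₀ k) :=
  Finsupp.lmapDomain k k (List.cons a)

@[simp]
theorem cons_single (a : L) (w : List L) (r : k) :
    cons k a (Finsupp.single w r) = Finsupp.single (a :: w) r := by
  simp [cons]

/-- The product of a path with label word `w` and a path with source `y` and label word `v`, as a
combination of label words. The first arrow of a path which occurs in the product is either
the first arrow `a` of the left factor, moved by the right action of `y`, or the first arrow `b` of
the right factor. -/
def shuffleWord (D : ArrowBimodule k G L) : List L → G → List L → (List L →₀ k)
  | [], _, v => Finsupp.single v 1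
  | a :: w, y, [] => D.coef a y • cons k (D.shift a y) (D.shuffleWord w y [])
  | a :: w, y, b :: v => D.coef a y • cons k (D.shift a y) (D.shuffleWord w y (b :: v)) +
      cons k b (D.shuffleWord (a :: w) (y * D.deg b) v)
  termination_by w _ v => w.length + v.length

/-- The bilinear extension of `shuffleWord`. -/
def shuffle (D : ArrowBimodule k G L) (y : G) :
    (List L →₀ k) →ₗ[k] (List L →₀ k) →ₗ[k] (List L →₀ k) :=
  Finsupp.linearCombination k fun w => Finsupp.linearCombination k fun v => D.shuffleWord w y v

variable (D : ArrowBimodule k G L)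

theorem shuffle_single (y : G) (w v : List L) :
    D.shuffle y (Finsupp.single w 1) (Finsupp.single v 1) = D.shuffleWord w y v := by
  simp [shuffle]

theorem shuffle_nil_left (y : G) (f : List L →₀ k) :
    D.shuffle y (Finsupp.single [] 1) f = f := by
  induction f using Finsupp.induction_linear with
  | zero => simp
  | add f g hf hg => simp only [map_add, hf, hg]
  | single v r => simp [shuffle, shuffleWord]

theorem shuffle_cons_nil (y : G) (a : L) (f : List L →₀ k) :
    D.shuffle y (cons k a f) (Finsupp.single [] 1) =
      D.coef a y • cons k (D.shift a y) (D.shuffle y f (Finsupp.single [] 1)) := by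
  induction f using Finsupp.induction_linear with
  | zero => simp
  | add f g hf hg => simp only [map_add, LinearMap.add_apply, hf, hg, smul_add]
  | single v r => simp [shuffle, shuffleWord, smul_comm r]

theorem shuffle_cons_cons (y : G) (a b : L) (f g : List L →₀ k) :
    D.shuffle y (cons k a f) (cons k b g) =
      D.coef a y • cons k (D.shift a y) (D.shuffle y f (cons k b g)) +
      cons k b (D.shuffle (y * D.deg b) (cons k a f) g) := by
  induction f using Finsupp.induction_linear with
  | zero => simp
  | add f g hf hg => simp only [map_add, LinearMap.add_apply, hf, hg, smul_add]; abel
  | single w r =>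
    induction g using Finsupp.induction_linear with
    | zero => simp
    | add f g hf hg => simp only [map_add, hf, hg, smul_add]; abel
    | single v s => simp [shuffle, shuffleWord, smul_comm _ (D.coef a y)]

theorem shuffle_nil_right (f : List L →₀ k) :
    D.shuffle 1 f (Finsupp.single [] 1) = f := by
  induction f using Finsupp.induction_linear with
  | zero => simp
  | add f g hf hg => simp only [map_add, LinearMap.add_apply, hf, hg]
  | single w r =>
    have : ∀ w : List L, D.shuffle 1 (Finsupp.single w 1) (Finsupp.single [] 1) =
        Finsupp.single w 1 := fun w => by
      induction w with
      | nil => rw [shuffle_nil_left]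
      | cons a w ih =>
        rw [← cons_single, shuffle_cons_nil, ih, D.coef_one, D.shift_one, one_smul]
    have h1 : (Finsupp.single w r : List L →₀ k) = r • Finsupp.single w 1 := by
      rw [Finsupp.smul_single, smul_eq_mul, mul_one]
    rw [h1, map_smul, LinearMap.smul_apply, this]

theorem shuffle_assoc_single (n : ℕ) : ∀ (w v t : List L) (y z : G),
    w.length + v.length + t.length ≤ n →
    D.shuffle z (D.shuffle y (Finsupp.single w 1) (Finsupp.single v 1)) (Finsupp.single t 1) =
    D.shuffle (y * z) (Finsupp.single w 1)
      (D.shuffle z (Finsupp.single v 1) (Finsupp.single t 1)) := by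
  induction n with
  | zero =>
    intro w v t y z h
    obtain rfl : w = [] := List.length_eq_zero_iff.1 (by omega)
    simp only [shuffle_nil_left]
  | succ n ih =>
    intro w v t y z h
    match w, v, t with
    | [], v, t => simp only [shuffle_nil_left]
    | a :: w, [], [] =>
      have h1 := ih w [] [] y z (by simp at h ⊢; omega)
      simp only [shuffle_nil_left] at h1 ⊢
      rw [← cons_single, shuffle_cons_nil, map_smul, LinearMap.smul_apply, shuffle_cons_nil,
        shuffle_cons_nil, h1, D.coef_mul, D.shift_mul, smul_smul]
    | a :: w, [], c :: t =>
      have h1 := ih w [] (c :: t) y z (by simp at h ⊢; omega)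
      have h2 := ih (a :: w) [] t y (z * D.deg c) (by simp at h ⊢; omega)
      simp only [shuffle_nil_left, ← cons_single] at h1 h2 ⊢
      rw [shuffle_cons_nil, map_smul, LinearMap.smul_apply] at h2 ⊢
      rw [shuffle_cons_cons, shuffle_cons_cons, h1, D.coef_mul, D.shift_mul, mul_assoc y z, ← h2,
        map_smul]
      module
    | a :: w, b :: v, [] =>
      have h1 := ih w (b :: v) [] y z (by simp at h ⊢; omega)
      have h2 := ih (a :: w) v [] (y * D.deg b) z (by simp at h ⊢; omega)
      simp only [← cons_single] at h1 h2 ⊢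
      have hd : y * z * D.deg (D.shift b z) = y * D.deg b * z := by rw [D.deg_shift]; group
      rw [D.shuffle_cons_cons y, map_add, map_smul, LinearMap.add_apply, LinearMap.smul_apply,
        shuffle_cons_nil, shuffle_cons_nil, h1, h2, shuffle_cons_nil]
      simp only [map_smul]
      rw [shuffle_cons_cons, hd, D.coef_mul, D.shift_mul]
      module
    | a :: w, b :: v, c :: t =>
      have h1 := ih w (b :: v) (c :: t) y z (by simp at h ⊢; omega)
      have h2 := ih (a :: w) v (c :: t) (y * D.deg b) z (by simp at h ⊢; omega)
      have h3 := ih (a :: w) (b :: v) t y (z * D.deg c) (by simp at h ⊢; omega)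
      simp only [← cons_single] at h1 h2 h3 ⊢
      have hd : y * z * D.deg (D.shift b z) = y * D.deg b * z := by rw [D.deg_shift]; group
      rw [D.shuffle_cons_cons z b c, map_add, map_smul] at h1 ⊢
      rw [D.shuffle_cons_cons y] at h3 ⊢
      simp only [map_add, map_smul, LinearMap.add_apply, LinearMap.smul_apply] at h1 h3 ⊢
      rw [shuffle_cons_cons, shuffle_cons_cons, shuffle_cons_cons, shuffle_cons_cons, h1, h2, hd,
        D.coef_mul, D.shift_mul, mul_assoc y z, ← h3]
      simp only [map_add, map_smul]
      module

theorem shuffle_assoc (y z : G) (f g h : List L →₀ k) :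
    D.shuffle z (D.shuffle y f g) h = D.shuffle (y * z) f (D.shuffle z g h) := by
  have h1 : ∀ (w : List L) (r : k), (Finsupp.single w r : List L →₀ k) = r • Finsupp.single w 1 :=
    fun w r => by rw [Finsupp.smul_single, smul_eq_mul, mul_one]
  induction f using Finsupp.induction_linear with
  | zero => simp
  | add f g hf hg => simp only [map_add, LinearMap.add_apply, hf, hg]
  | single w r =>
    induction g using Finsupp.induction_linear with
    | zero => simp
    | add f g hf hg => simp only [map_add, LinearMap.add_apply, hf, hg]
    | single v s =>
      induction h using Finsupp.induction_linear with
      | zero => simp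
      | add f g hf hg => simp only [map_add, hf, hg]
      | single t q =>
        rw [h1 w, h1 v, h1 t]
        simp only [map_smul, LinearMap.smul_apply]
        rw [D.shuffle_assoc_single _ w v t y z le_rfl]

/-- The path coalgebra `kQᶜ`. A basis is given by the paths; the pair `(x, [ℓ₁, …, ℓₙ])` stands for
the path of length `n` with source `x` whose arrows have, in the order in which they are passed,
the labels `ℓ₁, …, ℓₙ`. -/
def PathCoalgebra (_D : ArrowBimodule k G L) : Type _ := (G × List L) →₀ k

namespace PathCoalgebra

instance : AddCommGroup D.PathCoalgebra := inferInstanceAs (AddCommGroup ((G × List L) →₀ k))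

instance : Module k D.PathCoalgebra := inferInstanceAs (Module k ((G × List L) →₀ k))

/-- The path with source `x` and label word `w`. -/
def path (x : G) (w : List L) : D.PathCoalgebra := (Finsupp.single (x, w) 1 : (G × List L) →₀ k)

/-- The linear extension of a function on paths. -/
def lift {X : Type*} [AddCommGroup X] [Module k X] (f : G → List L → X) :
    D.PathCoalgebra →ₗ[k] X :=
  (Finsupp.linearCombination k fun p : G × List L => f p.1 p.2 : ((G × List L) →₀ k) →ₗ[k] X)

@[simp]
theorem lift_path {X : Type*} [AddCommGroup X] [Module k X] (f : G → List L → X) (x : G)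
    (w : List L) : lift D f (path D x w) = f x w :=
  (Finsupp.linearCombination_single k 1 (x, w)).trans (one_smul k _)

theorem hom_ext {X : Type*} [AddCommGroup X] [Module k X] {f g : D.PathCoalgebra →ₗ[k] X}
    (h : ∀ x w, f (path D x w) = g (path D x w)) : f = g := by
  refine Finsupp.lhom_ext' fun p => LinearMap.ext_ring ?_
  exact h p.1 p.2

@[elab_as_elim]
theorem induction_path {P : D.PathCoalgebra → Prop} (f : D.PathCoalgebra) (zero : P 0)
    (add : ∀ f g, P f → P g → P (f + g)) (smul : ∀ (r : k) (x : G) (w : List L),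
      P (r • path D x w)) : P f := by
  refine Finsupp.induction_linear (motive := P) f zero add fun p r => ?_
  have : (Finsupp.single p r : (G × List L) →₀ k) = r • Finsupp.single p 1 := by
    rw [Finsupp.smul_single, smul_eq_mul, mul_one]
  rw [this]
  exact smul r p.1 p.2

/-- Combinations of words as combinations of paths with source `x`. -/
def ofWord (x : G) : (List L →₀ k) →ₗ[k] D.PathCoalgebra :=
  Finsupp.linearCombination k fun w => path D x w

@[simp]
theorem ofWord_single (x : G) (w : List L) :
    ofWord D x (Finsupp.single w 1) = path D x w := by
  simp [ofWord]

/-- The product of the path coalgebra, which is the graded coalgebra map determined by the product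
of `kG` in degree zero and by the two actions of `kG` on the arrows in degree one. -/
def mulₗ : D.PathCoalgebra →ₗ[k] D.PathCoalgebra →ₗ[k] D.PathCoalgebra :=
  lift D fun x w => lift D fun y v => ofWord D (x * y) (D.shuffleWord w y v)

instance : Mul D.PathCoalgebra := ⟨fun f g => mulₗ D f g⟩

instance : One D.PathCoalgebra := ⟨path D 1 []⟩

theorem mul_def (f g : D.PathCoalgebra) : f * g = mulₗ D f g := rfl

theorem one_def : (1 : D.PathCoalgebra) = path D 1 [] := rfl

theorem path_mul_path (x y : G) (w v : List L) :
    path D x w * path D y v = ofWord D (x * y) (D.shuffleWord w y v) := by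
  simp [mul_def, mulₗ]

theorem ofWord_mul_ofWord (x y : G) (f g : List L →₀ k) :
    ofWord D x f * ofWord D y g = ofWord D (x * y) (D.shuffle y f g) := by
  rw [mul_def]
  induction f using Finsupp.induction_linear with
  | zero => simp
  | add f g hf hg => simp only [map_add, LinearMap.add_apply, hf, hg]
  | single w r =>
    induction g using Finsupp.induction_linear with
    | zero => simp
    | add f g hf hg => simp only [map_add, hf, hg]
    | single v s => simp [ofWord, shuffle, mulₗ, smul_comm s r]

instance : Ring D.PathCoalgebra where
  __ := (inferInstance : AddCommGroup D.PathCoalgebra)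
  left_distrib f g h := by simp only [mul_def, map_add]
  right_distrib f g h := by simp only [mul_def, map_add, LinearMap.add_apply]
  zero_mul f := by simp only [mul_def, map_zero, LinearMap.zero_apply]
  mul_zero f := by simp only [mul_def, map_zero]
  mul_assoc f g h := by
    simp only [mul_def]
    induction f using induction_path with
    | zero => simp
    | add f f' hf hf' => simp only [map_add, LinearMap.add_apply, hf, hf']
    | smul r x w =>
      induction g using induction_path with
      | zero => simp
      | add f f' hf hf' => simp only [map_add, LinearMap.add_apply, hf, hf']
      | smul s y v =>
        induction h using induction_path with
        | zero => simp
        | add f f' hf hf' => simp only [map_add, hf, hf']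
        | smul q z t =>
          simp only [map_smul, LinearMap.smul_apply, ← mul_def]
          rw [← ofWord_single, ← ofWord_single, ← ofWord_single, ofWord_mul_ofWord,
            ofWord_mul_ofWord, ofWord_mul_ofWord, ofWord_mul_ofWord, shuffle_assoc, mul_assoc]
  one_mul f := by
    have : mulₗ D 1 = LinearMap.id := hom_ext D fun x w => by
      rw [← mul_def, one_def, ← ofWord_single, ← ofWord_single, ofWord_mul_ofWord,
        shuffle_nil_left, one_mul, LinearMap.id_apply]
    rw [mul_def, this, LinearMap.id_apply]
  mul_one f := by
    have : (mulₗ D).flip 1 = LinearMap.id := hom_ext D fun x w => by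
      rw [LinearMap.flip_apply, ← mul_def, one_def, ← ofWord_single, ← ofWord_single,
        ofWord_mul_ofWord, shuffle_nil_right, mul_one, LinearMap.id_apply]
    rw [mul_def, ← LinearMap.flip_apply, this, LinearMap.id_apply]

instance : Algebra k D.PathCoalgebra :=
  Algebra.ofModule (fun r f g => by simp only [mul_def, map_smul, LinearMap.smul_apply])
    (fun r f g => by simp only [mul_def, map_smul])

instance : CoalgebraStruct k D.PathCoalgebra where
  comul := lift D fun x w => ∑ i ∈ Finset.range (w.length + 1),
    path D (x * ((w.take i).map D.deg).prod) (w.drop i) ⊗ₜ[k] path D x (w.take i)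
  counit := lift D fun _ w => if w = [] then 1 else 0

theorem comul_path (x : G) (w : List L) : Coalgebra.comul (R := k) (path D x w) =
    ∑ i ∈ Finset.range (w.length + 1),
      path D (x * ((w.take i).map D.deg).prod) (w.drop i) ⊗ₜ[k] path D x (w.take i) := by
  simp [CoalgebraStruct.comul]

theorem counit_path (x : G) (w : List L) : Coalgebra.counit (R := k) (path D x w) =
    if w = [] then 1 else 0 := by
  simp [CoalgebraStruct.counit]

/-- The comultiplication of the paths with source `x`, where the right tensor factor, whose source
is always `x`, is given by its label word. -/
def cut (x : G) : (List L →₀ k) →ₗ[k] D.PathCoalgebra ⊗[k] (List L →₀ k) :=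
  Finsupp.linearCombination k fun w => ∑ i ∈ Finset.range (w.length + 1),
    path D (x * ((w.take i).map D.deg).prod) (w.drop i) ⊗ₜ[k] Finsupp.single (w.take i) 1

theorem comul_ofWord (x : G) (f : List L →₀ k) : Coalgebra.comul (R := k) (ofWord D x f) =
    (ofWord D x).lTensor D.PathCoalgebra (cut D x f) := by
  induction f using Finsupp.induction_linear with
  | zero => simp
  | add f g hf hg => simp only [map_add, hf, hg]
  | single w r => simp [cut, ofWord, comul_path]

theorem cut_nil (x : G) :
    cut D x (Finsupp.single [] 1) = path D x [] ⊗ₜ[k] Finsupp.single [] 1 := by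
  simp [cut]

theorem cut_cons (x : G) (a : L) (f : List L →₀ k) : cut D x (cons k a f) =
    ofWord D x (cons k a f) ⊗ₜ[k] Finsupp.single [] 1 +
      (cons k a).lTensor D.PathCoalgebra (cut D (x * D.deg a) f) := by
  induction f using Finsupp.induction_linear with
  | zero => simp
  | add f g hf hg => simp only [map_add, TensorProduct.add_tmul, hf, hg]; abel
  | single w r =>
    rw [cons_single]
    simp only [cut, Finsupp.linearCombination_single, map_smul, List.length_cons]
    rw [Finset.sum_range_succ']
    simp [ofWord, mul_assoc, add_comm, TensorProduct.smul_tmul']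

/-- The product `(p ⊗ f)(q ⊗ g) = p q ⊗ shuffle f g` where the source of `g` is `y`. -/
def cutMul (y : G) : D.PathCoalgebra ⊗[k] (List L →₀ k) →ₗ[k]
    D.PathCoalgebra ⊗[k] (List L →₀ k) →ₗ[k] D.PathCoalgebra ⊗[k] (List L →₀ k) :=
  TensorProduct.map₂ (mulₗ D) (D.shuffle y)

theorem cutMul_top (x y : G) (f g : List L →₀ k) :
    cutMul D y (ofWord D x f ⊗ₜ Finsupp.single [] 1) (ofWord D y g ⊗ₜ Finsupp.single [] 1) =
    ofWord D (x * y) (D.shuffle y f g) ⊗ₜ Finsupp.single [] 1 := by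
  simp [cutMul, ← mul_def, ofWord_mul_ofWord, shuffle_nil_left]

theorem cutMul_nil_cons (y z : G) (b : L) (p : D.PathCoalgebra)
    (B : D.PathCoalgebra ⊗[k] (List L →₀ k)) :
    cutMul D y (p ⊗ₜ Finsupp.single [] 1) ((cons k b).lTensor D.PathCoalgebra B) =
    (cons k b).lTensor D.PathCoalgebra (cutMul D z (p ⊗ₜ Finsupp.single [] 1) B) := by
  induction B with
  | zero => simp
  | add B C hB hC => simp only [map_add, hB, hC]
  | tmul q g => simp [cutMul, shuffle_nil_left]

theorem cutMul_cons_nil (y : G) (a : L) (q : D.PathCoalgebra)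
    (A : D.PathCoalgebra ⊗[k] (List L →₀ k)) :
    cutMul D y ((cons k a).lTensor D.PathCoalgebra A) (q ⊗ₜ Finsupp.single [] 1) =
    D.coef a y • (cons k (D.shift a y)).lTensor D.PathCoalgebra
      (cutMul D y A (q ⊗ₜ Finsupp.single [] 1)) := by
  induction A with
  | zero => simp
  | add B C hB hC => simp only [map_add, LinearMap.add_apply, hB, hC, smul_add]
  | tmul p f => simp [cutMul, shuffle_cons_nil]

theorem cutMul_cons_cons (y : G) (a b : L) (A B : D.PathCoalgebra ⊗[k] (List L →₀ k)) :
    cutMul D y ((cons k a).lTensor D.PathCoalgebra A) ((cons k b).lTensor D.PathCoalgebra B) =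
    D.coef a y • (cons k (D.shift a y)).lTensor D.PathCoalgebra
      (cutMul D y A ((cons k b).lTensor D.PathCoalgebra B)) +
    (cons k b).lTensor D.PathCoalgebra
      (cutMul D (y * D.deg b) ((cons k a).lTensor D.PathCoalgebra A) B) := by
  induction A with
  | zero => simp
  | add A C hA hC => simp only [map_add, LinearMap.add_apply, hA, hC, smul_add]; abel
  | tmul p f =>
    induction B with
    | zero => simp
    | add B C hB hC => simp only [map_add, hB, hC, smul_add]; abel
    | tmul q g => simp [cutMul, shuffle_cons_cons, TensorProduct.tmul_add]

theorem cut_shuffle (n : ℕ) : ∀ (w v : List L) (x y : G), w.length + v.length ≤ n →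
    cut D (x * y) (D.shuffle y (Finsupp.single w 1) (Finsupp.single v 1)) =
    cutMul D y (cut D x (Finsupp.single w 1)) (cut D y (Finsupp.single v 1)) := by
  induction n with
  | zero =>
    intro w v x y h
    obtain rfl : w = [] := List.length_eq_zero_iff.1 (by omega)
    obtain rfl : v = [] := List.length_eq_zero_iff.1 (by omega)
    simp [shuffle_nil_left, cut_nil, cutMul, ← mul_def, path_mul_path, shuffleWord]
  | succ n ih =>
    intro w v x y h
    match w, v with
    | [], [] => simp [shuffle_nil_left, cut_nil, cutMul, ← mul_def, path_mul_path, shuffleWord]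
    | [], b :: v =>
      have h1 := ih [] v x (y * D.deg b) (by simp at h ⊢; omega)
      rw [cut_nil, shuffle_nil_left] at h1
      rw [cut_nil, ← cons_single, cut_cons, map_add, cutMul_nil_cons D y (y * D.deg b), ← h1,
        ← ofWord_single D x [], cutMul_top, shuffle_nil_left, cut_cons, mul_assoc]
    | a :: w, [] =>
      have h1 := ih w [] (x * D.deg a) y (by simp at h ⊢; omega)
      have hd : x * y * D.deg (D.shift a y) = x * D.deg a * y := by rw [D.deg_shift]; group
      rw [cut_nil, ← ofWord_single D y []] at h1 ⊢
      rw [← cons_single, cut_cons, map_add, LinearMap.add_apply, cutMul_top, cutMul_cons_nil, ← h1,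
        shuffle_cons_nil, map_smul, cut_cons, hd, map_smul, smul_add, TensorProduct.smul_tmul']
    | a :: w, b :: v =>
      have h1 := ih w (b :: v) (x * D.deg a) y (by simp at h ⊢; omega)
      have h2 := ih (a :: w) v x (y * D.deg b) (by simp at h ⊢; omega)
      have hd : x * y * D.deg (D.shift a y) = x * D.deg a * y := by rw [D.deg_shift]; group
      simp only [← cons_single] at h1 h2 ⊢
      rw [cut_cons D y] at h1 ⊢
      rw [cut_cons D x] at h2 ⊢
      simp only [map_add, LinearMap.add_apply] at h1 h2 ⊢
      rw [cutMul_top, cutMul_nil_cons D y (y * D.deg b), cutMul_cons_nil, cutMul_cons_cons,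
        shuffle_cons_cons]
      simp only [map_add, map_smul, cut_cons, hd, h1, mul_assoc x y, h2, TensorProduct.add_tmul,
        ← TensorProduct.smul_tmul', smul_add]
      abel

theorem comul_mul (f g : D.PathCoalgebra) : Coalgebra.comul (R := k) (f * g) =
    Coalgebra.comul (R := k) f * Coalgebra.comul (R := k) g := by
  have key : ∀ (x y : G) (A B : D.PathCoalgebra ⊗[k] (List L →₀ k)),
      (ofWord D (x * y)).lTensor D.PathCoalgebra (cutMul D y A B) =
      (ofWord D x).lTensor D.PathCoalgebra A * (ofWord D y).lTensor D.PathCoalgebra B := by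
    intro x y A B
    induction A with
    | zero => simp
    | add A C hA hC => simp only [map_add, LinearMap.add_apply, hA, hC, add_mul]
    | tmul p f =>
      induction B with
      | zero => simp
      | add B C hB hC => simp only [map_add, hB, hC, mul_add]
      | tmul q g => simp [cutMul, ← mul_def, ofWord_mul_ofWord]
  rw [mul_def]
  induction f using induction_path with
  | zero => simp
  | add f f' hf hf' => simp only [map_add, LinearMap.add_apply, hf, hf', add_mul]
  | smul r x w =>
    induction g using induction_path with
    | zero => simp
    | add f f' hf hf' => simp only [map_add, hf, hf', mul_add]
    | smul s y v =>
      simp only [map_smul, LinearMap.smul_apply, ← mul_def, smul_mul_smul_comm]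
      rw [← ofWord_single, ← ofWord_single, ofWord_mul_ofWord, comul_ofWord, comul_ofWord,
        comul_ofWord, ← key, cut_shuffle D _ _ _ _ _ le_rfl, mul_smul, smul_comm]

theorem lTensor_cut_cons (x : G) (a : L) (t : D.PathCoalgebra ⊗[k] (List L →₀ k)) :
    (TensorProduct.assoc k _ _ _).symm ((cut D x).lTensor _ ((cons k a).lTensor _ t)) =
    (ofWord D x).lTensor _ ((cons k a).lTensor _ t) ⊗ₜ[k] Finsupp.single [] 1 +
    (cons k a).lTensor _
      ((TensorProduct.assoc k _ _ _).symm ((cut D (x * D.deg a)).lTensor _ t)) := by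
  induction t with
  | zero => simp
  | add t u ht hu => simp only [map_add, ht, hu, TensorProduct.add_tmul]; abel
  | tmul p f =>
    simp only [LinearMap.lTensor_tmul, cut_cons, TensorProduct.tmul_add, map_add,
      TensorProduct.assoc_symm_tmul]
    congr 1
    generalize cut D (x * D.deg a) f = u
    induction u with
    | zero => simp
    | add t u ht hu => simp only [map_add, ht, hu, TensorProduct.tmul_add]
    | tmul q g => simp

theorem cut_coassoc (w : List L) : ∀ x : G,
    (Coalgebra.comul (R := k) (A := D.PathCoalgebra)).rTensor _ (cut D x (Finsupp.single w 1)) =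
    (TensorProduct.assoc k _ _ _).symm ((cut D x).lTensor _ (cut D x (Finsupp.single w 1))) := by
  induction w with
  | nil => intro x; simp [cut_nil, comul_path]
  | cons a w ih =>
    intro x
    have h1 : ∀ t : D.PathCoalgebra ⊗[k] (List L →₀ k),
        (Coalgebra.comul (R := k) (A := D.PathCoalgebra)).rTensor _ ((cons k a).lTensor _ t) =
        (cons k a).lTensor _ ((Coalgebra.comul (R := k) (A := D.PathCoalgebra)).rTensor _ t) :=
      fun t => by
        rw [← LinearMap.comp_apply, ← LinearMap.comp_apply, LinearMap.lTensor_comp_rTensor,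
          LinearMap.rTensor_comp_lTensor]
    rw [← cons_single, cut_cons, map_add, map_add, map_add, lTensor_cut_cons, h1, ih,
      LinearMap.rTensor_tmul, comul_ofWord, cut_cons, map_add, LinearMap.lTensor_tmul,
      LinearMap.lTensor_tmul, cut_nil, TensorProduct.add_tmul, ofWord_single, TensorProduct.assoc_symm_tmul]
    abel

instance : Coalgebra k D.PathCoalgebra where
  coassoc := hom_ext D fun x w => by
    have h1 : ∀ t : D.PathCoalgebra ⊗[k] (List L →₀ k),
        (Coalgebra.comul (R := k) (A := D.PathCoalgebra)).rTensor _ ((ofWord D x).lTensor _ t) =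
        (ofWord D x).lTensor _ ((Coalgebra.comul (R := k) (A := D.PathCoalgebra)).rTensor _ t) :=
      fun t => by
        rw [← LinearMap.comp_apply, ← LinearMap.comp_apply, LinearMap.lTensor_comp_rTensor,
          LinearMap.rTensor_comp_lTensor]
    simp only [LinearMap.comp_apply]
    rw [← ofWord_single, comul_ofWord, h1, cut_coassoc]
    generalize cut D x (Finsupp.single w 1) = t
    induction t with
    | zero => simp
    | add t u ht hu => simp only [map_add, ht, hu]
    | tmul p f =>
      rw [LinearMap.lTensor_tmul, LinearMap.lTensor_tmul, LinearMap.lTensor_tmul, comul_ofWord]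
      generalize cut D x f = u
      induction u with
      | zero => simp
      | add t u ht hu => simp only [map_add, TensorProduct.tmul_add, ht, hu]
      | tmul q g => simp
  rTensor_counit_comp_comul := hom_ext D fun x w => by
    rw [LinearMap.comp_apply, comul_path, map_sum, Finset.sum_range_succ, Finset.sum_eq_zero]
    · simp [counit_path]
    · intro i hi
      have : w.drop i ≠ [] := by simpa using hi
      rw [LinearMap.rTensor_tmul, counit_path, if_neg this, TensorProduct.zero_tmul]
  lTensor_counit_comp_comul := hom_ext D fun x w => by
    rw [LinearMap.comp_apply, comul_path, map_sum, Finset.sum_range_succ', Finset.sum_eq_zero]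
    · simp [counit_path]
    · intro i hi
      have : w.take (i + 1) ≠ [] := by
        rintro h
        simp at h
        simp [h] at hi
      rw [LinearMap.lTensor_tmul, counit_path, if_neg this, TensorProduct.tmul_zero]

instance : Bialgebra k D.PathCoalgebra :=
  Bialgebra.mk' k D.PathCoalgebra
    (by rw [one_def, counit_path, if_pos rfl])
    (fun {f g} => by
      have h0 : ∀ (x : G) (a : L) (f : List L →₀ k),
          Coalgebra.counit (R := k) (ofWord D x (cons k a f)) = 0 := fun x a f => by
        induction f using Finsupp.induction_linear with
        | zero => simp
        | add f g hf hg => simp only [map_add, hf, hg, add_zero]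
        | single w r => simp [ofWord, counit_path]
      rw [mul_def]
      induction f using induction_path with
      | zero => simp
      | add f f' hf hf' => simp only [map_add, LinearMap.add_apply, hf, hf', add_mul]
      | smul r x w =>
        induction g using induction_path with
        | zero => simp
        | add f f' hf hf' => simp only [map_add, hf, hf', mul_add]
        | smul s y v =>
          have : Coalgebra.counit (R := k) (path D x w * path D y v) =
              Coalgebra.counit (R := k) (path D x w) * Coalgebra.counit (R := k) (path D y v) := by
            rw [path_mul_path, counit_path, counit_path]
            match w, v with
            | [], v => simp [shuffleWord, counit_path]
            | a :: w, [] => simp [shuffleWord, h0]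
            | a :: w, b :: v => simp [shuffleWord, h0]
          simp only [map_smul, LinearMap.smul_apply, ← mul_def, this, smul_mul_smul_comm]
          rw [smul_smul, mul_comm s r])
    (by simp [one_def, comul_path, Algebra.TensorProduct.one_def])
    (fun {f g} => comul_mul D f g)

/-- The span of the paths of length `n`. -/
def degree (n : ℕ) : Submodule k D.PathCoalgebra :=
  Submodule.span k {p | ∃ (x : G) (w : List L), w.length = n ∧ path D x w = p}

end PathCoalgebra

/-- The one-type-co-path Hopf algebra `kG[kQ₁ᶜ]`: the subalgebra of the path coalgebra which is
generated by `kG` (the vertices) and `kQ₁` (the arrows). -/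
def oneType : Subalgebra k D.PathCoalgebra :=
  Algebra.adjoin k (PathCoalgebra.degree D 0 ∪ PathCoalgebra.degree D 1)

theorem oneType_le_comap : D.oneType ≤
    D.oneType.tensorVal.range.comap (Bialgebra.comulAlgHom k D.PathCoalgebra) := by
  have h0 : ∀ x, PathCoalgebra.path D x [] ∈ D.oneType := fun x =>
    Algebra.subset_adjoin (Or.inl (Submodule.subset_span ⟨x, [], rfl, rfl⟩))
  have h1 : ∀ x a, PathCoalgebra.path D x [a] ∈ D.oneType := fun x a =>
    Algebra.subset_adjoin (Or.inr (Submodule.subset_span ⟨x, [a], rfl, rfl⟩))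
  have h2 : ∀ p ∈ D.oneType, ∀ q ∈ D.oneType, p ⊗ₜ[k] q ∈ D.oneType.tensorVal.range :=
    fun p hp q hq => ⟨⟨p, hp⟩ ⊗ₜ ⟨q, hq⟩, rfl⟩
  refine Algebra.adjoin_le ?_
  rintro p (hp | hp)
  · suffices h : PathCoalgebra.degree D 0 ≤ Subalgebra.toSubmodule (D.oneType.tensorVal.range.comap
        (Bialgebra.comulAlgHom k D.PathCoalgebra)) from h hp
    refine Submodule.span_le.2 ?_
    rintro _ ⟨x, w, hw, rfl⟩
    obtain rfl := List.length_eq_zero_iff.1 hw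
    change Coalgebra.comul (R := k) _ ∈ D.oneType.tensorVal.range
    rw [PathCoalgebra.comul_path]
    exact Subalgebra.sum_mem _ fun i _ => h2 _ (by simpa using h0 _) _ (by simpa using h0 _)
  · suffices h : PathCoalgebra.degree D 1 ≤ Subalgebra.toSubmodule (D.oneType.tensorVal.range.comap
        (Bialgebra.comulAlgHom k D.PathCoalgebra)) from h hp
    refine Submodule.span_le.2 ?_
    rintro _ ⟨x, w, hw, rfl⟩
    obtain ⟨a, rfl⟩ := List.length_eq_one_iff.1 hw
    change Coalgebra.comul (R := k) _ ∈ D.oneType.tensorVal.range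
    rw [PathCoalgebra.comul_path]
    refine Subalgebra.sum_mem _ fun i hi => ?_
    simp only [List.length_singleton, Finset.mem_range] at hi
    interval_cases i
    · exact h2 _ (by simpa using h1 _ a) _ (by simpa using h0 _)
    · exact h2 _ (by simpa using h0 _) _ (by simpa using h1 _ a)

instance : Bialgebra k D.oneType := D.oneType.bialgebraOfLE D.oneType_le_comap

/-- The homogeneous components of `kG[kQ₁ᶜ]`. -/
def oneTypeDegree (n : ℕ) : Submodule k D.oneType :=
  (PathCoalgebra.degree D n).comap D.oneType.val.toLinearMap

end ArrowBimodule

/-- Two one-type-co-path Hopf algebras are isomorphic as graded Hopf algebras. (A bialgebra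
isomorphism between Hopf algebras preserves the antipodes.) -/
def OneTypeIsomorphic {k G L G' L' : Type*} [Field k] [Group G] [Group G']
    (D : ArrowBimodule k G L) (D' : ArrowBimodule k G' L') : Prop :=
  ∃ e : D.oneType ≃ₐc[k] D'.oneType,
    ∀ n, (D.oneTypeDegree n).map (e : D.oneType →ₗ[k] D'.oneType) = D'.oneTypeDegree n

namespace ArrowBimodule

variable {k G L : Type*} [Field k] [Group G]

/-- The Yetter-Drinfeld module `(kQ₁¹, ad)` over `kG` which is spanned by the arrows with source
`1`, with the action `g ▷ a = g · a · g⁻¹` and the coaction `a ↦ t(a) ⊗ a`. -/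
def ad (D : ArrowBimodule k G L) :
    YDModule k (MonoidAlgebra k G) ({a : G × L // a.1 = 1} →₀ k) :=
  YDModule.monomial
    (fun a => a.1.1 * D.deg a.1.2)
    (fun g a => ⟨(g * a.1.1 * g⁻¹, D.shift a.1.2 g⁻¹), by simp [a.2]⟩)
    (fun g a => D.coef a.1.2 g⁻¹)
    (fun a => by
      apply Subtype.ext
      simp [D.shift_one])
    (fun g h a => by
      apply Subtype.ext
      simp [D.shift_mul, mul_assoc])
    (fun a => by simp [D.coef_one])
    (fun g h a => by simp [D.coef_mul])
    (fun g a => by simp [D.deg_shift, mul_assoc])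

end ArrowBimodule

end Paths

section Systems

/-- A map `u` which chooses an element `u C` in each conjugacy class `C`. -/
structure ClassReps (G : Type*) [Group G] where
  u : ConjClasses G → G
  mk_u : ∀ C, ConjClasses.mk (u C) = C

/-- Representatives `g_θ` of the cosets of the centralizers of the elements `u C`. The cosets are
indexed by the elements `g_θ⁻¹ (u C) g_θ` of the class `C`, and the trivial coset is represented
by `1`. -/
structure CosetReps {G : Type*} [Group G] (u : ClassReps G) where
  rep : ∀ C : ConjClasses G, C.carrier → G
  rep_conj : ∀ C c, (rep C c)⁻¹ * u.u C * rep C c = c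
  rep_u : ∀ C (c : C.carrier), (c : G) = u.u C → rep C c = 1

/-- A ramification system with characters over `G`: index sets `I C` for the conjugacy classes `C`
(the ramification is `r_C = #(I C)`), representatives `u C ∈ C`, and a character of the centralizer
of `u C` for every `i ∈ I C`. -/
structure RSC (k : Type uk) (G : Type uG) [Field k] [Group G] where
  I : ConjClasses G → Type uI
  u : ClassReps G
  χ : ∀ C, I C → (Subgroup.centralizer {u.u C} →* kˣ)

namespace RSC

variable {k G G' : Type*} [Field k] [Group G] [Group G']

/-- Isomorphism of ramification systems with characters. (The element `z'` is determined by `z`, and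
`φ (h_C⁻¹ * z * h_C)` lies in the centralizer of `u' (φ C)` by the first condition.) -/
def Iso (R : RSC k G) (R' : RSC k G') : Prop :=
  ∃ (φ : G ≃* G') (h : ConjClasses G → G)
    (f : ∀ C, R.I C ≃ R'.I (ConjClasses.map φ.toMonoidHom C)),
    (∀ C, φ ((h C)⁻¹ * R.u.u C * h C) = R'.u.u (ConjClasses.map φ.toMonoidHom C)) ∧
    ∀ (C : ConjClasses G) (i : R.I C) (z : Subgroup.centralizer {R.u.u C})
      (z' : Subgroup.centralizer {R'.u.u (ConjClasses.map φ.toMonoidHom C)}),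
      (z' : G') = φ ((h C)⁻¹ * z * h C) → R'.χ _ (f C i) z' = R.χ C i z

/-- The ramification is central: the classes `C` with `I C ≠ ∅` consist of one element. -/
def IsCentral (R : RSC k G) : Prop :=
  ∀ C, Nonempty (R.I C) → ∃ g, C.carrier = {g}

/-- The labels of the arrows with a given source `x`: the arrow `a^{(i)}_{xc,x}` from `x` to `x * c`,
where `c ∈ C` and `i ∈ I C`, has the label `⟨C, i, c⟩`. -/
abbrev Label (R : RSC k G) : Type _ := Σ C : ConjClasses G, R.I C × C.carrier

end RSC

section Conj

variable {G : Type*} [Group G]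

/-- The element `h⁻¹ c h` of the conjugacy class of `c`. -/
def conjInClass {C : ConjClasses G} (c : C.carrier) (h : G) : C.carrier :=
  ⟨h⁻¹ * c * h, by
    have hc := ConjClasses.mem_carrier_iff_mk_eq.1 c.2
    refine ConjClasses.mem_carrier_iff_mk_eq.2 (Eq.trans ?_ hc)
    rw [ConjClasses.mk_eq_mk_iff_isConj, isConj_iff]
    exact ⟨h, by group⟩⟩

/-- The element `ζ_θ(h) = g_θ h g_θ'⁻¹` of the centralizer of `u C`, where `θ'` is the coset of
`g_θ h`. -/
def CosetReps.zeta {u : ClassReps G} (T : CosetReps u) (C : ConjClasses G) (c : C.carrier) (h : G) :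
    Subgroup.centralizer {u.u C} :=
  ⟨T.rep C c * h * (T.rep C (conjInClass c h))⁻¹, by
    rw [Subgroup.mem_centralizer_singleton_iff]
    have h1 := T.rep_conj C c
    have h2 := T.rep_conj C (conjInClass c h)
    have h3 : u.u C * T.rep C c = T.rep C c * c := by rw [← h1]; group
    have h4 : u.u C * T.rep C (conjInClass c h) =
      T.rep C (conjInClass c h) * (h⁻¹ * c * h) := by
        change _ = _ * ((conjInClass c h : C.carrier) : G)
        rw [← h2]; group
    have h5 : (T.rep C (conjInClass c h))⁻¹ * u.u C =
        h⁻¹ * c * h * (T.rep C (conjInClass c h))⁻¹ := by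
      rw [inv_mul_eq_iff_eq_mul, ← mul_assoc, ← h4]; group
    rw [mul_assoc, h5]
    calc _ = T.rep C c * c * h * (T.rep C (conjInClass c h))⁻¹ := by group
      _ = _ := by rw [← h3]; group⟩

end Conj

namespace RSC

variable {k G : Type*} [Field k] [Group G]

/-- The `kG`-Hopf bimodule `(kQ₁ᶜ, G, r, χ, u)` of a ramification system with characters: the arrow
`a^{(i)}_{y,x}` with `x⁻¹ y = g_θ⁻¹ u(C) g_θ` satisfies `h · a^{(i)}_{y,x} = a^{(i)}_{hy,hx}` and
`a^{(i)}_{y,x} · h = χ_C^{(i)}(ζ_θ(h)) a^{(i)}_{yh,xh}`. -/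
def arrowBimodule (R : RSC k G) (T : CosetReps R.u) : ArrowBimodule k G R.Label where
  deg a := a.2.2
  shift a h := ⟨a.1, a.2.1, conjInClass a.2.2 h⟩
  coef a h := (R.χ a.1 a.2.1 (T.zeta a.1 a.2.2 h) : kˣ)
  shift_one a := by
    have : conjInClass a.2.2 1 = a.2.2 := by ext; simp [conjInClass]
    rw [this]
  shift_mul a g h := by
    have : conjInClass a.2.2 (g * h) = conjInClass (conjInClass a.2.2 g) h := by
      ext; simp [conjInClass, mul_assoc]
    rw [this]
  coef_one a := by
    have h1 : conjInClass a.2.2 1 = a.2.2 := by ext; simp [conjInClass]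
    have h2 : T.zeta a.1 a.2.2 1 = 1 := by ext; simp [CosetReps.zeta, h1]
    rw [h2, map_one, Units.val_one]
  coef_mul a g h := by
    have h1 : conjInClass a.2.2 (g * h) = conjInClass (conjInClass a.2.2 g) h := by
      ext; simp [conjInClass, mul_assoc]
    have h2 : T.zeta a.1 a.2.2 (g * h) =
        T.zeta a.1 a.2.2 g * T.zeta a.1 (conjInClass a.2.2 g) h := by
      ext; simp [CosetReps.zeta, h1, mul_assoc]
    rw [h2, map_mul, Units.val_mul]
  deg_shift a h := rfl

end RSC

/-- An element system with characters over `G`, with index set `J`. -/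
structure ESC (k : Type uk) (G : Type uG) (J : Type uJ) [Field k] [Group G] where
  g : J → G
  g_mem : ∀ i, g i ∈ Subgroup.center G
  χ : J → G →* kˣ

namespace ESC

variable {k G G' J J' : Type*} [Field k] [Group G] [Group G']

/-- Isomorphism of element systems with characters. -/
def Iso (E : ESC k G J) (E' : ESC k G' J') : Prop :=
  ∃ (φ : G ≃* G') (σ : J ≃ J'),
    ∀ i, φ (E.g i) = E'.g (σ i) ∧ (E'.χ (σ i)).comp φ.toMonoidHom = E.χ i

/-- The central ramification system with characters of an element system with characters, where
`I_{{g}} = {j | g_j = g}` and `χ_{{g}}^{(j)} = χ_j`. -/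
def toRSC (E : ESC k G J) (u : ClassReps G) : RSC k G where
  I C := {j : J // ConjClasses.mk (E.g j) = C}
  u := u
  χ _ j := (E.χ j).comp (Subgroup.subtype _)

/-- The pointed Yetter-Drinfeld module `V(G, g_i, χ_i; i ∈ J)` with the basis `x_i`, `i ∈ J`, where
`h • x_i = χ_i(h) x_i` and `x_i ↦ g_i ⊗ x_i`. -/
def V (E : ESC k G J) : YDModule k (MonoidAlgebra k G) (J →₀ k) :=
  YDModule.monomial E.g (fun _ i => i) (fun h i => (E.χ i h : kˣ))
    (fun _ => rfl) (fun _ _ _ => rfl) (fun _ => by simp)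
    (fun g h i => by simp [mul_comm])
    (fun g i => by rw [Subgroup.mem_center_iff.1 (E.g_mem i) g]; simp)

/-- The `kG`-Hopf bimodule `(kQ₁ᶜ, G, g_i, χ_i; i ∈ J)`. -/
def arrowBimodule (E : ESC k G J) {u : ClassReps G} (T : CosetReps u) :
    ArrowBimodule k G (E.toRSC u).Label :=
  (E.toRSC u).arrowBimodule T

end ESC

end Systems

end

/-!
All the structures attached to an element system are determined, up to isomorphism, by the family of
its labels `(g_i, χ_i)`, and an isomorphism of element systems is a group isomorphism together with
a bijection of the index sets which matches the labels (`LabelIso`). So each of the equivalences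
comes down to recovering the labels, with multiplicities, from the structure.

* A Hopf algebra isomorphism of group algebras is induced by a group isomorphism, because the group
  consists of the group-like elements (`MonoidAlgebra.exists_mulEquiv`). Given this isomorphism, an
  isomorphism of Yetter-Drinfeld modules maps the space of vectors of degree `g` on which the group
  acts by `χ` onto the corresponding space. The basis vectors with label `(g, χ)` form a basis of
  this space, so equality of dimensions, as cardinals, yields the bijection of the index sets
  (`exists_equiv_of_map_supported`, `YDModule.exists_ydIso_monomial_iff`).
* The Nichols algebra is functorial for isomorphisms, since its ideal of relations is defined by a
  maximality property (`YDModule.nicholsIso`). Its relations have degree at least two, so the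
  Yetter-Drinfeld module is recovered as the part of degree one
  (`YDModule.nonempty_ydIso_of_nicholsIso`).
* In the algebra generated by the vertices and the arrows, the vertices are the group-like elements
  of degree zero. If the right action of the group fixes the labels of the arrows, the arrows with
  source `1` and label `(g, χ)` form a basis of the space of elements `p` of degree one with
  `Δ p = p ⊗ 1 + g ⊗ p` and `p h = χ(h) h p`. A graded Hopf algebra isomorphism preserves these
  descriptions; conversely, the structure of the path coalgebra depends on the labels only
  (`ArrowBimodule.oneTypeIsomorphic_iff`).
* The arrows with source `1` under the adjoint action have the labels `(g_i, χ_i⁻¹)`, and inverting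
  all characters does not affect whether labels match (`ESC.iso_iff_ydIso_ad`).
* In a central ramification system the right action fixes the labels of the arrows, and the coset
  representatives cancel from the scalars `χ(g_c h g_c⁻¹) = χ(h)`. So such a system amounts to the
  labels of its arrows, which form an element system (`RSC.IsCentral.esc`).
* A one-dimensional Yetter-Drinfeld submodule is spanned by a vector whose degree is central and on
  which the group acts by a character, so pointed modules are those which have a basis of such
  vectors. Over a finite abelian group with enough characters, every homogeneous vector is the sum
  of its projections to the isotypic components (`YDModule.isPointed_of_finite`).
-/

/-! ### Matching families of labels, and monomial Yetter-Drinfeld modules over group algebras -/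

section Labels

/-- Two families `x ↦ (deg x, c x)` of group elements and scalar functions on the groups are
isomorphic if a group isomorphism and a bijection of the index sets match them. Element systems,
pointed Yetter-Drinfeld modules and quivers with central arrows are all described by such
families. -/
def LabelIso {k G G' X X' : Type*} [Group G] [Group G'] (deg : X → G) (c : X → G → k)
    (deg' : X' → G') (c' : X' → G' → k) : Prop :=
  ∃ (φ : G ≃* G') (σ : X ≃ X'), ∀ x, deg' (σ x) = φ (deg x) ∧ ∀ h, c' (σ x) (φ h) = c x h

/-- Transport of `LabelIso` along reindexings of both families. -/
theorem LabelIso.congr_equiv {k G G' X X' Y Y' : Type*} [Group G] [Group G']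
    {deg : X → G} {c : X → G → k} {deg' : X' → G'} {c' : X' → G' → k} (s : Y ≃ X) (s' : Y' ≃ X') :
    LabelIso (deg ∘ s) (c ∘ s) (deg' ∘ s') (c' ∘ s') ↔ LabelIso deg c deg' c' := by
  constructor
  · rintro ⟨φ, σ, h⟩
    refine ⟨φ, s.symm.trans (σ.trans s'), fun x => ?_⟩
    simpa using h (s.symm x)
  · rintro ⟨φ, σ, h⟩
    refine ⟨φ, s.trans (σ.trans s'.symm), fun x => ?_⟩
    simpa using h (s x)

variable {k X X' A A' S : Type*} [Field k] [AddCommGroup A] [Module k A] [AddCommGroup A']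
  [Module k A']

/-- If a linear equivalence carries, for every label `s`, the span of the basis vectors with label
`s` onto the corresponding span, then there is a label-preserving bijection of the bases: both
spans have the same dimension. -/
theorem exists_equiv_of_map_supported (f : X → S) (f' : X' → S) (i : (X →₀ k) →ₗ[k] A)
    (hi : Function.Injective i) (i' : (X' →₀ k) →ₗ[k] A') (hi' : Function.Injective i')
    (e : A ≃ₗ[k] A')
    (h : ∀ s, ((Finsupp.supported k k (f ⁻¹' {s})).map i).map (e : A →ₗ[k] A') =
      (Finsupp.supported k k (f' ⁻¹' {s})).map i') :
    ∃ σ : X ≃ X', ∀ x, f' (σ x) = f x := by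
  have key : ∀ s, Nonempty ({x // f x = s} ≃ {x // f' x = s}) := fun s => by
    let e1 := (Finsupp.supported k k (f ⁻¹' {s})).equivMapOfInjective i hi
    let e2 := e.submoduleMap ((Finsupp.supported k k (f ⁻¹' {s})).map i)
    let e3 := LinearEquiv.ofEq _ _ (h s)
    let e4 := (Finsupp.supported k k (f' ⁻¹' {s})).equivMapOfInjective i' hi'
    let E := e1.trans (e2.trans (e3.trans e4.symm))
    let b : Module.Basis (f ⁻¹' {s}) k (Finsupp.supported k k (f ⁻¹' {s})) :=
      ⟨Finsupp.supportedEquivFinsupp _⟩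
    let b' : Module.Basis (f' ⁻¹' {s}) k (Finsupp.supported k k (f' ⁻¹' {s})) :=
      ⟨Finsupp.supportedEquivFinsupp _⟩
    exact ⟨(b.map E).indexEquiv b'⟩
  exact ⟨Equiv.ofFiberEquiv fun s => (key s).some, fun x => Equiv.ofFiberEquiv_map _ x⟩

end Labels

section GroupAlgebraIso

variable {k G G' : Type*} [Field k] [Group G] [Group G']

/-- A Hopf algebra isomorphism of group algebras comes from a group isomorphism, since the elements
of the group are the group-like elements. -/
theorem MonoidAlgebra.exists_mulEquiv (φ : MonoidAlgebra k G ≃ₐc[k] MonoidAlgebra k G') :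
    ∃ f : G ≃* G', ∀ g r, φ (MonoidAlgebra.single g r) = MonoidAlgebra.single (f g) r := by
  let a := MonoidAlgebra.mapDomainOfBialgHom (φ : MonoidAlgebra k G →ₐc[k] MonoidAlgebra k G')
  let b := MonoidAlgebra.mapDomainOfBialgHom (φ.symm : MonoidAlgebra k G' →ₐc[k] MonoidAlgebra k G)
  refine ⟨MonoidHom.toMulEquiv a b ?_ ?_, fun g r => ?_⟩
  · rw [← MonoidAlgebra.mapDomainOfBialgHom_comp, BialgEquiv.symm_comp,
      MonoidAlgebra.mapDomainOfBialgHom_id]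
  · rw [← MonoidAlgebra.mapDomainOfBialgHom_comp, BialgEquiv.comp_symm,
      MonoidAlgebra.mapDomainOfBialgHom_id]
  · exact (MonoidAlgebra.single_mapDomainOfBialgHom
      (φ : MonoidAlgebra k G →ₐc[k] MonoidAlgebra k G') g r).symm

theorem MonoidAlgebra.domCongrBialgEquiv_single (f : G ≃* G') (g : G) (r : k) :
    MonoidAlgebra.domCongrBialgEquiv k k f (MonoidAlgebra.single g r) =
      MonoidAlgebra.single (f g) r := by
  simp [MonoidAlgebra.domCongrBialgEquiv]

/-- The coefficient of `g ⊗ y` in an element of `kG ⊗ (Y →₀ k)`. -/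
noncomputable def MonoidAlgebra.tensorCoeff {Y : Type*} (g : G) (y : Y) :
    MonoidAlgebra k G ⊗[k] (Y →₀ k) →ₗ[k] k :=
  LinearMap.mul' k k ∘ₗ TensorProduct.map
    (Finsupp.lapply g ∘ₗ (MonoidAlgebra.coeffLinearEquiv k).toLinearMap) (Finsupp.lapply y)

end GroupAlgebraIso

namespace YDModule

variable {k G G' X X' : Type*} [Field k] [Group G] [Group G']
  {deg : X → G} {a : G → X → X} {c : G → X → k} {a_one : ∀ x, a 1 x = x}
  {a_mul : ∀ g h x, a (g * h) x = a g (a h x)} {c_one : ∀ x, c 1 x = 1}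
  {c_mul : ∀ g h x, c (g * h) x = c h x * c g (a h x)}
  {deg_a : ∀ g x, deg (a g x) = g * deg x * g⁻¹}

theorem monomial_act_single (h : G) (x : X) (r : k) :
    (monomial deg a c a_one a_mul c_one c_mul deg_a).act (MonoidAlgebra.single h 1)
      (Finsupp.single x r) = Finsupp.single (a h x) (r * c h x) := by
  simp [monomial, ofGroup]

theorem monomial_coact_single (x : X) (r : k) :
    (monomial deg a c a_one a_mul c_one c_mul deg_a).coact (Finsupp.single x r) =
      MonoidAlgebra.single (deg x) 1 ⊗ₜ Finsupp.single x r := by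
  have : (Finsupp.single x r : X →₀ k) = r • Finsupp.single x 1 := by simp
  rw [this, TensorProduct.tmul_smul]
  simp [monomial, ofGroup]

/-- If the group moves no basis vector, a vector lies in the span of the basis vectors of degree `g`
and character `χ` if and only if it has coaction `v ↦ g ⊗ v` and is an eigenvector with
character `χ`. -/
theorem mem_supported_iff_monomial (ha : ∀ g x, a g x = x) (g : G) (χ : G → k) (v : X →₀ k) :
    v ∈ Finsupp.supported k k ((fun x => (deg x, fun h => c h x)) ⁻¹' {(g, χ)}) ↔
      (monomial deg a c a_one a_mul c_one c_mul deg_a).coact v = MonoidAlgebra.single g 1 ⊗ₜ v ∧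
      ∀ h, (monomial deg a c a_one a_mul c_one c_mul deg_a).act (MonoidAlgebra.single h 1) v =
        χ h • v := by
  constructor
  · rw [Finsupp.supported_eq_span_single]
    intro hv
    induction hv using Submodule.span_induction with
    | mem v hv =>
      obtain ⟨x, hx, rfl⟩ := hv
      obtain ⟨h1, h2⟩ := Prod.mk.inj hx
      refine ⟨by rw [monomial_coact_single, h1], fun h => ?_⟩
      rw [monomial_act_single, ha, ← congrFun h2 h, Finsupp.smul_single, smul_eq_mul, mul_comm]
    | zero => simp
    | add u v _ _ hu hv =>
      exact ⟨by rw [map_add, hu.1, hv.1, TensorProduct.tmul_add],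
        fun h => by rw [map_add, hu.2, hv.2, smul_add]⟩
    | smul r v _ hv =>
      exact ⟨by rw [map_smul, hv.1, TensorProduct.tmul_smul],
        fun h => by rw [map_smul, hv.2, smul_comm]⟩
  · rintro ⟨h1, h2⟩
    rw [Finsupp.mem_supported]
    intro x hx
    have hx : v x ≠ 0 := by simpa using hx
    have h3 : ∀ w : X →₀ k, MonoidAlgebra.tensorCoeff (deg x) x
        ((monomial deg a c a_one a_mul c_one c_mul deg_a).coact w) = w x := fun w => by
      induction w using Finsupp.induction_linear with
      | zero => simp
      | add u w hu hw => simp only [map_add, hu, hw, Finsupp.add_apply]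
      | single y r =>
        rw [monomial_coact_single]
        by_cases hyx : y = x
        · subst hyx; simp [MonoidAlgebra.tensorCoeff]
        · simp [MonoidAlgebra.tensorCoeff, Finsupp.single_eq_of_ne' hyx]
    have h4 : ∀ (h : G) (w : X →₀ k), (monomial deg a c a_one a_mul c_one c_mul deg_a).act
        (MonoidAlgebra.single h 1) w x = w x * c h x := fun h w => by
      induction w using Finsupp.induction_linear with
      | zero => simp
      | add u w hu hw => simp only [map_add, hu, hw, Finsupp.add_apply, add_mul]
      | single y r =>
        rw [monomial_act_single, ha]
        by_cases hyx : y = x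
        · subst hyx; simp
        · simp [Finsupp.single_eq_of_ne' hyx]
    have h5 := h3 v
    rw [h1] at h5
    simp only [Set.mem_preimage, Set.mem_singleton_iff, Prod.mk.injEq]
    constructor
    · by_contra hne
      apply hx
      rw [← h5]
      simp [MonoidAlgebra.tensorCoeff, Finsupp.single_eq_of_ne' (Ne.symm hne)]
    · funext h
      have h6 := h4 h v
      rw [h2] at h6
      exact mul_left_cancel₀ hx (by rw [← h6, Finsupp.smul_apply, smul_eq_mul, mul_comm])

variable {deg' : X' → G'} {a' : G' → X' → X'} {c' : G' → X' → k} {a_one' : ∀ x, a' 1 x = x}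
  {a_mul' : ∀ g h x, a' (g * h) x = a' g (a' h x)} {c_one' : ∀ x, c' 1 x = 1}
  {c_mul' : ∀ g h x, c' (g * h) x = c' h x * c' g (a' h x)}
  {deg_a' : ∀ g x, deg' (a' g x) = g * deg' x * g⁻¹}

/-- Two Yetter-Drinfeld modules with bases of simultaneous eigenvectors are isomorphic, up to a
Hopf algebra isomorphism of the group algebras, if and only if their degrees and characters
match. -/
theorem exists_ydIso_monomial_iff (ha : ∀ g x, a g x = x) (ha' : ∀ g x, a' g x = x) :
    (∃ φ : MonoidAlgebra k G ≃ₐc[k] MonoidAlgebra k G',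
      Nonempty (YDIso φ (monomial deg a c a_one a_mul c_one c_mul deg_a)
        (monomial deg' a' c' a_one' a_mul' c_one' c_mul' deg_a'))) ↔
    LabelIso deg (fun x g => c g x) deg' (fun x g => c' g x) := by
  constructor
  · rintro ⟨φ, ⟨ψ⟩⟩
    obtain ⟨f, hf⟩ := MonoidAlgebra.exists_mulEquiv φ
    have hact := ψ.map_act
    have hcoact := ψ.map_coact
    obtain ⟨σ, hσ⟩ := exists_equiv_of_map_supported
      (fun x => (f (deg x), fun h => c (f.symm h) x)) (fun x => (deg' x, fun h => c' h x))
      LinearMap.id Function.injective_id LinearMap.id Function.injective_id ψ.toLinearEquiv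
      (fun s => by
        obtain ⟨g', χ'⟩ := s
        have h0 : (fun x => (f (deg x), fun h => c (f.symm h) x)) ⁻¹' {(g', χ')} =
            (fun x => (deg x, fun h => c h x)) ⁻¹' {(f.symm g', fun h => χ' (f h))} := by
          ext x
          simp only [Set.mem_preimage, Set.mem_singleton_iff, Prod.mk.injEq]
          refine and_congr (MulEquiv.eq_symm_apply f).symm ⟨fun h => ?_, fun h => ?_⟩
          · funext y; rw [← h]; simp
          · funext y; have := congrFun h (f.symm y); simpa using this
        rw [Submodule.map_id, Submodule.map_id, h0]
        ext w
        rw [mem_supported_iff_monomial (a_one := a_one') (a_mul := a_mul') (c_one := c_one')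
          (c_mul := c_mul') (deg_a := deg_a') ha', Submodule.mem_map_equiv,
          mem_supported_iff_monomial (a_one := a_one) (a_mul := a_mul) (c_one := c_one)
          (c_mul := c_mul) (deg_a := deg_a) ha]
        obtain ⟨v, rfl⟩ := ψ.toLinearEquiv.surjective w
        rw [LinearEquiv.symm_apply_apply]
        have hinj : Function.Injective
            (TensorProduct.map (φ : MonoidAlgebra k G →ₗ[k] MonoidAlgebra k G')
              ψ.toLinearMap) :=
          TensorProduct.map_injective_of_flat_flat _ _ φ.injective ψ.toLinearEquiv.injective
        have e1 : (ψ.toLinearEquiv v) = ψ.toFun v := rfl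
        refine and_congr ?_ ⟨fun h y => ?_, fun h y => ?_⟩
        · rw [e1, ← hcoact, ← hinj.eq_iff, TensorProduct.map_tmul]
          have : (φ : MonoidAlgebra k G →ₗ[k] MonoidAlgebra k G')
            (MonoidAlgebra.single (f.symm g') 1) = MonoidAlgebra.single g' 1 := by
            refine (hf _ _).trans ?_
            rw [MulEquiv.apply_symm_apply]
          rw [this]
          rfl
        · have h1 := hact (MonoidAlgebra.single (f.symm y) 1) v
          rw [hf, MulEquiv.apply_symm_apply, h] at h1
          rw [e1, ← h1, MulEquiv.apply_symm_apply]
          exact map_smul ψ.toLinearEquiv _ _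
        · have h1 := hact (MonoidAlgebra.single y 1) v
          rw [hf, ← e1, h] at h1
          apply ψ.toLinearEquiv.injective
          rw [map_smul]
          exact h1)
    refine ⟨f, σ, fun x => ?_⟩
    obtain ⟨h1, h2⟩ := Prod.mk.inj (hσ x)
    refine ⟨h1, fun h => ?_⟩
    have := congrFun h2 (f h)
    simpa using this
  · rintro ⟨f, σ, h⟩
    refine ⟨MonoidAlgebra.domCongrBialgEquiv k k f, ⟨{ Finsupp.domLCongr σ with
      map_act := fun x v => ?_
      map_coact := fun v => ?_ }⟩⟩
    · change Finsupp.domLCongr σ _ = YDModule.act _ _ (Finsupp.domLCongr σ v)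
      induction x using MonoidAlgebra.induction_linear with
      | zero => simp
      | add x y hx hy => simp only [map_add, LinearMap.add_apply, hx, hy]
      | single g r =>
        have hr : (MonoidAlgebra.single g r : MonoidAlgebra k G) =
          r • MonoidAlgebra.single g 1 := by simp
        simp only [hr, map_smul, LinearMap.smul_apply, MonoidAlgebra.domCongrBialgEquiv_single]
        congr 1
        induction v using Finsupp.induction_linear with
        | zero => simp
        | add u v hu hv => simp only [map_add, hu, hv]
        | single x r =>
          have hc : c' (f g) (σ x) = c g x := (h x).2 g
          rw [monomial_act_single, Finsupp.domLCongr_single, Finsupp.domLCongr_single,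
            monomial_act_single, ha, ha', hc]
    · change TensorProduct.map _ (Finsupp.domLCongr σ).toLinearMap _ =
        YDModule.coact _ (Finsupp.domLCongr σ v)
      induction v using Finsupp.induction_linear with
      | zero => simp
      | add u v hu hv => simp only [map_add, hu, hv]
      | single x r =>
        rw [monomial_coact_single, Finsupp.domLCongr_single, monomial_coact_single,
          TensorProduct.map_tmul, (h x).1]
        congr 1
        · exact MonoidAlgebra.domCongrBialgEquiv_single f _ _
        · exact Finsupp.domLCongr_single σ _ _

end YDModule

/-! ### Skew-primitive elements of path coalgebras -/

namespace ArrowBimodule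

variable {k G L : Type*} [Field k] [Group G] (D : ArrowBimodule k G L)

namespace PathCoalgebra

/-- The basis of the path coalgebra which consists of the paths. -/
noncomputable def pathBasis : Module.Basis (G × List L) k D.PathCoalgebra :=
  ⟨(LinearEquiv.refl k ((G × List L) →₀ k) :)⟩

@[simp]
theorem pathBasis_apply (p : G × List L) : pathBasis D p = path D p.1 p.2 := rfl

@[simp]
theorem pathBasis_repr_path (x : G) (w : List L) :
    (pathBasis D).repr (path D x w) = Finsupp.single (x, w) 1 := by
  rw [← (pathBasis D).repr_self]; rfl

theorem path_injective {x y : G} {w v : List L} (h : path D x w = path D y v) :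
    x = y ∧ w = v :=
  Prod.mk.inj ((pathBasis D).injective h)

theorem degree_eq_span (n : ℕ) :
    degree D n = Submodule.span k (pathBasis D '' {p | p.2.length = n}) := by
  rw [degree]
  congr 1
  ext p
  constructor
  · rintro ⟨x, w, hw, rfl⟩; exact ⟨(x, w), hw, rfl⟩
  · rintro ⟨⟨x, w⟩, hw, rfl⟩; exact ⟨x, w, hw, rfl⟩

theorem path_nil_mul_path (h x : G) (w : List L) :
    path D h [] * path D x w = path D (h * x) w := by
  rw [path_mul_path]
  simp [shuffleWord]

theorem path_singleton_mul_path_nil (x h : G) (a : L) :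
    path D x [a] * path D h [] = D.coef a h • path D (x * h) [D.shift a h] := by
  rw [path_mul_path]
  simp [shuffleWord, ofWord]

theorem comul_path_nil (x : G) :
    Coalgebra.comul (R := k) (path D x []) = path D x [] ⊗ₜ[k] path D x [] := by
  simp [comul_path]

theorem comul_path_singleton (x : G) (a : L) : Coalgebra.comul (R := k) (path D x [a]) =
    path D x [a] ⊗ₜ[k] path D x [] + path D (x * D.deg a) [] ⊗ₜ[k] path D x [a] := by
  simp [comul_path, Finset.sum_range_succ]

theorem isGroupLikeElem_path_nil (x : G) : IsGroupLikeElem k (path D x []) :=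
  ⟨by simp [counit_path], comul_path_nil D x⟩

/-- The vertices are the only group-like elements of degree zero, because group-like elements are
linearly independent. -/
theorem exists_eq_path_nil {p : D.PathCoalgebra} (h0 : p ∈ degree D 0)
    (hp : IsGroupLikeElem k p) : ∃ x, p = path D x [] := by
  by_contra h
  push Not at h
  have h1 : LinearIndepOn k id (insert p (Set.range fun x => path D x [])) :=
    linearIndepOn_isGroupLikeElem.mono (by
      rintro _ (rfl | ⟨x, rfl⟩)
      · exact hp
      · exact isGroupLikeElem_path_nil D x)
  have h2 : p ∉ Set.range fun x => path D x [] := by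
    rintro ⟨x, rfl⟩; exact h x rfl
  have h3 := h1.notMem_span_of_insert h2
  rw [Set.image_id] at h3
  refine h3 (Submodule.span_mono ?_ h0)
  rintro _ ⟨x, w, hw, rfl⟩
  obtain rfl := List.length_eq_zero_iff.1 hw
  exact ⟨x, rfl⟩

/-- The coefficient of `p ⊗ q`, for two paths `p` and `q`, in an element of the tensor square. -/
noncomputable def tensorCoeff (p q : G × List L) :
    D.PathCoalgebra ⊗[k] D.PathCoalgebra →ₗ[k] k :=
  LinearMap.mul' k k ∘ₗ TensorProduct.map ((pathBasis D).coord p) ((pathBasis D).coord q)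

/-- The inclusion of the span of the arrows with source `1`. -/
noncomputable def arrows : (L →₀ k) →ₗ[k] D.PathCoalgebra :=
  Finsupp.linearCombination k fun a => path D 1 [a]

theorem arrows_injective : Function.Injective (arrows D) :=
  (pathBasis D).linearIndependent.comp (fun a : L => (1, [a])) (fun a b h => by simpa using h)

/-- If the right action of the group fixes the labels of the arrows, then the span of the arrows
with source `1`, degree `g` and character `χ` consists of the elements of degree one which are
`(1, g)`-primitive and which the vertices commute with up to `χ`. -/
theorem mem_map_arrows_iff (hD : ∀ a h, D.shift a h = a) (g : G) (χ : G → k)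
    (p : D.PathCoalgebra) :
    p ∈ (Finsupp.supported k k ((fun a => (D.deg a, D.coef a)) ⁻¹' {(g, χ)})).map (arrows D) ↔
      p ∈ degree D 1 ∧ Coalgebra.comul (R := k) p = p ⊗ₜ 1 + path D g [] ⊗ₜ p ∧
      ∀ h, p * path D h [] = χ h • (path D h [] * p) := by
  classical
  have hspan : (Finsupp.supported k k ((fun a => (D.deg a, D.coef a)) ⁻¹' {(g, χ)})).map
      (arrows D) = Submodule.span k (pathBasis D '' ((fun a : L => (1, [a])) ''
        ((fun a => (D.deg a, D.coef a)) ⁻¹' {(g, χ)}))) := by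
    rw [arrows, ← Finsupp.span_image_eq_map_linearCombination, Set.image_image]
    rfl
  rw [hspan]
  constructor
  · intro hp
    induction hp using Submodule.span_induction with
    | mem p hp =>
      obtain ⟨_, ⟨a, ha, rfl⟩, rfl⟩ := hp
      obtain ⟨rfl, rfl⟩ := Prod.mk.inj ha
      refine ⟨Submodule.subset_span ⟨1, [a], rfl, rfl⟩, ?_, fun h => ?_⟩
      · rw [pathBasis_apply, comul_path_singleton, one_mul, one_def]
      · rw [pathBasis_apply, path_singleton_mul_path_nil, path_nil_mul_path, hD, one_mul, mul_one]
    | zero => simp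
    | add p q _ _ hp hq =>
      refine ⟨add_mem hp.1 hq.1, ?_, fun h => ?_⟩
      · rw [map_add, hp.2.1, hq.2.1, TensorProduct.add_tmul, TensorProduct.tmul_add]; abel
      · rw [add_mul, hp.2.2, hq.2.2, mul_add, smul_add]
    | smul r p _ hp =>
      refine ⟨Submodule.smul_mem _ _ hp.1, ?_, fun h => ?_⟩
      · rw [map_smul, hp.2.1, smul_add, TensorProduct.tmul_smul, TensorProduct.smul_tmul']
      · rw [smul_mul_assoc, hp.2.2, mul_smul_comm, smul_comm]
  · rintro ⟨h1, h2, h3⟩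
    have hlen := h1
    rw [degree_eq_span, Module.Basis.mem_span_image] at hlen
    rw [Module.Basis.mem_span_image]
    -- Coordinates of `Δ q`, `q h` and `h q` for `q` of degree one. Comparing them for `q = p` shows
    -- that every arrow in `p` has source `1`, degree `g` and character `χ`.
    have c1 : ∀ q ∈ degree D 1, ∀ (x : G) (a : L),
        tensorCoeff D (x, [a]) (x, []) (Coalgebra.comul (R := k) q) =
          (pathBasis D).repr q (x, [a]) ∧
        tensorCoeff D (x * D.deg a, []) (x, [a]) (Coalgebra.comul (R := k) q) =
          (pathBasis D).repr q (x, [a]) ∧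
        ∀ h, (pathBasis D).repr (q * path D h []) (x * h, [a]) =
          D.coef a h * (pathBasis D).repr q (x, [a]) := by
      intro q hq x a
      induction hq using Submodule.span_induction with
      | mem q hq =>
        obtain ⟨y, w, hw, rfl⟩ := hq
        obtain ⟨b, rfl⟩ := List.length_eq_one_iff.1 hw
        refine ⟨?_, ?_, fun h => ?_⟩
        · simp [comul_path_singleton, tensorCoeff, Finsupp.single_apply]
          aesop
        · simp [comul_path_singleton, tensorCoeff, Finsupp.single_apply]
          aesop
        · simp [path_singleton_mul_path_nil, hD, Finsupp.single_apply]
          aesop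
      | zero => simp
      | add p q _ _ hp hq =>
        refine ⟨by simp [hp.1, hq.1], by simp [hp.2.1, hq.2.1], fun h => ?_⟩
        rw [add_mul, map_add, Finsupp.add_apply, hp.2.2, hq.2.2, map_add, Finsupp.add_apply,
          mul_add]
      | smul r p _ hp =>
        refine ⟨by simp [hp.1], by simp [hp.2.1], fun h => ?_⟩
        rw [smul_mul_assoc, map_smul, Finsupp.smul_apply, hp.2.2, map_smul, Finsupp.smul_apply,
          smul_eq_mul, smul_eq_mul, mul_left_comm]
    have c2 : ∀ q ∈ degree D 1, ∀ (h : G) (a : L),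
        (pathBasis D).repr (path D h [] * q) (1 * h, [a]) = (pathBasis D).repr q (1, [a]) := by
      intro q hq h a
      induction hq using Submodule.span_induction with
      | mem q hq =>
        obtain ⟨y, w, hw, rfl⟩ := hq
        simp [path_nil_mul_path, Finsupp.single_apply]
      | zero => simp
      | add p q _ _ hp hq =>
        rw [mul_add, map_add, Finsupp.add_apply, hp, hq, map_add, Finsupp.add_apply]
      | smul r p _ hp =>
        rw [mul_smul_comm, map_smul, Finsupp.smul_apply, hp, map_smul, Finsupp.smul_apply]
    rintro ⟨x, w⟩ hx
    obtain ⟨a, rfl⟩ := List.length_eq_one_iff.1 (hlen hx)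
    have hx : (pathBasis D).repr p (x, [a]) ≠ 0 := by simpa using hx
    obtain ⟨d1, d2, d3⟩ := c1 p h1 x a
    have hx1 : x = 1 := by
      by_contra hne
      apply hx
      rw [← d1, h2]
      simp [tensorCoeff, one_def, Ne.symm hne]
    subst hx1
    refine ⟨a, Prod.ext ?_ (funext fun h => ?_), rfl⟩
    · by_contra hne
      have hne : g ≠ D.deg a := Ne.symm hne
      apply hx
      rw [← d2, h2]
      simp [tensorCoeff, one_def, hne]
    · have := d3 h
      rw [h3, map_smul, Finsupp.smul_apply, c2 p h1, smul_eq_mul] at this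
      exact (mul_right_cancel₀ hx this).symm

end PathCoalgebra

end ArrowBimodule

/-! ### Relabelling the vertices and arrows of a quiver -/

section SubBialgebraIso

variable {k A A' : Type*} [Field k] [Ring A] [Bialgebra k A] [Ring A'] [Bialgebra k A']

/-- An isomorphism of bialgebras which maps one sub-bialgebra onto another restricts to an
isomorphism of these. -/
theorem Subalgebra.exists_bialgEquiv_of_map_eq (S : Subalgebra k A) (S' : Subalgebra k A')
    (h : S ≤ S.tensorVal.range.comap (Bialgebra.comulAlgHom k A))
    (h' : S' ≤ S'.tensorVal.range.comap (Bialgebra.comulAlgHom k A'))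
    (P : A ≃ₐ[k] A') (hcounit : ∀ x, Coalgebra.counit (R := k) (P x) = Coalgebra.counit (R := k) x)
    (hcomul : ∀ x, TensorProduct.map P.toLinearMap P.toLinearMap (Coalgebra.comul (R := k) x) =
      Coalgebra.comul (R := k) (P x))
    (hS : S.map (P : A →ₐ[k] A') = S') :
    let _ := S.bialgebraOfLE h
    let _ := S'.bialgebraOfLE h'
    ∃ e : S ≃ₐc[k] S', ∀ x, (e x : A') = P x := by
  intro _ _
  let E : S ≃ₐ[k] S' := (P.subalgebraMap S).trans (Subalgebra.equivOfEq _ _ hS)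
  have hE : ∀ x, (E x : A') = P x := fun x => rfl
  refine ⟨BialgEquiv.ofAlgEquiv E ?_ ?_, hE⟩
  · ext x
    exact hcounit x
  · ext x
    apply S'.tensorVal_injective
    have h1 : ∀ t : S ⊗[k] S, S'.tensorVal (Algebra.TensorProduct.map (E : S →ₐ[k] S') E t) =
        TensorProduct.map P.toLinearMap P.toLinearMap (S.tensorVal t) := fun t => by
      induction t with
      | zero => simp
      | add t u ht hu => simp only [map_add, ht, hu]
      | tmul a b => rfl
    have h2 : S.tensorVal (Coalgebra.comul (R := k) x) = Coalgebra.comul (R := k) (x : A) :=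
      S.tensorVal_comulOfLE h x
    have h3 : S'.tensorVal (Coalgebra.comul (R := k) (E x)) = Coalgebra.comul (R := k) (E x : A') :=
      S'.tensorVal_comulOfLE h' (E x)
    refine (h1 _).trans ((congrArg _ h2).trans ((hcomul _).trans ?_))
    rw [← hE]
    exact h3.symm

end SubBialgebraIso

namespace ArrowBimodule

variable {k G L G' L' : Type*} [Field k] [Group G] [Group G'] {D : ArrowBimodule k G L}
  {D' : ArrowBimodule k G' L'}

namespace PathCoalgebra

variable (φ : G ≃* G') (σ : L ≃ L')

variable (D D') in
/-- The linear isomorphism of path coalgebras which relabels vertices and arrows. -/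
noncomputable def relabel : D.PathCoalgebra ≃ₗ[k] D'.PathCoalgebra :=
  (pathBasis D).equiv (pathBasis D')
    (φ.toEquiv.prodCongr (Equiv.listEquivOfEquiv σ))

@[simp]
theorem relabel_path (x : G) (w : List L) :
    relabel D D' φ σ (path D x w) = path D' (φ x) (w.map σ) :=
  (pathBasis D).equiv_apply (x, w) (pathBasis D') _

theorem mapDomain_cons (a : L) (f : List L →₀ k) :
    Finsupp.mapDomain (List.map σ) (cons k a f) =
      cons k (σ a) (Finsupp.mapDomain (List.map σ) f) := by
  induction f using Finsupp.induction_linear with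
  | zero => simp
  | add f g hf hg => simp only [map_add, Finsupp.mapDomain_add, hf, hg]
  | single w r => simp [Finsupp.mapDomain_single]

theorem relabel_ofWord (x : G) (f : List L →₀ k) :
    relabel D D' φ σ (ofWord D x f) = ofWord D' (φ x) (Finsupp.mapDomain (List.map σ) f) := by
  induction f using Finsupp.induction_linear with
  | zero => simp
  | add f g hf hg => simp only [map_add, Finsupp.mapDomain_add, hf, hg]
  | single w r => simp [Finsupp.mapDomain_single, ofWord]

variable {φ σ}

/-- The words in a product of two paths are relabelled compatibly. The recursion for `shuffleWord`
shortens one of the two words at a time, so the induction is on a bound `n` for the total length. -/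
theorem mapDomain_shuffleWord (hdeg : ∀ a, D'.deg (σ a) = φ (D.deg a))
    (hcoef : ∀ a h, D'.coef (σ a) (φ h) = D.coef a h)
    (hshift : ∀ a h, D'.shift (σ a) (φ h) = σ (D.shift a h)) (n : ℕ) :
    ∀ (w v : List L) (y : G), w.length + v.length ≤ n →
    Finsupp.mapDomain (List.map σ) (D.shuffleWord w y v) =
      D'.shuffleWord (w.map σ) (φ y) (v.map σ) := by
  induction n with
  | zero =>
    intro w v y h
    obtain rfl : w = [] := List.length_eq_zero_iff.1 (by omega)
    simp [shuffleWord, Finsupp.mapDomain_single]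
  | succ n ih =>
    intro w v y h
    match w, v with
    | [], v => simp [shuffleWord, Finsupp.mapDomain_single]
    | a :: w, [] =>
      have h1 := ih w [] y (by simp at h ⊢; omega)
      simp only [List.map_cons, List.map_nil, shuffleWord, Finsupp.mapDomain_smul, mapDomain_cons,
        hcoef, hshift] at h1 ⊢
      rw [h1]
    | a :: w, b :: v =>
      have h1 := ih w (b :: v) y (by simp at h ⊢; omega)
      have h2 := ih (a :: w) v (y * D.deg b) (by simp at h ⊢; omega)
      simp only [List.map_cons, shuffleWord, Finsupp.mapDomain_smul, Finsupp.mapDomain_add,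
        mapDomain_cons, hcoef, hshift, map_mul, hdeg] at h1 h2 ⊢
      rw [h1, h2]

theorem relabel_mul (hdeg : ∀ a, D'.deg (σ a) = φ (D.deg a))
    (hcoef : ∀ a h, D'.coef (σ a) (φ h) = D.coef a h)
    (hshift : ∀ a h, D'.shift (σ a) (φ h) = σ (D.shift a h)) (p q : D.PathCoalgebra) :
    relabel D D' φ σ (p * q) = relabel D D' φ σ p * relabel D D' φ σ q := by
  induction p using induction_path with
  | zero => simp
  | add p p' hp hp' => simp only [add_mul, map_add, hp, hp']
  | smul r x w =>
    induction q using induction_path with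
    | zero => simp
    | add q q' hq hq' => simp only [mul_add, map_add, hq, hq']
    | smul s y v =>
      simp only [smul_mul_smul_comm, map_smul, relabel_path, path_mul_path, relabel_ofWord, map_mul]
      rw [mapDomain_shuffleWord hdeg hcoef hshift _ w v y le_rfl]

theorem relabel_comul (hdeg : ∀ a, D'.deg (σ a) = φ (D.deg a)) (p : D.PathCoalgebra) :
    TensorProduct.map (relabel D D' φ σ).toLinearMap (relabel D D' φ σ).toLinearMap
      (Coalgebra.comul (R := k) p) = Coalgebra.comul (R := k) (relabel D D' φ σ p) := by
  induction p using induction_path with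
  | zero => simp
  | add p p' hp hp' => simp only [map_add, hp, hp']
  | smul r x w =>
    simp only [map_smul, relabel_path, comul_path, map_sum, TensorProduct.map_tmul,
      LinearEquiv.coe_coe, List.length_map, List.map_drop, List.map_take, map_mul]
    congr 1
    refine Finset.sum_congr rfl fun i _ => ?_
    have : φ ((w.take i).map D.deg).prod = ((((w.map σ).take i)).map D'.deg).prod := by
      rw [map_list_prod, ← List.map_take, List.map_map, List.map_map]
      congr 2
      funext a
      exact (hdeg a).symm
    simp only [← List.map_take, this]

theorem relabel_counit (p : D.PathCoalgebra) :
    Coalgebra.counit (R := k) (relabel D D' φ σ p) = Coalgebra.counit (R := k) p := by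
  induction p using induction_path with
  | zero => simp
  | add p p' hp hp' => simp only [map_add, hp, hp']
  | smul r x w => simp [counit_path]

theorem map_relabel_degree (n : ℕ) :
    (degree D n).map (relabel D D' φ σ).toLinearMap = degree D' n := by
  rw [degree, degree, Submodule.map_span]
  congr 1
  ext p
  constructor
  · rintro ⟨_, ⟨x, w, hw, rfl⟩, rfl⟩
    exact ⟨φ x, w.map σ, by simpa using hw, (relabel_path φ σ x w).symm⟩
  · rintro ⟨x, w, hw, rfl⟩
    exact ⟨path D (φ.symm x) (w.map σ.symm), ⟨_, _, by simpa using hw, rfl⟩, by simp⟩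

end PathCoalgebra

open PathCoalgebra

/-- Matching relabellings of the vertices and the arrows induce an isomorphism of the graded Hopf
algebras generated by them. -/
theorem oneTypeIsomorphic_of_relabel (φ : G ≃* G') (σ : L ≃ L')
    (hdeg : ∀ a, D'.deg (σ a) = φ (D.deg a)) (hcoef : ∀ a h, D'.coef (σ a) (φ h) = D.coef a h)
    (hshift : ∀ a h, D'.shift (σ a) (φ h) = σ (D.shift a h)) : OneTypeIsomorphic D D' := by
  let P : D.PathCoalgebra ≃ₐ[k] D'.PathCoalgebra := AlgEquiv.ofLinearEquiv (relabel D D' φ σ)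
    (by simp [one_def]) (relabel_mul hdeg hcoef hshift)
  have hmap : ∀ n, P '' degree D n = degree D' n := fun n => by
    have := congrArg (fun S : Submodule k D'.PathCoalgebra => (S : Set D'.PathCoalgebra))
      (map_relabel_degree (D := D) (D' := D') (φ := φ) (σ := σ) n)
    simpa only [Submodule.map_coe] using! this
  have hS : D.oneType.map (P : D.PathCoalgebra →ₐ[k] D'.PathCoalgebra) = D'.oneType := by
    rw [oneType, AlgHom.map_adjoin, oneType]
    congr 1
    rw [← hmap, ← hmap, ← Set.image_union]
    rfl
  obtain ⟨e, he⟩ := Subalgebra.exists_bialgEquiv_of_map_eq D.oneType D'.oneType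
    D.oneType_le_comap D'.oneType_le_comap P relabel_counit (relabel_comul hdeg) hS
  refine ⟨e, fun n => ?_⟩
  ext y
  constructor
  · rintro ⟨x, hx, rfl⟩
    change ((e x : D'.oneType) : D'.PathCoalgebra) ∈ degree D' n
    rw [he, ← SetLike.mem_coe, ← hmap]
    exact ⟨x, hx, rfl⟩
  · intro hy
    obtain ⟨x, rfl⟩ := e.surjective y
    refine ⟨x, ?_, rfl⟩
    have hy : ((e x : D'.oneType) : D'.PathCoalgebra) ∈ degree D' n := hy
    rw [he, ← SetLike.mem_coe, ← hmap] at hy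
    obtain ⟨z, hz, hzx⟩ := hy
    rw [P.injective hzx] at hz
    exact hz

end ArrowBimodule

/-! ### Isomorphisms of the graded Hopf algebras generated by vertices and arrows -/

namespace ArrowBimodule

open PathCoalgebra

variable {k G L G' L' : Type*} [Field k] [Group G] [Group G'] {D : ArrowBimodule k G L}
  {D' : ArrowBimodule k G' L'}

theorem path_nil_mem_oneType (x : G) : path D x [] ∈ D.oneType :=
  Algebra.subset_adjoin (Or.inl (Submodule.subset_span ⟨x, [], rfl, rfl⟩))

theorem path_singleton_mem_oneType (x : G) (a : L) : path D x [a] ∈ D.oneType :=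
  Algebra.subset_adjoin (Or.inr (Submodule.subset_span ⟨x, [a], rfl, rfl⟩))

variable (D) in
/-- The vertices as elements of the algebra generated by the vertices and the arrows. -/
noncomputable def vertex (x : G) : D.oneType := ⟨path D x [], path_nil_mem_oneType x⟩

variable (D) in
/-- The inclusion of the span of the arrows with source `1` into the algebra generated by the
vertices and the arrows. -/
noncomputable def oneTypeArrows : (L →₀ k) →ₗ[k] D.oneType :=
  (arrows D).codRestrict (Subalgebra.toSubmodule D.oneType) fun f => by
    induction f using Finsupp.induction_linear with
    | zero => rw [map_zero]; exact zero_mem _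
    | add _ _ hf hg => rw [map_add]; exact add_mem hf hg
    | single a r =>
      rw [arrows, Finsupp.linearCombination_single]
      exact Submodule.smul_mem _ _ (path_singleton_mem_oneType 1 a)

theorem oneTypeArrows_injective : Function.Injective D.oneTypeArrows := fun _ _ h =>
  arrows_injective D (congrArg Subtype.val h)

theorem tensorVal_comul (p : D.oneType) :
    D.oneType.tensorVal (Coalgebra.comul (R := k) p) =
      Coalgebra.comul (R := k) (p : D.PathCoalgebra) :=
  D.oneType.tensorVal_comulOfLE D.oneType_le_comap p

theorem vertex_mul (x y : G) : D.vertex (x * y) = D.vertex x * D.vertex y :=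
  Subtype.ext (path_nil_mul_path D x y []).symm

theorem vertex_injective : Function.Injective D.vertex := fun _ _ h =>
  (path_injective D (congrArg Subtype.val h)).1

theorem isGroupLikeElem_vertex (x : G) : IsGroupLikeElem k (D.vertex x) where
  counit_eq_one := (isGroupLikeElem_path_nil D x).counit_eq_one
  comul_eq_tmul_self := D.oneType.tensorVal_injective (by
    rw [tensorVal_comul]
    exact comul_path_nil D x)

theorem vertex_mem_oneTypeDegree (x : G) : D.vertex x ∈ D.oneTypeDegree 0 :=
  Submodule.subset_span ⟨x, [], rfl, rfl⟩

theorem exists_eq_vertex {p : D.oneType} (h0 : p ∈ D.oneTypeDegree 0)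
    (hp : IsGroupLikeElem k p) : ∃ x, p = D.vertex x := by
  have h1 : IsGroupLikeElem k (p : D.PathCoalgebra) :=
    ⟨hp.counit_eq_one, by rw [← tensorVal_comul, hp.comul_eq_tmul_self]; rfl⟩
  obtain ⟨x, hx⟩ := exists_eq_path_nil D h0 h1
  exact ⟨x, Subtype.ext hx⟩

/-- The arrows with a given label are characterized inside the graded Hopf algebra which is
generated by the vertices and the arrows, without reference to the path coalgebra. -/
theorem mem_map_oneTypeArrows_iff (hD : ∀ a h, D.shift a h = a) (g : G) (χ : G → k)
    (p : D.oneType) :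
    p ∈ (Finsupp.supported k k ((fun a => (D.deg a, D.coef a)) ⁻¹' {(g, χ)})).map
        D.oneTypeArrows ↔
      p ∈ D.oneTypeDegree 1 ∧ Coalgebra.comul (R := k) p = p ⊗ₜ 1 + D.vertex g ⊗ₜ p ∧
      ∀ h, p * D.vertex h = χ h • (D.vertex h * p) := by
  have h1 : p ∈ (Finsupp.supported k k ((fun a => (D.deg a, D.coef a)) ⁻¹' {(g, χ)})).map
      D.oneTypeArrows ↔ (p : D.PathCoalgebra) ∈ (Finsupp.supported k k
        ((fun a => (D.deg a, D.coef a)) ⁻¹' {(g, χ)})).map (arrows D) := by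
    constructor
    · rintro ⟨f, hf, rfl⟩; exact ⟨f, hf, rfl⟩
    · rintro ⟨f, hf, hfp⟩; exact ⟨f, hf, Subtype.ext hfp⟩
  rw [h1, mem_map_arrows_iff D hD, ← tensorVal_comul]
  refine and_congr Iff.rfl (and_congr ?_ (forall_congr' fun h => ?_))
  · rw [← D.oneType.tensorVal_injective.eq_iff, map_add]
    rfl
  · rw [← Subtype.val_injective.eq_iff]
    rfl

/-- An isomorphism of graded Hopf algebras maps vertices to vertices, the group-like elements of
degree zero, and so induces a group isomorphism. -/
theorem exists_mulEquiv_vertex (e : D.oneType ≃ₐc[k] D'.oneType)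
    (he : ∀ n, (D.oneTypeDegree n).map (e : D.oneType →ₗ[k] D'.oneType) = D'.oneTypeDegree n) :
    ∃ φ : G ≃* G', ∀ x, e (D.vertex x) = D'.vertex (φ x) := by
  have h1 : ∀ x, ∃ y, e (D.vertex x) = D'.vertex y := fun x =>
    exists_eq_vertex (by rw [← he 0]; exact ⟨_, vertex_mem_oneTypeDegree x, rfl⟩)
      ((isGroupLikeElem_vertex x).map e)
  have h2 : ∀ y, ∃ x, e (D.vertex x) = D'.vertex y := fun y => by
    obtain ⟨p, hp, hpy⟩ : D'.vertex y ∈ (D.oneTypeDegree 0).map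
      (e : D.oneType →ₗ[k] D'.oneType) := by rw [he 0]; exact vertex_mem_oneTypeDegree y
    have hpy : e p = D'.vertex y := hpy
    have hp' : IsGroupLikeElem k p := by
      have := isGroupLikeElem_vertex (D := D') y
      rw [← hpy] at this
      exact (isGroupLikeElem_map_equiv e).1 this
    obtain ⟨x, rfl⟩ := exists_eq_vertex hp hp'
    exact ⟨x, hpy⟩
  choose f hf using h1
  have hinj : Function.Injective e := fun _ _ h => e.injective h
  refine ⟨MulEquiv.ofBijective (MonoidHom.mk' f fun x y => ?_) ⟨fun x y h => ?_, fun y => ?_⟩, hf⟩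
  · apply vertex_injective (D := D')
    rw [← hf, vertex_mul, map_mul, hf, hf, vertex_mul]
  · apply vertex_injective (D := D)
    apply hinj
    rw [hf, hf]
    exact congrArg D'.vertex h
  · obtain ⟨x, hx⟩ := h2 y
    exact ⟨x, vertex_injective ((hf x).symm.trans hx)⟩

/-- If the right action of the groups fixes the labels of the arrows, the graded Hopf algebras
generated by the vertices and the arrows are isomorphic if and only if the degrees and characters
of the labels match. -/
theorem oneTypeIsomorphic_iff (hD : ∀ a h, D.shift a h = a) (hD' : ∀ a h, D'.shift a h = a) :
    OneTypeIsomorphic D D' ↔ LabelIso D.deg D.coef D'.deg D'.coef := by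
  constructor
  · rintro ⟨e, he⟩
    obtain ⟨φ, hφ⟩ := exists_mulEquiv_vertex e he
    obtain ⟨σ, hσ⟩ := exists_equiv_of_map_supported
      (fun a => (φ (D.deg a), fun h => D.coef a (φ.symm h))) (fun a => (D'.deg a, D'.coef a))
      D.oneTypeArrows oneTypeArrows_injective D'.oneTypeArrows oneTypeArrows_injective
      (e : D.oneType ≃ₐ[k] D'.oneType).toLinearEquiv (fun s => by
        obtain ⟨g', χ'⟩ := s
        have h0 : (fun a => (φ (D.deg a), fun h => D.coef a (φ.symm h))) ⁻¹' {(g', χ')} =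
            (fun a => (D.deg a, D.coef a)) ⁻¹' {(φ.symm g', fun h => χ' (φ h))} := by
          ext x
          simp only [Set.mem_preimage, Set.mem_singleton_iff, Prod.mk.injEq]
          refine and_congr (MulEquiv.eq_symm_apply φ).symm ⟨fun h => ?_, fun h => ?_⟩
          · funext y; rw [← h]; simp
          · funext y; have := congrFun h (φ.symm y); simpa using this
        rw [h0]
        ext q
        obtain ⟨p, rfl⟩ := (e : D.oneType ≃ₐ[k] D'.oneType).toLinearEquiv.surjective q
        rw [mem_map_oneTypeArrows_iff hD', Submodule.mem_map_equiv, LinearEquiv.symm_apply_apply,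
          mem_map_oneTypeArrows_iff hD]
        change _ ↔ e p ∈ _ ∧ Coalgebra.comul (R := k) (e p) = e p ⊗ₜ 1 + _ ⊗ₜ e p ∧
          ∀ h, e p * _ = χ' h • (_ * e p)
        have hinj : Function.Injective (TensorProduct.map (e : D.oneType →ₗ[k] D'.oneType)
            (e : D.oneType →ₗ[k] D'.oneType)) :=
          TensorProduct.map_injective_of_flat_flat _ _ e.injective e.injective
        have hv : ∀ y, D'.vertex y = e (D.vertex (φ.symm y)) := fun y => by
          rw [hφ, MulEquiv.apply_symm_apply]
        refine and_congr ?_ (and_congr ?_ ⟨fun h y => ?_, fun h y => ?_⟩)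
        · rw [← he 1]
          exact ⟨fun h => ⟨p, h, rfl⟩, fun ⟨p', h, h'⟩ => by rwa [← e.injective h']⟩
        · rw [← CoalgHomClass.map_comp_comul_apply, ← hinj.eq_iff, map_add, TensorProduct.map_tmul,
            TensorProduct.map_tmul, hv]
          have : (e : D.oneType →ₗ[k] D'.oneType) 1 = 1 := map_one e
          rw [this]
          rfl
        · rw [hv, ← map_mul, h, MulEquiv.apply_symm_apply, map_smul, map_mul]
        · have hinj : Function.Injective e := fun _ _ h => e.injective h
          apply hinj
          rw [map_mul, hφ, h, map_smul, map_mul, hφ])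
    refine ⟨φ, σ, fun a => ?_⟩
    obtain ⟨h1, h2⟩ := Prod.mk.inj (hσ a)
    refine ⟨h1, fun h => ?_⟩
    have := congrFun h2 (φ h)
    simpa using this
  · rintro ⟨φ, σ, h⟩
    exact oneTypeIsomorphic_of_relabel φ σ (fun a => (h a).1) (fun a => (h a).2)
      (fun a g => by rw [hD, hD'])

end ArrowBimodule

/-! ### Naturality of the braided tensor Hopf algebra -/

namespace YDIso

variable {k H H' V V' : Type*} [Field k] [Ring H] [HopfAlgebra k H] [Ring H'] [HopfAlgebra k H']
  [AddCommGroup V] [Module k V] [AddCommGroup V'] [Module k V'] {φ : H ≃ₐc[k] H'}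
  {M : YDModule k H V} {N : YDModule k H' V'}

theorem apply_act (ψ : YDIso φ M N) (h : H) (v : V) :
    ψ.toLinearEquiv (M.act h v) = N.act (φ h) (ψ.toLinearEquiv v) :=
  ψ.map_act h v

theorem map_apply_coact (ψ : YDIso φ M N) (v : V) :
    TensorProduct.map (φ : H →ₗ[k] H') ψ.toLinearEquiv.toLinearMap (M.coact v) =
      N.coact (ψ.toLinearEquiv v) :=
  ψ.map_coact v

/-- The inverse of an isomorphism of Yetter-Drinfeld modules. -/
def symm (ψ : YDIso φ M N) : YDIso φ.symm N M where
  toLinearEquiv := ψ.toLinearEquiv.symm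
  map_act h v := by
    change ψ.toLinearEquiv.symm _ = M.act _ (ψ.toLinearEquiv.symm v)
    rw [LinearEquiv.symm_apply_eq, apply_act, LinearEquiv.apply_symm_apply,
      BialgEquiv.apply_symm_apply]
  map_coact v := by
    change TensorProduct.map _ ψ.toLinearEquiv.symm.toLinearMap _ =
      M.coact (ψ.toLinearEquiv.symm v)
    obtain ⟨v, rfl⟩ := ψ.toLinearEquiv.surjective v
    rw [← map_apply_coact, LinearEquiv.symm_apply_apply]
    generalize M.coact v = t
    induction t with
    | zero => simp
    | add t u ht hu => simp only [map_add, ht, hu]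
    | tmul a b =>
      rw [TensorProduct.map_tmul, TensorProduct.map_tmul]
      congr 1
      · exact φ.symm_apply_apply a
      · exact ψ.toLinearEquiv.symm_apply_apply b

end YDIso

namespace YDModule

section Braiding

variable {k H H' V W V' W' A A' : Type*} [Field k] [Ring H] [HopfAlgebra k H] [Ring H']
  [HopfAlgebra k H'] [AddCommGroup V] [Module k V] [AddCommGroup W] [Module k W]
  [AddCommGroup V'] [Module k V'] [AddCommGroup W'] [Module k W'] [Ring A] [Algebra k A]
  [Ring A'] [Algebra k A'] {φ : H ≃ₐc[k] H'}

theorem braiding_tmul (M : YDModule k H V) (N : YDModule k H W) (v : V) (w : W) :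
    M.braiding N (v ⊗ₜ w) =
      TensorProduct.map (LinearMap.applyₗ w ∘ₗ N.act.toLinearMap) LinearMap.id (M.coact v) := by
  simp only [braiding, LinearMap.comp_apply, LinearMap.rTensor_tmul]
  generalize M.coact v = t
  induction t with
  | zero => simp
  | add t u ht hu => simp only [map_add, TensorProduct.add_tmul, ht, hu]
  | tmul a b => simp

/-- The braiding is natural for isomorphisms over a Hopf algebra isomorphism. -/
theorem map_braiding {M : YDModule k H V} {N : YDModule k H W} {M' : YDModule k H' V'}
    {N' : YDModule k H' W'} (ψ : YDIso φ M M') (χ : YDIso φ N N') (t : V ⊗[k] W) :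
    TensorProduct.map χ.toLinearEquiv.toLinearMap ψ.toLinearEquiv.toLinearMap (M.braiding N t) =
      M'.braiding N' (TensorProduct.map ψ.toLinearEquiv.toLinearMap
        χ.toLinearEquiv.toLinearMap t) := by
  induction t with
  | zero => simp
  | add t u ht hu => simp only [map_add, ht, hu]
  | tmul v w =>
    rw [TensorProduct.map_tmul, braiding_tmul, braiding_tmul, LinearEquiv.coe_coe,
      LinearEquiv.coe_coe, ← ψ.map_apply_coact]
    generalize M.coact v = t
    induction t with
    | zero => simp
    | add t u ht hu => simp only [map_add, ht, hu]
    | tmul a b =>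
      simp only [TensorProduct.map_tmul]
      congr 1
      exact χ.apply_act a w

theorem braidedMul_tmul_tmul (M : YDModule k H A) (a b a' b' : A) :
    M.braidedMul (a ⊗ₜ b) (a' ⊗ₜ b') =
      TensorProduct.map (LinearMap.mulLeft k a) (LinearMap.mulRight k b')
        (M.braiding M (b ⊗ₜ a')) := by
  simp only [braidedMul, TensorProduct.curry_apply, LinearMap.comp_apply, LinearEquiv.coe_coe,
    TensorProduct.assoc_tmul, LinearMap.lTensor_tmul, TensorProduct.assoc_symm_tmul,
    LinearMap.rTensor_tmul]
  generalize M.braiding M (b ⊗ₜ a') = t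
  induction t with
  | zero => simp
  | add t u ht hu => simp only [map_add, TensorProduct.add_tmul, TensorProduct.tmul_add, ht, hu]
  | tmul c d => simp

/-- The product of the braided tensor square is natural for multiplicative isomorphisms. -/
theorem map_braidedMul {M : YDModule k H A} {N : YDModule k H' A'} (ψ : YDIso φ M N)
    (hψ : ∀ x y, ψ.toLinearEquiv (x * y) = ψ.toLinearEquiv x * ψ.toLinearEquiv y)
    (s t : A ⊗[k] A) :
    TensorProduct.map ψ.toLinearEquiv.toLinearMap ψ.toLinearEquiv.toLinearMap (M.braidedMul s t) =
      N.braidedMul (TensorProduct.map ψ.toLinearEquiv.toLinearMap ψ.toLinearEquiv.toLinearMap s)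
        (TensorProduct.map ψ.toLinearEquiv.toLinearMap ψ.toLinearEquiv.toLinearMap t) := by
  induction s with
  | zero => simp
  | add s s' hs hs' => simp only [map_add, LinearMap.add_apply, hs, hs']
  | tmul a b =>
    induction t with
    | zero => simp
    | add t t' ht ht' => simp only [map_add, ht, ht']
    | tmul a' b' =>
      have h := map_braiding ψ ψ (b ⊗ₜ a')
      simp only [TensorProduct.map_tmul] at h ⊢
      rw [braidedMul_tmul_tmul, braidedMul_tmul_tmul, ← h]
      generalize M.braiding M (b ⊗ₜ a') = u
      induction u with
      | zero => simp
      | add u u' hu hu' => simp only [map_add, hu, hu']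
      | tmul c d => simp [hψ]

end Braiding

variable {k G G' V V' : Type*} [Field k] [Group G] [Group G'] [AddCommGroup V] [Module k V]
  [AddCommGroup V'] [Module k V'] {M : YDModule k (MonoidAlgebra k G) V}
  {N : YDModule k (MonoidAlgebra k G') V'}

theorem tensor_act_single (g : G) (x : TensorAlgebra k V) :
    M.tensor.act (MonoidAlgebra.single g 1) x = M.tensorAct g x := by
  simp [tensor, ofGroup]

theorem tensor_act_ι (h : MonoidAlgebra k G) (v : V) :
    M.tensor.act h (TensorAlgebra.ι k v) = TensorAlgebra.ι k (M.act h v) := by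
  induction h using MonoidAlgebra.induction_linear with
  | zero => simp
  | add x y hx hy => simp only [map_add, LinearMap.add_apply, hx, hy]
  | single g r =>
    have hr : (MonoidAlgebra.single g r : MonoidAlgebra k G) = r • MonoidAlgebra.single g 1 := by
      simp
    simp only [hr, map_smul, LinearMap.smul_apply, tensor_act_single]
    simp [tensorAct]

theorem tensor_coact_ι (v : V) : M.tensor.coact (TensorAlgebra.ι k v) =
    (TensorAlgebra.ι k).lTensor (MonoidAlgebra k G) (M.coact v) :=
  TensorAlgebra.lift_ι_apply _ _

/-- The isomorphism of tensor algebras induced by a linear isomorphism. -/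
noncomputable def tensorAlgebraEquiv (e : V ≃ₗ[k] V') :
    TensorAlgebra k V ≃ₐ[k] TensorAlgebra k V' :=
  AlgEquiv.ofAlgHom (TensorAlgebra.lift k (TensorAlgebra.ι k ∘ₗ e.toLinearMap))
    (TensorAlgebra.lift k (TensorAlgebra.ι k ∘ₗ e.symm.toLinearMap))
    (by ext; simp) (by ext; simp)

@[simp]
theorem tensorAlgebraEquiv_ι (e : V ≃ₗ[k] V') (v : V) :
    tensorAlgebraEquiv e (TensorAlgebra.ι k v) = TensorAlgebra.ι k (e v) :=
  TensorAlgebra.lift_ι_apply _ _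

variable {φ : MonoidAlgebra k G ≃ₐc[k] MonoidAlgebra k G'}

/-- The isomorphism of the tensor algebras induced by an isomorphism of Yetter-Drinfeld modules. -/
noncomputable def tensorIso (ψ : YDIso φ M N) : YDIso φ M.tensor N.tensor where
  toLinearEquiv := (tensorAlgebraEquiv ψ.toLinearEquiv).toLinearEquiv
  map_act h x := by
    change tensorAlgebraEquiv ψ.toLinearEquiv _ =
      N.tensor.act _ (tensorAlgebraEquiv ψ.toLinearEquiv x)
    obtain ⟨f, hf⟩ := MonoidAlgebra.exists_mulEquiv φ
    induction h using MonoidAlgebra.induction_linear with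
    | zero => simp
    | add x y hx hy => simp only [map_add, LinearMap.add_apply, hx, hy]
    | single g r =>
      have hr : (MonoidAlgebra.single g r : MonoidAlgebra k G) =
        r • MonoidAlgebra.single g 1 := by simp
      simp only [hr, map_smul, LinearMap.smul_apply, tensor_act_single, hf]
      congr 1
      have : (tensorAlgebraEquiv ψ.toLinearEquiv : TensorAlgebra k V →ₐ[k] TensorAlgebra k V').comp
          (M.tensorAct g) = (N.tensorAct (f g)).comp
          (tensorAlgebraEquiv ψ.toLinearEquiv : TensorAlgebra k V →ₐ[k] TensorAlgebra k V') := by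
        ext v
        simp [tensorAct, ψ.apply_act, hf]
      exact DFunLike.congr_fun this x
  map_coact x := by
    have : (Algebra.TensorProduct.map
        ((φ : MonoidAlgebra k G ≃ₐ[k] MonoidAlgebra k G') : MonoidAlgebra k G →ₐ[k] _)
        (tensorAlgebraEquiv ψ.toLinearEquiv : TensorAlgebra k V →ₐ[k] TensorAlgebra k V')).comp
          M.tensorCoact = N.tensorCoact.comp
          (tensorAlgebraEquiv ψ.toLinearEquiv : TensorAlgebra k V →ₐ[k] TensorAlgebra k V') := by
      ext v
      simp only [tensorCoact, LinearMap.comp_apply, AlgHom.toLinearMap_apply, AlgHom.comp_apply,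
        TensorAlgebra.lift_ι_apply]
      have hι : (tensorAlgebraEquiv ψ.toLinearEquiv : TensorAlgebra k V →ₐ[k] TensorAlgebra k V')
        (TensorAlgebra.ι k v) = TensorAlgebra.ι k (ψ.toLinearEquiv v) := tensorAlgebraEquiv_ι _ _
      rw [hι, TensorAlgebra.lift_ι_apply, LinearMap.comp_apply, ← ψ.map_apply_coact]
      generalize M.coact v = t
      induction t with
      | zero => simp
      | add t u ht hu => simp only [map_add, ht, hu]
      | tmul a b =>
        simp only [LinearMap.lTensor_tmul, Algebra.TensorProduct.map_tmul, TensorProduct.map_tmul]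
        congr 1
        exact tensorAlgebraEquiv_ι _ _
    exact DFunLike.congr_fun this x

/-- The isomorphism of tensor algebras respects the braided comultiplications. -/
theorem map_tensorComul (ψ : YDIso φ M N) (x : TensorAlgebra k V) :
    TensorProduct.map (tensorAlgebraEquiv ψ.toLinearEquiv).toLinearMap
      (tensorAlgebraEquiv ψ.toLinearEquiv).toLinearMap (M.tensorComul x) =
    N.tensorComul (tensorAlgebraEquiv ψ.toLinearEquiv x) := by
  set F := tensorAlgebraEquiv ψ.toLinearEquiv with hF
  let dM := M.tensor.braidedMul ∘ₗ
        ((TensorProduct.mk k (TensorAlgebra k V) (TensorAlgebra k V)).flip 1 +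
          TensorProduct.mk k (TensorAlgebra k V) (TensorAlgebra k V) 1) ∘ₗ
        TensorAlgebra.ι k
  let dN := N.tensor.braidedMul ∘ₗ
        ((TensorProduct.mk k (TensorAlgebra k V') (TensorAlgebra k V')).flip 1 +
          TensorProduct.mk k (TensorAlgebra k V') (TensorAlgebra k V') 1) ∘ₗ
        TensorAlgebra.ι k
  -- The comultiplication is `x ↦ x · (1 ⊗ 1)`, where the tensor algebra acts on its braided tensor
  -- square so that `v ∈ V` acts as left multiplication by `v ⊗ 1 + 1 ⊗ v`.
  have key : ∀ t, TensorProduct.map F.toLinearMap F.toLinearMap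
      (TensorAlgebra.lift k (A := Module.End k _) dM x t) =
      TensorAlgebra.lift k (A := Module.End k _) dN (F x)
        (TensorProduct.map F.toLinearMap F.toLinearMap t) := by
    induction x using TensorAlgebra.induction with
    | algebraMap r => intro t; simp [Module.algebraMap_end_apply]
    | ι v =>
      intro t
      rw [TensorAlgebra.lift_ι_apply, hF, tensorAlgebraEquiv_ι, TensorAlgebra.lift_ι_apply]
      refine (map_braidedMul (tensorIso ψ) (fun x y => map_mul F x y) _ t).trans ?_
      change N.tensor.braidedMul _ _ = N.tensor.braidedMul _ _
      congr 2
      simp only [LinearMap.comp_apply, LinearMap.add_apply, LinearMap.flip_apply,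
        TensorProduct.mk_apply, map_add, TensorProduct.map_tmul]
      have h1 : (tensorIso ψ).toLinearEquiv 1 = 1 := map_one F
      have h2 : (tensorIso ψ).toLinearEquiv (TensorAlgebra.ι k v) =
        TensorAlgebra.ι k (ψ.toLinearEquiv v) := tensorAlgebraEquiv_ι _ _
      rw [LinearEquiv.coe_coe, h1, h2]
    | mul a b ha hb =>
      intro t
      rw [map_mul, map_mul, map_mul, Module.End.mul_apply, Module.End.mul_apply, ha, hb]
    | add a b ha hb =>
      intro t
      rw [map_add, map_add, map_add, LinearMap.add_apply, LinearMap.add_apply, map_add, ha, hb]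
  have := key (1 ⊗ₜ 1)
  rw [TensorProduct.map_tmul, AlgEquiv.toLinearMap_apply, map_one] at this
  exact this

theorem map_tensorAlgebraEquiv_pow (e : V ≃ₗ[k] V') (n : ℕ) :
    ((LinearMap.range (TensorAlgebra.ι k (M := V))) ^ n).map (tensorAlgebraEquiv e).toLinearMap =
      (LinearMap.range (TensorAlgebra.ι k (M := V'))) ^ n := by
  have : (tensorAlgebraEquiv e).toLinearMap =
    (tensorAlgebraEquiv e : TensorAlgebra k V →ₐ[k] TensorAlgebra k V').toLinearMap := rfl
  rw [this, Submodule.map_pow, ← LinearMap.range_comp]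
  congr 1
  ext x
  constructor
  · rintro ⟨v, rfl⟩; exact ⟨e v, (tensorAlgebraEquiv_ι e v).symm⟩
  · rintro ⟨v, rfl⟩; exact ⟨e.symm v, by simp⟩

theorem decompose_tensorAlgebraEquiv (e : V ≃ₗ[k] V') (x : TensorAlgebra k V) (n : ℕ) :
    (DirectSum.decompose (fun n : ℕ => (LinearMap.range (TensorAlgebra.ι k (M := V'))) ^ n)
      (tensorAlgebraEquiv e x) n : TensorAlgebra k V') = tensorAlgebraEquiv e
        (DirectSum.decompose (fun n : ℕ => (LinearMap.range (TensorAlgebra.ι k (M := V))) ^ n)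
          x n) := by
  induction x using DirectSum.Decomposition.inductionOn
    (fun n : ℕ => (LinearMap.range (TensorAlgebra.ι k (M := V))) ^ n) with
  | zero => simp
  | @homogeneous i x =>
    have hx : tensorAlgebraEquiv e x ∈ (LinearMap.range (TensorAlgebra.ι k (M := V'))) ^ i := by
      rw [← map_tensorAlgebraEquiv_pow e]; exact ⟨x, x.2, rfl⟩
    by_cases h : i = n
    · subst h
      rw [DirectSum.decompose_of_mem_same _ hx, DirectSum.decompose_of_mem_same _ x.2]
    · rw [DirectSum.decompose_of_mem_ne (fun n : ℕ => (LinearMap.range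
        (TensorAlgebra.ι k (M := V'))) ^ n) hx h, DirectSum.decompose_of_mem_ne
        (fun n : ℕ => (LinearMap.range (TensorAlgebra.ι k (M := V))) ^ n) x.2 h, map_zero]
  | add x y hx hy =>
    simp only [map_add, DirectSum.decompose_add, DirectSum.add_apply, Submodule.coe_add, hx, hy]

/-- The defining relations of Nichols algebras are preserved by isomorphisms. -/
theorem IsNicholsRelation.comap (ψ : YDIso φ M N) {I : Ideal (TensorAlgebra k V)}
    (hI : M.IsNicholsRelation I) :
    N.IsNicholsRelation (I.comap (tensorAlgebraEquiv ψ.toLinearEquiv).symm) := by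
  set F := tensorAlgebraEquiv ψ.toLinearEquiv with hF
  -- Every element of the transported ideal is the image of an element of `I`.
  have hmem : ∀ y ∈ I.comap F.symm, ∃ x ∈ I, F x = y := fun y hy =>
    ⟨F.symm y, hy, F.apply_symm_apply y⟩
  have hmem' : ∀ x ∈ I, F x ∈ I.comap F.symm := fun x hx => by
    rw [Ideal.mem_comap, F.symm_apply_apply]; exact hx
  let FI : I.restrictScalars k →ₗ[k] (I.comap F.symm).restrictScalars k :=
    (F.toLinearMap ∘ₗ (I.restrictScalars k).subtype).codRestrict _ fun x => hmem' x x.2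
  exact {
    isTwoSided := by
      have := hI.isTwoSided
      infer_instance
    homogeneous := fun n y hy => by
      obtain ⟨x, hx, rfl⟩ := hmem y hy
      rw [hF, decompose_tensorAlgebraEquiv]
      exact hmem' _ (hI.homogeneous n hx)
    two_le_degree := fun y hy => by
      obtain ⟨x, hx, rfl⟩ := hmem y hy
      have : (⨆ n : ℕ, (LinearMap.range (TensorAlgebra.ι k (M := V'))) ^ (n + 2)) =
          (⨆ n : ℕ, (LinearMap.range (TensorAlgebra.ι k (M := V))) ^ (n + 2)).map
            F.toLinearMap := by
        rw [Submodule.map_iSup]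
        exact iSup_congr fun n => (map_tensorAlgebraEquiv_pow ψ.toLinearEquiv (n + 2)).symm
      rw [this]
      exact ⟨x, hI.two_le_degree hx, rfl⟩
    isSub :=
      { act_mem := fun h y hy => by
          obtain ⟨x, hx, rfl⟩ := hmem y hy
          have := (tensorIso ψ).apply_act (φ.symm h) x
          rw [BialgEquiv.apply_symm_apply] at this
          change N.tensor.act h ((tensorIso ψ).toLinearEquiv x) ∈ _
          rw [← this]
          exact hmem' _ (hI.isSub.act_mem _ x hx)
        coact_mem := fun y hy => by
          obtain ⟨x, hx, rfl⟩ := hmem y hy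
          change N.tensor.coact ((tensorIso ψ).toLinearEquiv x) ∈ _
          rw [← (tensorIso ψ).map_apply_coact]
          obtain ⟨t, ht⟩ := hI.isSub.coact_mem x hx
          rw [← ht]
          refine ⟨TensorProduct.map (φ : MonoidAlgebra k G →ₗ[k] MonoidAlgebra k G') FI t, ?_⟩
          clear ht
          induction t with
          | zero => simp
          | add t u ht hu => simp only [map_add, ht, hu]
          | tmul a b => rfl }
    coideal := fun y hy => by
      obtain ⟨x, hx, rfl⟩ := hmem y hy
      rw [hF, ← map_tensorComul]
      obtain ⟨_, ⟨s, rfl⟩, _, ⟨t, rfl⟩, hst⟩ := Submodule.mem_sup.1 (hI.coideal x hx)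
      rw [← hst, map_add]
      refine Submodule.add_mem_sup ⟨TensorProduct.map FI F.toLinearMap s, ?_⟩
        ⟨TensorProduct.map F.toLinearMap FI t, ?_⟩
      · clear hst
        induction s with
        | zero => simp only [map_zero]
        | add t u ht hu => simp only [map_add, ht, hu]
        | tmul a b => rfl
      · clear hst
        induction t with
        | zero => simp only [map_zero]
        | add t u ht hu => simp only [map_add, ht, hu]
        | tmul a b => rfl }

/-- The defining ideals of Nichols algebras correspond, because each is the largest one with
properties that are preserved by isomorphisms. -/
theorem nicholsIdeal_eq_map (ψ : YDIso φ M N) :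
    N.nicholsIdeal = M.nicholsIdeal.map
      (tensorAlgebraEquiv ψ.toLinearEquiv : TensorAlgebra k V →+* TensorAlgebra k V') := by
  apply le_antisymm
  · have h := M.le_nicholsIdeal (IsNicholsRelation.comap ψ.symm N.isNicholsRelation_nicholsIdeal)
    intro y hy
    obtain ⟨x, rfl⟩ := (tensorAlgebraEquiv ψ.toLinearEquiv).surjective y
    exact Ideal.mem_map_of_mem _ (h hy)
  · rw [Ideal.map_le_iff_le_comap]
    intro x hx
    have h := N.le_nicholsIdeal (IsNicholsRelation.comap ψ M.isNicholsRelation_nicholsIdeal)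
    refine h (Ideal.mem_comap.2 ?_)
    change (tensorAlgebraEquiv ψ.toLinearEquiv).symm (tensorAlgebraEquiv ψ.toLinearEquiv x) ∈ _
    rw [AlgEquiv.symm_apply_apply]
    exact hx

end YDModule

/-! ### Nichols algebras and their degree one part -/

namespace YDModule

variable {k G G' V V' : Type*} [Field k] [Group G] [Group G'] [AddCommGroup V] [Module k V]
  [AddCommGroup V'] [Module k V'] {M : YDModule k (MonoidAlgebra k G) V}
  {N : YDModule k (MonoidAlgebra k G') V'} {φ : MonoidAlgebra k G ≃ₐc[k] MonoidAlgebra k G'}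

theorem nichols_act_toNichols (h : MonoidAlgebra k G) (x : TensorAlgebra k V) :
    M.nichols.act h (M.toNichols x) = M.toNichols (M.tensor.act h x) :=
  M.tensor.quotientAct_apply M.toNichols.toLinearMap _
    (M.ker_toNichols ▸ M.isNicholsRelation_nicholsIdeal.isSub) h x

theorem nichols_coact_toNichols (x : TensorAlgebra k V) :
    M.nichols.coact (M.toNichols x) = M.toNichols.toLinearMap.lTensor _ (M.tensor.coact x) :=
  M.tensor.quotientCoact_apply M.toNichols.toLinearMap _
    (M.ker_toNichols ▸ M.isNicholsRelation_nicholsIdeal.isSub) x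

theorem nicholsComul_toNichols (x : TensorAlgebra k V) :
    M.nicholsComul (M.toNichols x) =
      TensorProduct.map M.toNichols.toLinearMap M.toNichols.toLinearMap (M.tensorComul x) :=
  LinearMap.descend_apply M.toNichols.toLinearMap _ _ _ x

theorem nicholsCounit_toNichols (x : TensorAlgebra k V) :
    M.nicholsCounit (M.toNichols x) = TensorAlgebra.algebraMapInv x :=
  LinearMap.descend_apply M.toNichols.toLinearMap _ _ _ x

/-- The isomorphism of algebras between the Nichols algebras of isomorphic Yetter-Drinfeld
modules. -/
noncomputable def nicholsEquiv (ψ : YDIso φ M N) : M.Nichols ≃ₐ[k] N.Nichols :=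
  Ideal.quotientEquivAlg M.nicholsIdeal N.nicholsIdeal (tensorAlgebraEquiv ψ.toLinearEquiv)
    (nicholsIdeal_eq_map ψ)

theorem nicholsEquiv_toNichols (ψ : YDIso φ M N) (x : TensorAlgebra k V) :
    nicholsEquiv ψ (M.toNichols x) = N.toNichols (tensorAlgebraEquiv ψ.toLinearEquiv x) := rfl

theorem nicholsEquiv_comp_toNichols (ψ : YDIso φ M N) :
    (nicholsEquiv ψ).toLinearMap ∘ₗ M.toNichols.toLinearMap =
      N.toNichols.toLinearMap ∘ₗ (tensorAlgebraEquiv ψ.toLinearEquiv).toLinearMap := rfl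

/-- Isomorphic Yetter-Drinfeld modules have isomorphic Nichols algebras. -/
noncomputable def nicholsIso (ψ : YDIso φ M N) : NicholsIso φ M N where
  toLinearEquiv := (nicholsEquiv ψ).toLinearEquiv
  map_act h x := by
    obtain ⟨x, rfl⟩ := M.toNichols_surjective x
    change nicholsEquiv ψ _ = N.nichols.act _ (nicholsEquiv ψ (M.toNichols x))
    rw [nichols_act_toNichols, nicholsEquiv_toNichols, nicholsEquiv_toNichols,
      nichols_act_toNichols]
    exact congrArg N.toNichols ((tensorIso ψ).apply_act h x)
  map_coact x := by
    obtain ⟨x, rfl⟩ := M.toNichols_surjective x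
    change TensorProduct.map _ (nicholsEquiv ψ).toLinearMap _ =
      N.nichols.coact (nicholsEquiv ψ (M.toNichols x))
    rw [nichols_coact_toNichols, nicholsEquiv_toNichols, nichols_coact_toNichols]
    refine Eq.trans ?_ (congrArg _ ((tensorIso ψ).map_apply_coact x))
    generalize M.tensor.coact x = t
    induction t with
    | zero => simp
    | add t u ht hu => simp only [map_add, ht, hu]
    | tmul a b => rfl
  map_one := map_one (nicholsEquiv ψ)
  map_mul := map_mul (nicholsEquiv ψ)
  map_comul x := by
    obtain ⟨x, rfl⟩ := M.toNichols_surjective x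
    change TensorProduct.map (nicholsEquiv ψ).toLinearMap (nicholsEquiv ψ).toLinearMap _ =
      N.nicholsComul (nicholsEquiv ψ (M.toNichols x))
    rw [nicholsComul_toNichols, nicholsEquiv_toNichols, nicholsComul_toNichols, ← map_tensorComul]
    generalize M.tensorComul x = t
    induction t with
    | zero => simp
    | add t u ht hu => simp only [map_add, ht, hu]
    | tmul a b => rfl
  map_counit x := by
    obtain ⟨x, rfl⟩ := M.toNichols_surjective x
    change N.nicholsCounit (nicholsEquiv ψ (M.toNichols x)) = _
    rw [nicholsCounit_toNichols, nicholsEquiv_toNichols, nicholsCounit_toNichols]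
    have : TensorAlgebra.algebraMapInv.comp
        (tensorAlgebraEquiv ψ.toLinearEquiv : TensorAlgebra k V →ₐ[k] TensorAlgebra k V') =
        TensorAlgebra.algebraMapInv := by
      ext v
      simp [TensorAlgebra.algebraMapInv]
    exact DFunLike.congr_fun this x
  map_grading n := by
    change (M.nicholsGrading n).map (nicholsEquiv ψ).toLinearMap = _
    rw [nicholsGrading, nicholsGrading, ← Submodule.map_comp, nicholsEquiv_comp_toNichols,
      Submodule.map_comp, map_tensorAlgebraEquiv_pow]

variable (M) in
/-- The inclusion of a Yetter-Drinfeld module into its Nichols algebra. -/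
noncomputable def toNicholsι : V →ₗ[k] M.Nichols := M.toNichols.toLinearMap ∘ₗ TensorAlgebra.ι k

/-- The defining ideal of the Nichols algebra has no elements of degree one. -/
theorem toNicholsι_injective : Function.Injective M.toNicholsι := by
  rw [injective_iff_map_eq_zero]
  intro v hv
  have h1 : TensorAlgebra.ι k v ∈ M.nicholsIdeal.restrictScalars k := by
    rw [← M.ker_toNichols]; exact hv
  have h2 := M.isNicholsRelation_nicholsIdeal.two_le_degree h1
  -- The trivial square zero extension `k ⊕ V` is a quotient of the tensor algebra in which all
  -- products of two vectors vanish, but the vectors themselves survive.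
  let _ : Module kᵐᵒᵖ V := Module.compHom _ ((RingHom.id k).fromOpposite mul_comm)
  have : IsCentralScalar k V := ⟨fun r m => rfl⟩
  have h3 : (⨆ n : ℕ, (LinearMap.range (TensorAlgebra.ι k (M := V))) ^ (n + 2)) ≤
      LinearMap.ker (TensorAlgebra.toTrivSqZeroExt (R := k) (M := V)).toLinearMap := by
    refine iSup_le fun n => ?_
    rw [pow_succ, pow_succ, mul_assoc]
    refine Submodule.mul_le.2 fun a _ b hb => ?_
    have hb : b ∈ LinearMap.ker
        (TensorAlgebra.toTrivSqZeroExt (R := k) (M := V)).toLinearMap := by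
      refine Submodule.mul_le.2 ?_ hb
      rintro _ ⟨x, rfl⟩ _ ⟨y, rfl⟩
      simp
    have hb : TensorAlgebra.toTrivSqZeroExt (R := k) (M := V) b = 0 := hb
    simp [hb]
  have h4 : TensorAlgebra.toTrivSqZeroExt (R := k) (TensorAlgebra.ι k v) = 0 := h3 h2
  rw [TensorAlgebra.toTrivSqZeroExt_ι] at h4
  exact congrArg TrivSqZeroExt.snd h4

theorem range_toNicholsι : LinearMap.range M.toNicholsι = M.nicholsGrading 1 := by
  rw [nicholsGrading, pow_one, toNicholsι, LinearMap.range_comp]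

theorem nichols_act_toNicholsι (h : MonoidAlgebra k G) (v : V) :
    M.nichols.act h (M.toNicholsι v) = M.toNicholsι (M.act h v) :=
  (nichols_act_toNichols h _).trans (congrArg M.toNichols (tensor_act_ι h v))

theorem nichols_coact_toNicholsι (v : V) :
    M.nichols.coact (M.toNicholsι v) = M.toNicholsι.lTensor _ (M.coact v) := by
  refine (nichols_coact_toNichols _).trans ?_
  rw [tensor_coact_ι, ← LinearMap.comp_apply, ← LinearMap.lTensor_comp]
  rfl

/-- The degree one part of an isomorphism of graded Nichols algebras is an isomorphism of the
Yetter-Drinfeld modules. -/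
theorem nonempty_ydIso_of_nicholsIso (Ψ : NicholsIso φ M N) : Nonempty (YDIso φ M N) := by
  let E : M.Nichols ≃ₗ[k] N.Nichols := Ψ.toLinearEquiv
  have hrange :
      (LinearMap.range M.toNicholsι).map E.toLinearMap = LinearMap.range N.toNicholsι := by
    rw [range_toNicholsι, range_toNicholsι]
    exact Ψ.map_grading 1
  let e : V ≃ₗ[k] V' := (LinearEquiv.ofInjective M.toNicholsι toNicholsι_injective).trans
    ((E.submoduleMap _).trans ((LinearEquiv.ofEq _ _ hrange).trans
      (LinearEquiv.ofInjective N.toNicholsι toNicholsι_injective).symm))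
  have he : ∀ v, N.toNicholsι (e v) = E (M.toNicholsι v) := fun v => by
    have := (LinearEquiv.ofInjective N.toNicholsι toNicholsι_injective).apply_symm_apply
      (LinearEquiv.ofEq _ _ hrange (E.submoduleMap _
        (LinearEquiv.ofInjective M.toNicholsι toNicholsι_injective v)))
    exact congrArg Subtype.val this
  refine ⟨{ e with
    map_act := fun h v => ?_
    map_coact := fun v => ?_ }⟩
  · change e _ = N.act _ (e v)
    apply toNicholsι_injective (M := N)
    rw [he, ← nichols_act_toNicholsι, ← nichols_act_toNicholsι, he]
    exact Ψ.toYDIso.apply_act h _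
  · change TensorProduct.map _ e.toLinearMap _ = N.coact (e v)
    have hinj : Function.Injective (N.toNicholsι.lTensor (MonoidAlgebra k G')) :=
      Module.Flat.lTensor_preserves_injective_linearMap _ toNicholsι_injective
    apply hinj
    rw [← nichols_coact_toNicholsι, he]
    refine Eq.trans ?_ (Ψ.toYDIso.map_apply_coact _)
    rw [nichols_coact_toNicholsι]
    generalize M.coact v = t
    induction t with
    | zero => simp
    | add t u ht hu => simp only [map_add, ht, hu]
    | tmul a b =>
      simp only [TensorProduct.map_tmul, LinearMap.lTensor_tmul]
      congr 1
      exact he b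

end YDModule

/-! ### Pointed Yetter-Drinfeld modules -/

namespace YDModule

section Pointed

variable {k G V : Type*} [Field k] [Group G] [AddCommGroup V] [Module k V]

/-- A vector `v` of a Yetter-Drinfeld module over `kG` has weight `(g, χ)` if its coaction is
`v ↦ g ⊗ v` and every `h ∈ G` acts on it by the scalar `χ h`. -/
structure HasWeight (M : YDModule k (MonoidAlgebra k G) V) (g : G) (χ : G → k) (v : V) : Prop where
  coact_eq : M.coact v = MonoidAlgebra.single g 1 ⊗ₜ v
  act_eq : ∀ h, M.act (MonoidAlgebra.single h 1) v = χ h • v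

variable {M : YDModule k (MonoidAlgebra k G) V}

theorem coact_act_single_of_coact_eq {g : G} {v : V}
    (hv : M.coact v = MonoidAlgebra.single g 1 ⊗ₜ v) (h : G) :
    M.coact (M.act (MonoidAlgebra.single h 1) v) =
      MonoidAlgebra.single (h * g * h⁻¹) 1 ⊗ₜ M.act (MonoidAlgebra.single h 1) v := by
  rw [M.compat, hv]
  simp [MonoidAlgebra.antipode_single, mul_assoc]

theorem HasWeight.isSub_span {g : G} {χ : G → k} {v : V} (hv : M.HasWeight g χ v) :
    M.IsSub (Submodule.span k {v}) where
  act_mem h w hw := by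
    obtain ⟨r, rfl⟩ := Submodule.mem_span_singleton.1 hw
    induction h using MonoidAlgebra.induction_linear with
    | zero => simp
    | add x y hx hy => rw [map_add, LinearMap.add_apply]; exact add_mem hx hy
    | single h s =>
      have hs : (MonoidAlgebra.single h s : MonoidAlgebra k G) = s • MonoidAlgebra.single h 1 := by
        simp
      simp only [hs, map_smul, LinearMap.smul_apply, hv.act_eq]
      exact Submodule.smul_mem _ _ (Submodule.smul_mem _ _ (Submodule.smul_mem _ _
        (Submodule.mem_span_singleton_self v)))
  coact_mem w hw := by
    obtain ⟨r, rfl⟩ := Submodule.mem_span_singleton.1 hw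
    refine ⟨r • (MonoidAlgebra.single g 1 ⊗ₜ ⟨v, Submodule.mem_span_singleton_self v⟩), ?_⟩
    rw [map_smul, LinearMap.lTensor_tmul, map_smul, hv.coact_eq]
    rfl

/-- The weight of a nonzero vector consists of a central element and of a character. -/
theorem HasWeight.exists_character {g : G} {χ : G → k} {v : V} (hv : M.HasWeight g χ v)
    (hv0 : v ≠ 0) : g ∈ Subgroup.center G ∧ ∃ χ' : G →* kˣ, ∀ h, (χ' h : k) = χ h := by
  have h1 : χ 1 = 1 := by
    have := hv.act_eq 1
    rw [← MonoidAlgebra.one_def, map_one, Module.End.one_apply] at this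
    exact smul_left_injective k hv0 (by simpa using this.symm)
  have hmul : ∀ a b, χ (a * b) = χ a * χ b := fun a b => by
    have := hv.act_eq (a * b)
    have hab : (MonoidAlgebra.single (a * b) 1 : MonoidAlgebra k G) =
      MonoidAlgebra.single a 1 * MonoidAlgebra.single b 1 := by simp
    rw [hab, map_mul, Module.End.mul_apply, hv.act_eq, map_smul, hv.act_eq, smul_smul] at this
    rw [mul_comm]
    exact smul_left_injective k hv0 this.symm
  have hne : ∀ a, χ a ≠ 0 := fun a h => by
    have := hmul a a⁻¹
    rw [mul_inv_cancel, h1, h, zero_mul] at this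
    exact one_ne_zero this
  refine ⟨Subgroup.mem_center_iff.2 fun h => ?_,
    MonoidHom.toHomUnits ⟨⟨χ, h1⟩, hmul⟩, fun h => rfl⟩
  have h2 := coact_act_single_of_coact_eq hv.coact_eq h
  rw [hv.act_eq, map_smul, hv.coact_eq, TensorProduct.tmul_smul] at h2
  have h3 := smul_right_injective _ (hne h) h2
  obtain ⟨f, hf⟩ : ∃ f : Module.Dual k V, f v ≠ 0 := by
    by_contra! hall
    exact hv0 ((Module.forall_dual_apply_eq_zero_iff k v).1 hall)
  have h4 := congrArg (TensorProduct.rid k _ ∘ f.lTensor (MonoidAlgebra k G)) h3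
  simp only [Function.comp_apply, LinearMap.lTensor_tmul, TensorProduct.rid_tmul] at h4
  have h5 := MonoidAlgebra.single_left_injective one_ne_zero (smul_right_injective _ hf h4)
  calc h * g = (h * g * h⁻¹) * h := by group
    _ = g * h := by rw [← h5]

/-- A one-dimensional Yetter-Drinfeld submodule is spanned by a vector with a weight: its coaction
is given by a group-like element, that is, by an element of the group. -/
theorem IsSub.exists_hasWeight {W : Submodule k V} (hW : M.IsSub W)
    (h1 : Module.finrank k W = 1) :
    ∃ v ≠ 0, W = Submodule.span k {v} ∧ ∃ g χ, M.HasWeight g χ v := by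
  obtain ⟨⟨v, hv⟩, hv0, hspan⟩ := finrank_eq_one_iff'.1 h1
  have hv0 : v ≠ 0 := fun h => hv0 (Subtype.ext h)
  have hspan : ∀ w ∈ W, ∃ r : k, r • v = w := fun w hw => by
    obtain ⟨r, hr⟩ := hspan ⟨w, hw⟩
    exact ⟨r, congrArg Subtype.val hr⟩
  obtain ⟨f, hf⟩ : ∃ f : Module.Dual k V, f v ≠ 0 := by
    by_contra! hall
    exact hv0 ((Module.forall_dual_apply_eq_zero_iff k v).1 hall)
  obtain ⟨a, ha⟩ : ∃ a : MonoidAlgebra k G, M.coact v = a ⊗ₜ v := by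
    obtain ⟨t, ht⟩ := hW.coact_mem v hv
    rw [← ht]
    clear ht
    induction t with
    | zero => exact ⟨0, by simp⟩
    | add t u ht hu =>
      obtain ⟨a, ha⟩ := ht
      obtain ⟨b, hb⟩ := hu
      exact ⟨a + b, by rw [map_add, ha, hb, TensorProduct.add_tmul]⟩
    | tmul a w =>
      obtain ⟨r, hr⟩ := hspan w w.2
      exact ⟨r • a, by rw [LinearMap.lTensor_tmul, Submodule.subtype_apply, ← hr,
        TensorProduct.tmul_smul, TensorProduct.smul_tmul']⟩
  have hcounit : Coalgebra.counit (R := k) a = 1 := by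
    have := LinearMap.congr_fun M.rTensor_counit v
    rw [LinearMap.comp_apply, ha, LinearMap.rTensor_tmul] at this
    have := congrArg (TensorProduct.lid k V) this
    simp only [TensorProduct.mk_apply, TensorProduct.lid_tmul] at this
    exact smul_left_injective k hv0 this
  have hcomul : Coalgebra.comul (R := k) a = a ⊗ₜ a := by
    have := LinearMap.congr_fun M.coassoc v
    simp only [LinearMap.comp_apply, LinearEquiv.coe_coe] at this
    rw [ha, LinearMap.rTensor_tmul, LinearMap.lTensor_tmul, ha, ← TensorProduct.assoc_tmul] at this
    have := (TensorProduct.assoc k _ _ _).injective this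
    have := congrArg (TensorProduct.rid k _ ∘ f.lTensor _) this
    simp only [Function.comp_apply, LinearMap.lTensor_tmul, TensorProduct.rid_tmul] at this
    exact smul_right_injective _ hf this
  obtain ⟨g, hg⟩ := MonoidAlgebra.isGroupLikeElem_iff_mem_range_single_one.1
    (⟨hcounit, hcomul⟩ : IsGroupLikeElem k a)
  have hact : ∀ h, ∃ r : k, r • v = M.act (MonoidAlgebra.single h 1) v := fun h =>
    hspan _ (hW.act_mem _ v hv)
  choose χ hχ using hact
  refine ⟨v, hv0, le_antisymm (fun w hw => ?_) ?_, g, χ, ⟨by rw [ha, ← hg], fun h => (hχ h).symm⟩⟩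
  · obtain ⟨r, rfl⟩ := hspan w hw
    exact Submodule.smul_mem _ _ (Submodule.mem_span_singleton_self v)
  · rwa [Submodule.span_singleton_le_iff_mem]

theorem isPointed_of_basis {K : Type*} (b : Module.Basis K k V)
    (hb : ∀ i, ∃ g χ, M.HasWeight g χ (b i)) : M.IsPointed := by
  refine ⟨Set.range fun i => Submodule.span k {b i}, ?_, ?_, ?_⟩
  · rintro _ ⟨i, rfl⟩
    obtain ⟨g, χ, h⟩ := hb i
    exact ⟨h.isSub_span, finrank_span_singleton (b.ne_zero i)⟩
  · exact b.linearIndependent.iSupIndep_span_singleton.sSupIndep_range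
  · rw [sSup_range, ← Submodule.span_range_eq_iSup, b.span_eq]

theorem isPointed_of_span_eq_top
    (h : Submodule.span k {v | ∃ g χ, M.HasWeight g χ v} = ⊤) : M.IsPointed := by
  obtain ⟨b, hbt, hspan, hli⟩ := exists_linearIndependent k {v | ∃ g χ, M.HasWeight g χ v}
  refine isPointed_of_basis (Module.Basis.mk hli ?_) fun i => ?_
  · rw [Subtype.range_coe_subtype, Set.ofPred_mem_eq, hspan, h]
  · rw [Module.Basis.mk_apply]; exact hbt i.2

/-- A pointed Yetter-Drinfeld module has a basis of vectors with weights. -/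
theorem IsPointed.exists_basis {V : Type uV} [AddCommGroup V] [Module k V]
    {M : YDModule k (MonoidAlgebra k G) V} (hM : M.IsPointed) :
    ∃ (K : Type uV) (b : Module.Basis K k V), ∀ i, ∃ g χ, M.HasWeight g χ (b i) := by
  obtain ⟨S, hS, hind, htop⟩ := hM
  choose v hv0 hv hw using fun W : S => (hS W W.2).1.exists_hasWeight (hS W W.2).2
  have hli : LinearIndependent k v := by
    refine ((sSupIndep_iff S).1 hind).linearIndependent Subtype.val (fun W => ?_) hv0
    rw [hv W]
    exact Submodule.mem_span_singleton_self _
  refine ⟨S, Module.Basis.mk hli ?_, fun W => ?_⟩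
  · rw [← htop]
    refine sSup_le fun W hW => ?_
    exact (hv ⟨W, hW⟩).le.trans (Submodule.span_mono (by rintro _ rfl; exact ⟨_, rfl⟩))
  · rw [Module.Basis.mk_apply]; exact hw W

theorem hasWeight_single {J : Type*} (F : ESC k G J) (i : J) :
    F.V.HasWeight (F.g i) (fun h => (F.χ i h : k)) (Finsupp.single i 1) where
  coact_eq := monomial_coact_single i 1
  act_eq h := by
    refine (monomial_act_single h i 1).trans ?_
    rw [Finsupp.smul_single, smul_eq_mul, mul_comm]

/-- A basis of vectors with weights identifies a Yetter-Drinfeld module with the one of an element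
system. -/
theorem exists_esc_of_basis {K : Type*} (b : Module.Basis K k V)
    (hb : ∀ i, ∃ g χ, M.HasWeight g χ (b i)) :
    ∃ F : ESC k G K, Nonempty (YDIso (BialgEquiv.refl k (MonoidAlgebra k G)) M F.V) := by
  choose g χ h using hb
  choose hg χ' hχ using fun i => (h i).exists_character (b.ne_zero i)
  let F : ESC k G K := ⟨g, hg, χ'⟩
  refine ⟨F, ⟨{ b.repr with
    map_act := fun x v => ?_
    map_coact := fun v => ?_ }⟩⟩
  · change b.repr _ = F.V.act x (b.repr v)
    have key : b.repr.toLinearMap ∘ₗ M.act x = F.V.act x ∘ₗ b.repr.toLinearMap := by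
      refine b.ext fun i => ?_
      simp only [LinearMap.comp_apply, LinearEquiv.coe_coe, b.repr_self]
      induction x using MonoidAlgebra.induction_linear with
      | zero => simp
      | add x y hx hy => simp only [map_add, LinearMap.add_apply, hx, hy]
      | single y s =>
        have hs : (MonoidAlgebra.single y s : MonoidAlgebra k G) =
          s • MonoidAlgebra.single y 1 := by simp
        simp only [hs, map_smul, LinearMap.smul_apply]
        rw [(h i).act_eq, (hasWeight_single F i).act_eq, map_smul, b.repr_self]
        exact congrArg (fun r : k => s • r • Finsupp.single i (1 : k)) (hχ i y).symm
    exact LinearMap.congr_fun key v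
  · change TensorProduct.map _ b.repr.toLinearMap _ = F.V.coact (b.repr v)
    have key : TensorProduct.map
        ((BialgEquiv.refl k (MonoidAlgebra k G) : _ ≃ₐc[k] _) : _ →ₗ[k] MonoidAlgebra k G)
        b.repr.toLinearMap ∘ₗ M.coact = F.V.coact ∘ₗ b.repr.toLinearMap := by
      refine b.ext fun i => ?_
      simp only [LinearMap.comp_apply, LinearEquiv.coe_coe, b.repr_self]
      rw [(h i).coact_eq, (hasWeight_single F i).coact_eq, TensorProduct.map_tmul]
      exact congrArg (MonoidAlgebra.single (g i) (1 : k) ⊗ₜ[k] ·) (b.repr_self i)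
    exact LinearMap.congr_fun key v

theorem isPointed_of_ydIso {J : Type*} (F : ESC k G J)
    (ψ : YDIso (BialgEquiv.refl k (MonoidAlgebra k G)) M F.V) : M.IsPointed := by
  refine isPointed_of_basis (⟨ψ.toLinearEquiv⟩ : Module.Basis J k V) fun i =>
    ⟨F.g i, fun h => (F.χ i h : k), ?_, fun h => ?_⟩
  · change M.coact (ψ.toLinearEquiv.symm (Finsupp.single i 1)) =
      _ ⊗ₜ (ψ.toLinearEquiv.symm (Finsupp.single i 1))
    refine (ψ.symm.map_apply_coact (Finsupp.single i 1)).symm.trans ?_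
    rw [(hasWeight_single F i).coact_eq]
    rfl
  · change M.act _ (ψ.toLinearEquiv.symm (Finsupp.single i 1)) =
      _ • (ψ.toLinearEquiv.symm (Finsupp.single i 1))
    refine (ψ.symm.apply_act _ (Finsupp.single i 1)).symm.trans ?_
    refine (congrArg ψ.symm.toLinearEquiv ((hasWeight_single F i).act_eq h)).trans ?_
    rw [map_smul]
    rfl

end Pointed

end YDModule

/-! ### Yetter-Drinfeld modules over finite abelian groups -/

section Characters

variable {k G : Type*} [Field k] [Group G]

/-- A finite abelian group whose exponent is the order of a root of unity in `k` has enough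
characters with values in `k`, and their number is invertible in `k`. -/
theorem exists_character_of_isPrimitiveRoot [Finite G] (hcomm : ∀ a b : G, a * b = b * a) {ζ : k}
    (hζ : IsPrimitiveRoot ζ (Monoid.exponent G)) :
    Finite (G →* kˣ) ∧ (Nat.card (G →* kˣ) : k) ≠ 0 ∧ ∀ g : G, g ≠ 1 → ∃ χ : G →* kˣ, χ g ≠ 1 := by
  let _ : CommGroup G := { ‹Group G› with mul_comm := hcomm }
  have : NeZero (Monoid.exponent G) := ⟨Monoid.exponent_ne_zero_of_finite⟩
  have : HasEnoughRootsOfUnity k (Monoid.exponent G) := ⟨⟨ζ, hζ⟩, inferInstance⟩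
  have hfin : Finite (G →* kˣ) :=
    Finite.of_equiv G (CommGroup.monoidHom_mulEquiv_of_hasEnoughRootsOfUnity G k).some.symm
  refine ⟨hfin, ?_, fun g hg => CommGroup.exists_apply_ne_one_of_hasEnoughRootsOfUnity G k hg⟩
  rw [CommGroup.card_monoidHom_of_hasEnoughRootsOfUnity]
  intro h0
  -- The characteristic is a prime divisor of the order of the group, hence of its exponent.
  obtain ⟨p, hp⟩ := CharP.exists k
  have hdvd : p ∣ Nat.card G := (CharP.cast_eq_zero_iff k p _).1 h0
  have hp0 : p ≠ 0 := fun h => by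
    rw [h, zero_dvd_iff] at hdvd
    exact Nat.card_pos.ne' hdvd
  have : Fact p.Prime := ⟨(CharP.char_is_prime_or_zero k p).resolve_right hp0⟩
  obtain ⟨g, hg⟩ := exists_prime_orderOf_dvd_card' p hdvd
  have hdvd' : p ∣ Monoid.exponent G := hg ▸ Monoid.order_dvd_exponent g
  exact hζ.neZero'.out ((CharP.cast_eq_zero_iff k p _).2 hdvd')

theorem sum_character_eq_zero [Fintype (G →* kˣ)] {g : G} (hg : ∃ χ : G →* kˣ, χ g ≠ 1) :
    ∑ χ : G →* kˣ, (χ g : k) = 0 := by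
  obtain ⟨χ, hχ⟩ := hg
  have h1 : (χ g : k) * ∑ ψ : G →* kˣ, (ψ g : k) = ∑ ψ : G →* kˣ, (ψ g : k) := by
    rw [Finset.mul_sum]
    exact Fintype.sum_equiv (Equiv.mulLeft χ) _ _ fun ψ => by simp
  have h2 : ((χ g : k) - 1) * ∑ ψ : G →* kˣ, (ψ g : k) = 0 := by rw [sub_mul, h1, one_mul, sub_self]
  refine (mul_eq_zero.1 h2).resolve_left fun h => hχ ?_
  rw [sub_eq_zero] at h
  exact Units.ext h

end Characters

namespace YDModule

variable {k G V : Type*} [Field k] [AddCommGroup V] [Module k V]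

/-- The coefficient of `g` in an element of `kG ⊗ V`. -/
noncomputable def coeffAt (g : G) : MonoidAlgebra k G ⊗[k] V →ₗ[k] V :=
  (TensorProduct.lid k V).toLinearMap ∘ₗ
    (Finsupp.lapply g ∘ₗ (MonoidAlgebra.coeffLinearEquiv k).toLinearMap).rTensor V

theorem coeffAt_tmul (g : G) (a : MonoidAlgebra k G) (v : V) :
    coeffAt g (a ⊗ₜ v) = a.coeff g • v := by
  simp [coeffAt]

theorem sum_single_tmul_coeffAt [Fintype G] (t : MonoidAlgebra k G ⊗[k] V) :
    ∑ g, MonoidAlgebra.single g 1 ⊗ₜ[k] coeffAt g t = t := by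
  classical
  induction t with
  | zero => simp
  | add t u ht hu =>
    conv_rhs => rw [← ht, ← hu]
    simp only [map_add, TensorProduct.tmul_add, Finset.sum_add_distrib]
  | tmul a v =>
    induction a using MonoidAlgebra.induction_linear with
    | zero => simp
    | add a b ha hb =>
      conv_rhs => rw [TensorProduct.add_tmul, ← ha, ← hb]
      simp only [TensorProduct.add_tmul, map_add, TensorProduct.tmul_add, Finset.sum_add_distrib]
    | single h r =>
      rw [Finset.sum_eq_single h]
      · simp [coeffAt_tmul, TensorProduct.tmul_smul, TensorProduct.smul_tmul']
      · intro g _ hg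
        simp [coeffAt_tmul, Finsupp.single_eq_of_ne hg]
      · simp

variable [Group G] (M : YDModule k (MonoidAlgebra k G) V)

theorem coact_coeffAt_coact (g : G) (v : V) : M.coact (coeffAt g (M.coact v)) =
    MonoidAlgebra.single g 1 ⊗ₜ coeffAt g (M.coact v) := by
  have h1 := congrArg (coeffAt g) (LinearMap.congr_fun M.coassoc v)
  simp only [LinearMap.comp_apply, LinearEquiv.coe_coe] at h1
  have h2 : ∀ t : MonoidAlgebra k G ⊗[k] V,
      coeffAt g (M.coact.lTensor _ t) = M.coact (coeffAt g t) := fun t => by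
    induction t with
    | zero => simp
    | add t u ht hu => simp only [map_add, ht, hu]
    | tmul a v => simp [coeffAt_tmul]
  have h3 : ∀ t : MonoidAlgebra k G ⊗[k] V, coeffAt g (TensorProduct.assoc k _ _ _
      ((Coalgebra.comul (R := k) (A := MonoidAlgebra k G)).rTensor V t)) =
        MonoidAlgebra.single g 1 ⊗ₜ coeffAt g t := fun t => by
    induction t with
    | zero => simp
    | add t u ht hu => simp only [map_add, ht, hu, TensorProduct.tmul_add]
    | tmul a v =>
      induction a using MonoidAlgebra.induction_linear with
      | zero => simp
      | add a b ha hb => simp only [TensorProduct.add_tmul, map_add, ha, hb, TensorProduct.tmul_add]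
      | single h r =>
        by_cases hgh : g = h
        · subst hgh
          simp [coeffAt_tmul, TensorProduct.tmul_smul, TensorProduct.smul_tmul']
        · simp [coeffAt_tmul, Finsupp.single_eq_of_ne hgh]
  rw [h2, h3] at h1
  exact h1.symm

theorem sum_coeffAt_coact [Fintype G] (v : V) : ∑ g, coeffAt g (M.coact v) = v := by
  have h1 := congrArg (TensorProduct.lid k V) (LinearMap.congr_fun M.rTensor_counit v)
  simp only [LinearMap.comp_apply, TensorProduct.mk_apply, TensorProduct.lid_tmul, one_smul] at h1
  rw [← sum_single_tmul_coeffAt (M.coact v)] at h1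
  refine Eq.trans ?_ h1
  simp

/-- Over a finite abelian group with enough characters, the homogeneous components of a vector are
sums of their projections `∑ h, χ(h⁻¹) h • w` to the isotypic components, up to the number of
characters. -/
theorem isPointed_of_finite [Finite G] (hcomm : ∀ a b : G, a * b = b * a) {ζ : k}
    (hζ : IsPrimitiveRoot ζ (Monoid.exponent G)) : M.IsPointed := by
  classical
  obtain ⟨hfin, hcard, hsep⟩ := exists_character_of_isPrimitiveRoot hcomm hζ
  have := Fintype.ofFinite G
  have := Fintype.ofFinite (G →* kˣ)
  refine isPointed_of_span_eq_top (eq_top_iff.2 fun v _ => ?_)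
  rw [← sum_coeffAt_coact M v]
  refine Submodule.sum_mem _ fun g _ => ?_
  have hw := coact_coeffAt_coact M g v
  generalize coeffAt g (M.coact v) = w at hw
  let e : (G →* kˣ) → V := fun χ =>
    ∑ h, (χ h⁻¹ : k) • M.act (MonoidAlgebra.single h 1) w
  have he : ∀ χ : G →* kˣ, M.HasWeight g (fun h => (χ h : k)) (e χ) := fun χ => by
    refine ⟨?_, fun y => ?_⟩
    · simp only [e, map_sum, map_smul, TensorProduct.tmul_sum, TensorProduct.tmul_smul]
      refine Finset.sum_congr rfl fun h _ => ?_
      rw [coact_act_single_of_coact_eq hw, hcomm h g, mul_inv_cancel_right]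
    · simp only [e, map_sum, map_smul, Finset.smul_sum, smul_smul]
      refine Fintype.sum_equiv (Equiv.mulLeft y) _ _ fun h => ?_
      have hyh : (MonoidAlgebra.single (y * h) 1 : MonoidAlgebra k G) =
        MonoidAlgebra.single y 1 * MonoidAlgebra.single h 1 := by simp
      rw [Equiv.coe_mulLeft, hyh, map_mul, Module.End.mul_apply]
      congr 1
      rw [← Units.val_mul, ← map_mul]
      change (χ h⁻¹ : k) = (χ (y * (y * h)⁻¹) : kˣ)
      rw [hcomm y h, mul_inv_rev, mul_inv_cancel_left]
  have hsum : ∑ χ, e χ = (Nat.card (G →* kˣ) : k) • w := by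
    simp only [e]
    rw [Finset.sum_comm]
    simp only [← Finset.sum_smul]
    rw [Finset.sum_eq_single 1]
    · rw [← MonoidAlgebra.one_def, map_one, Module.End.one_apply]
      simp
    · intro h _ hh
      rw [sum_character_eq_zero (hsep h⁻¹ (inv_ne_one.2 hh)), zero_smul]
    · simp
  have hwe : w = (Nat.card (G →* kˣ) : k)⁻¹ • ∑ χ, e χ := by
    rw [hsum, smul_smul, inv_mul_cancel₀ hcard, one_smul]
  rw [hwe]
  exact Submodule.smul_mem _ _ (Submodule.sum_mem _ fun χ _ =>
    Submodule.subset_span ⟨g, _, he χ⟩)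

end YDModule

/-! ### Central ramification systems and element systems -/

section Central

variable {G : Type*} [Group G]

theorem ConjClasses.carrier_mk_of_mem_center {g : G} (hg : g ∈ Subgroup.center G) :
    (ConjClasses.mk g).carrier = {g} := by
  ext x
  rw [ConjClasses.mem_carrier_iff_mk_eq, ConjClasses.mk_eq_mk_iff_isConj, isConj_comm, isConj_iff,
    Set.mem_singleton_iff]
  constructor
  · rintro ⟨c, rfl⟩
    rw [Subgroup.mem_center_iff.1 hg c, mul_inv_cancel_right]
  · rintro rfl
    exact ⟨1, by simp⟩

theorem ConjClasses.eq_of_mk_eq_of_mem_center {g x : G} (hg : g ∈ Subgroup.center G)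
    (h : ConjClasses.mk x = ConjClasses.mk g) : x = g := by
  have := ConjClasses.mem_carrier_iff_mk_eq.2 h
  rwa [ConjClasses.carrier_mk_of_mem_center hg] at this

theorem ConjClasses.map_bijective {G' : Type*} [Group G'] (φ : G ≃* G') :
    Function.Bijective (ConjClasses.map φ.toMonoidHom) := by
  constructor
  · intro C D hCD
    obtain ⟨a, rfl⟩ := ConjClasses.mk_surjective C
    obtain ⟨b, rfl⟩ := ConjClasses.mk_surjective D
    have hCD : ConjClasses.mk (φ a) = ConjClasses.mk (φ b) := hCD
    obtain ⟨y, hy⟩ := isConj_iff.1 (ConjClasses.mk_eq_mk_iff_isConj.1 hCD)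
    rw [ConjClasses.mk_eq_mk_iff_isConj, isConj_iff]
    exact ⟨φ.symm y, φ.injective (by simpa using hy)⟩
  · intro C
    obtain ⟨a, rfl⟩ := ConjClasses.mk_surjective C
    refine ⟨ConjClasses.mk (φ.symm a), ?_⟩
    change ConjClasses.mk (φ (φ.symm a)) = _
    rw [φ.apply_symm_apply]

theorem ClassReps.u_mem (u : ClassReps G) (C : ConjClasses G) : u.u C ∈ C.carrier :=
  ConjClasses.mem_carrier_iff_mk_eq.2 (u.mk_u C)

theorem ClassReps.mem_center_of_carrier_eq (u : ClassReps G) {C : ConjClasses G} {g : G}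
    (h : C.carrier = {g}) : u.u C ∈ Subgroup.center G := by
  rw [Subgroup.mem_center_iff]
  intro x
  have h1 : u.u C = g := by simpa [h] using u.u_mem C
  have h2 : ((conjInClass ⟨u.u C, u.u_mem C⟩ x⁻¹ : C.carrier) : G) = g := by
    simpa only [h, Set.mem_singleton_iff] using (conjInClass ⟨u.u C, u.u_mem C⟩ x⁻¹ : C.carrier).2
  rw [← h1] at h2
  simp only [conjInClass, inv_inv] at h2
  exact mul_inv_eq_iff_eq_mul.1 h2

end Central

namespace RSC

variable {k G : Type*} [Field k] [Group G] {R : RSC k G}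

theorem IsCentral.subsingleton (hR : R.IsCentral) {C : ConjClasses G} (i : R.I C) :
    Subsingleton C.carrier := by
  obtain ⟨g, hg⟩ := hR C ⟨i⟩
  rw [hg]
  infer_instance

theorem IsCentral.u_mem_center (hR : R.IsCentral) {C : ConjClasses G} (i : R.I C) :
    R.u.u C ∈ Subgroup.center G := by
  obtain ⟨g, hg⟩ := hR C ⟨i⟩
  exact R.u.mem_center_of_carrier_eq hg

theorem IsCentral.mem_centralizer (hR : R.IsCentral) {C : ConjClasses G} (i : R.I C) (h : G) :
    h ∈ Subgroup.centralizer {R.u.u C} := by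
  rw [Subgroup.mem_centralizer_singleton_iff]
  exact Subgroup.mem_center_iff.1 (hR.u_mem_center i) h

/-- The characters of a central ramification system are defined on the whole group. -/
def IsCentral.character (hR : R.IsCentral) {C : ConjClasses G} (i : R.I C) : G →* kˣ :=
  (R.χ C i).comp ((MonoidHom.id G).codRestrict _ (hR.mem_centralizer i))

variable (T : CosetReps R.u)

theorem IsCentral.shift_eq (hR : R.IsCentral) (a : R.Label) (h : G) :
    (R.arrowBimodule T).shift a h = a := by
  obtain ⟨C, i, c⟩ := a
  have := hR.subsingleton i
  change (⟨C, i, conjInClass c h⟩ : R.Label) = _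
  rw [Subsingleton.elim (conjInClass c h) c]

theorem IsCentral.deg_eq (hR : R.IsCentral) (a : R.Label) :
    (R.arrowBimodule T).deg a = R.u.u a.1 := by
  obtain ⟨C, i, c⟩ := a
  have := hR.subsingleton i
  exact congrArg Subtype.val (Subsingleton.elim c ⟨R.u.u C, R.u.u_mem C⟩)

/-- In a central ramification system the coset representatives do not affect the right action on
the arrows, because the characters have commutative values. -/
theorem IsCentral.coef_eq (hR : R.IsCentral) (a : R.Label) (h : G) :
    (R.arrowBimodule T).coef a h = (hR.character a.2.1 h : k) := by
  obtain ⟨C, i, c⟩ := a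
  have := hR.subsingleton i
  change ((R.χ C i (T.zeta C c h) : kˣ) : k) = _
  have hz : T.zeta C c h = (MonoidHom.id G).codRestrict _ (hR.mem_centralizer i)
      (T.rep C c * h * (T.rep C c)⁻¹) := by
    apply Subtype.ext
    change T.rep C c * h * (T.rep C (conjInClass c h))⁻¹ = _
    rw [Subsingleton.elim (conjInClass c h) c]
    rfl
  rw [hz]
  change ((hR.character i _ : kˣ) : k) = _
  rw [map_mul, map_mul, map_inv, mul_inv_cancel_comm]

end RSC

theorem RSC.isCentral_of_comm {k G : Type*} [Field k] [Group G] (h : ∀ a b : G, a * b = b * a)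
    (R : RSC k G) : R.IsCentral := fun C _ => by
  obtain ⟨g, rfl⟩ := ConjClasses.mk_surjective C
  exact ⟨g, ConjClasses.carrier_mk_of_mem_center (Subgroup.mem_center_iff.2 (h · g))⟩

namespace ESC

variable {k G G' J J' : Type*} [Field k] [Group G] [Group G']

theorem isCentral_toRSC (E : ESC k G J) (u : ClassReps G) : (E.toRSC u).IsCentral := by
  rintro C ⟨⟨j, rfl⟩⟩
  exact ⟨E.g j, ConjClasses.carrier_mk_of_mem_center (E.g_mem j)⟩

/-- The arrows with a given source in the quiver of an element system correspond to the indices. -/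
def labelEquiv (E : ESC k G J) (u : ClassReps G) : (E.toRSC u).Label ≃ J where
  toFun a := a.2.1.1
  invFun j := ⟨ConjClasses.mk (E.g j), ⟨j, rfl⟩, ⟨E.g j, ConjClasses.mem_carrier_mk⟩⟩
  left_inv a := by
    obtain ⟨C, i, c⟩ := a
    have := (E.isCentral_toRSC u).subsingleton i
    obtain ⟨j, rfl⟩ := i
    exact congrArg (fun c => (⟨_, ⟨j, rfl⟩, c⟩ : (E.toRSC u).Label)) (Subsingleton.elim _ _)
  right_inv j := rfl

theorem deg_eq (E : ESC k G J) {u : ClassReps G} (T : CosetReps u) :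
    (E.arrowBimodule T).deg = E.g ∘ E.labelEquiv u := by
  funext a
  obtain ⟨C, ⟨j, rfl⟩, c⟩ := a
  exact ConjClasses.eq_of_mk_eq_of_mem_center (E.g_mem j)
    (ConjClasses.mem_carrier_iff_mk_eq.1 c.2)

theorem coef_eq (E : ESC k G J) {u : ClassReps G} (T : CosetReps u) :
    (E.arrowBimodule T).coef = (fun j h => (E.χ j h : k)) ∘ E.labelEquiv u := by
  funext a h
  exact (E.isCentral_toRSC u).coef_eq T a h

theorem shift_eq (E : ESC k G J) {u : ClassReps G} (T : CosetReps u) (a : (E.toRSC u).Label)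
    (h : G) : (E.arrowBimodule T).shift a h = a :=
  (E.isCentral_toRSC u).shift_eq T a h

theorem iso_iff_labelIso (E : ESC k G J) (E' : ESC k G' J') :
    E.Iso E' ↔ LabelIso E.g (fun j h => (E.χ j h : k)) E'.g (fun j h => (E'.χ j h : k)) := by
  refine exists_congr fun φ => exists_congr fun σ => forall_congr' fun j =>
    and_congr eq_comm ⟨fun h x => ?_, fun h => MonoidHom.ext fun x => Units.ext (h x)⟩
  simp only [← h]
  rfl

/-- Element systems are isomorphic if and only if those with the inverse characters are. -/
theorem iso_iff_labelIso_inv (E : ESC k G J) (E' : ESC k G' J') :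
    E.Iso E' ↔ LabelIso E.g (fun j h => (E.χ j h⁻¹ : k)) E'.g (fun j h => (E'.χ j h⁻¹ : k)) := by
  rw [iso_iff_labelIso]
  refine exists_congr fun φ => exists_congr fun σ => forall_congr' fun j =>
    and_congr Iff.rfl ⟨fun h x => ?_, fun h x => ?_⟩
  · simpa using h x⁻¹
  · simpa using h x⁻¹

/-- The conjugating elements in an isomorphism of ramification systems are irrelevant for element
systems, since the degrees are central and the characters are defined on the whole group. -/
theorem iso_iff_rsc_iso (E : ESC k G J) (E' : ESC k G' J') (u : ClassReps G) (u' : ClassReps G') :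
    E.Iso E' ↔ (E.toRSC u).Iso (E'.toRSC u') := by
  constructor
  · rintro ⟨φ, σ, h⟩
    have hconj : ∀ C, ∃ x : G, φ (x⁻¹ * u.u C * x) = u'.u (ConjClasses.map φ.toMonoidHom C) := by
      intro C
      have h1 : ConjClasses.mk (φ (u.u C)) =
          ConjClasses.mk (u'.u (ConjClasses.map φ.toMonoidHom C)) := by
        rw [u'.mk_u]
        conv_rhs => rw [← u.mk_u C]
        rfl
      obtain ⟨y, hy⟩ := isConj_iff.1 (ConjClasses.mk_eq_mk_iff_isConj.1 h1)
      refine ⟨φ.symm y⁻¹, ?_⟩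
      rw [← hy]
      simp
    choose x hx using hconj
    have hmk : ∀ (C : ConjClasses G) (j : J), ConjClasses.mk (E.g j) = C ↔
        ConjClasses.mk (E'.g (σ j)) = ConjClasses.map φ.toMonoidHom C := by
      intro C j
      rw [← (h j).1, ← (ConjClasses.map_bijective φ).1.eq_iff]
      rfl
    refine ⟨φ, x, fun C => σ.subtypeEquiv (hmk C), hx, ?_⟩
    rintro C ⟨j, hj⟩ z z' hz
    change E'.χ (σ j) z' = E.χ j z
    rw [hz, ← (h j).2]
    simp
  · rintro ⟨φ, x, f, -, hχ⟩
    -- The map of conjugacy classes is bijective, so the bijections of the index sets combine.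
    let σ : J ≃ J' := (Equiv.sigmaFiberEquiv fun j => ConjClasses.mk (E.g j)).symm.trans
      ((Equiv.sigmaCongr (Equiv.ofBijective _ (ConjClasses.map_bijective φ)) f).trans
        (Equiv.sigmaFiberEquiv fun j => ConjClasses.mk (E'.g j)))
    have hσ : ∀ j, ∃ i : (E.toRSC u).I (ConjClasses.mk (E.g j)), i.1 = j ∧ (f _ i).1 = σ j :=
      fun j => ⟨⟨j, rfl⟩, rfl, rfl⟩
    refine ⟨φ, σ, fun j => ?_⟩
    obtain ⟨i, hi, hij⟩ := hσ j
    have hmk := (f _ i).2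
    rw [hij] at hmk
    refine ⟨ConjClasses.eq_of_mk_eq_of_mem_center (E'.g_mem _) hmk.symm, MonoidHom.ext fun z => ?_⟩
    set y := x (ConjClasses.mk (E.g j))
    have := hχ _ i ⟨y * z * y⁻¹, (E.isCentral_toRSC u).mem_centralizer i _⟩
      ⟨φ z, (E'.isCentral_toRSC u').mem_centralizer (f _ i) _⟩ (by simp [y, mul_assoc])
    change E'.χ (f _ i).1 (φ z) = E.χ i.1 (y * z * y⁻¹) at this
    rw [hij, hi, map_mul, map_mul, map_inv, mul_inv_cancel_comm] at this
    exact this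

end ESC

namespace RSC

variable {k : Type uk} {G : Type uG} [Field k] [Group G] {R : RSC.{uk, uG, uI} k G}

/-- The element system of a central ramification system: its indices are the arrows with source
`1`. -/
def IsCentral.esc (hR : R.IsCentral) : ESC k G (Σ C, R.I C) where
  g i := R.u.u i.1
  g_mem i := hR.u_mem_center i.2
  χ i := hR.character i.2

theorem IsCentral.iso_esc (hR : R.IsCentral) : R.Iso (hR.esc.toRSC R.u) := by
  have hmap : ∀ C : ConjClasses G,
      ConjClasses.map (MulEquiv.refl G).toMonoidHom C = C := fun C => by
    obtain ⟨a, rfl⟩ := ConjClasses.mk_surjective C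
    rfl
  have hmk : ∀ C, ConjClasses.mk (R.u.u C) =
      ConjClasses.map (MulEquiv.refl G).toMonoidHom C := fun C => by rw [hmap, R.u.mk_u]
  let f : ∀ C, R.I C → (hR.esc.toRSC R.u).I (ConjClasses.map (MulEquiv.refl G).toMonoidHom C) :=
    fun C i => ⟨⟨C, i⟩, hmk C⟩
  have hf : ∀ C, Function.Bijective (f C) := fun C => by
    refine ⟨fun i j hij => ?_, ?_⟩
    · have := congrArg Subtype.val hij
      simpa [f] using this
    · rintro ⟨⟨D, i⟩, hi⟩
      have : D = C := by
        rw [← hmap C, ← hi]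
        exact (R.u.mk_u D).symm
      subst this
      exact ⟨i, rfl⟩
  refine ⟨MulEquiv.refl G, fun _ => 1, fun C => Equiv.ofBijective (f C) (hf C), fun C => ?_, ?_⟩
  · rw [hmap]
    simp
    rfl
  · intro C i z z' hz
    change R.χ C i ⟨(z' : G), hR.mem_centralizer i _⟩ = R.χ C i z
    congr 1
    apply Subtype.ext
    simpa using hz

theorem IsCentral.oneTypeIsomorphic_esc (hR : R.IsCentral) (S : CosetReps R.u) :
    OneTypeIsomorphic (R.arrowBimodule S) (hR.esc.arrowBimodule S) := by
  let p : R.Label ≃ Σ C, R.I C :=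
    { toFun a := ⟨a.1, a.2.1⟩
      invFun i := ⟨i.1, i.2, ⟨R.u.u i.1, R.u.u_mem i.1⟩⟩
      left_inv a := by
        obtain ⟨C, i, c⟩ := a
        have := hR.subsingleton i
        exact congrArg (fun c => (⟨C, i, c⟩ : R.Label)) (Subsingleton.elim _ _)
      right_inv i := rfl }
  rw [ArrowBimodule.oneTypeIsomorphic_iff (hR.shift_eq S) (hR.esc.shift_eq S), hR.esc.deg_eq,
    hR.esc.coef_eq]
  have hdeg : (R.arrowBimodule S).deg = hR.esc.g ∘ p := funext fun a => hR.deg_eq S a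
  have hcoef : (R.arrowBimodule S).coef = (fun j h => (hR.esc.χ j h : k)) ∘ p :=
    funext fun a => funext fun h => hR.coef_eq S a h
  rw [hdeg, hcoef, LabelIso.congr_equiv]
  exact ⟨MulEquiv.refl G, Equiv.refl _, fun _ => ⟨rfl, fun _ => rfl⟩⟩

end RSC

/-! ### The equivalent conditions in terms of labels -/

namespace ArrowBimodule

/-- If the right action of the groups fixes the labels of the arrows, then the adjoint modules on
the arrows with source `1` are isomorphic if and only if the degrees and the inverse characters of
the labels match. -/
theorem exists_ydIso_ad_iff {k G G' L L' : Type*} [Field k] [Group G] [Group G']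
    {D : ArrowBimodule k G L} {D' : ArrowBimodule k G' L'} (hD : ∀ a h, D.shift a h = a)
    (hD' : ∀ a h, D'.shift a h = a) :
    (∃ φ : MonoidAlgebra k G ≃ₐc[k] MonoidAlgebra k G', Nonempty (YDIso φ D.ad D'.ad)) ↔
      LabelIso D.deg (fun a h => D.coef a h⁻¹) D'.deg (fun a h => D'.coef a h⁻¹) := by
  let s : {a : G × L // a.1 = 1} ≃ L := ⟨fun a => a.1.2, fun a => ⟨(1, a), rfl⟩,
    fun a => Subtype.ext (Prod.ext a.2.symm rfl), fun _ => rfl⟩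
  let s' : {a : G' × L' // a.1 = 1} ≃ L' := ⟨fun a => a.1.2, fun a => ⟨(1, a), rfl⟩,
    fun a => Subtype.ext (Prod.ext a.2.symm rfl), fun _ => rfl⟩
  rw [← LabelIso.congr_equiv s s', ad, ad, YDModule.exists_ydIso_monomial_iff]
  · have hdeg : (fun a : {a : G × L // a.1 = 1} => a.1.1 * D.deg a.1.2) = D.deg ∘ s :=
      funext fun a => by rw [a.2, one_mul]; rfl
    have hdeg' : (fun a : {a : G' × L' // a.1 = 1} => a.1.1 * D'.deg a.1.2) = D'.deg ∘ s' :=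
      funext fun a => by rw [a.2, one_mul]; rfl
    rw [hdeg, hdeg']
    rfl
  · rintro g ⟨⟨x, a⟩, rfl : x = 1⟩
    exact Subtype.ext (Prod.ext (by simp) (hD a _))
  · rintro g ⟨⟨x, a⟩, rfl : x = 1⟩
    exact Subtype.ext (Prod.ext (by simp) (hD' a _))

end ArrowBimodule

namespace ESC

variable {k G G' J J' : Type*} [Field k] [Group G] [Group G'] (E : ESC k G J) (E' : ESC k G' J')

theorem iso_iff_ydIso : E.Iso E' ↔ ∃ φ : MonoidAlgebra k G ≃ₐc[k] MonoidAlgebra k G',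
    Nonempty (YDIso φ E.V E'.V) := by
  rw [iso_iff_labelIso, V, V, YDModule.exists_ydIso_monomial_iff (fun _ _ => rfl) fun _ _ => rfl]

theorem iso_iff_nicholsIso : E.Iso E' ↔ ∃ φ : MonoidAlgebra k G ≃ₐc[k] MonoidAlgebra k G',
    Nonempty (NicholsIso φ E.V E'.V) := by
  rw [iso_iff_ydIso]
  exact exists_congr fun φ => ⟨fun ⟨ψ⟩ => ⟨YDModule.nicholsIso ψ⟩,
    fun ⟨Ψ⟩ => YDModule.nonempty_ydIso_of_nicholsIso Ψ⟩

variable {u : ClassReps G} (T : CosetReps u) {u' : ClassReps G'} (T' : CosetReps u')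

theorem iso_iff_oneTypeIsomorphic :
    E.Iso E' ↔ OneTypeIsomorphic (E.arrowBimodule T) (E'.arrowBimodule T') := by
  rw [ArrowBimodule.oneTypeIsomorphic_iff (E.shift_eq T) (E'.shift_eq T'), E.deg_eq, E.coef_eq,
    E'.deg_eq, E'.coef_eq, LabelIso.congr_equiv, iso_iff_labelIso]

/-- Since `h ▷ a = h · a · h⁻¹`, the characters of the adjoint module on the arrows with source `1`
are the inverses of those of the element system. -/
theorem iso_iff_ydIso_ad : E.Iso E' ↔ ∃ φ : MonoidAlgebra k G ≃ₐc[k] MonoidAlgebra k G',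
    Nonempty (YDIso φ (E.arrowBimodule T).ad (E'.arrowBimodule T').ad) := by
  rw [ArrowBimodule.exists_ydIso_ad_iff (E.shift_eq T) (E'.shift_eq T'), iso_iff_labelIso_inv,
    E.deg_eq, E.coef_eq, E'.deg_eq, E'.coef_eq]
  exact (LabelIso.congr_equiv (E.labelEquiv u) (E'.labelEquiv u')).symm

end ESC

theorem theorem4 {k : Type uk} [Field k] {G : Type uG} [Group G] {G' : Type uG'} [Group G']
    {J : Type uJ} {J' : Type uJ'} (E : ESC k G J) (E' : ESC k G' J')
    (u : ClassReps G) (T : CosetReps u) (u' : ClassReps G') (T' : CosetReps u') :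
    -- the six equivalent conditions
    List.TFAE [
      E.Iso E',
      (E.toRSC u).Iso (E'.toRSC u'),
      ∃ φ : MonoidAlgebra k G ≃ₐc[k] MonoidAlgebra k G', Nonempty (YDIso φ E.V E'.V),
      ∃ φ : MonoidAlgebra k G ≃ₐc[k] MonoidAlgebra k G', Nonempty (NicholsIso φ E.V E'.V),
      ∃ φ : MonoidAlgebra k G ≃ₐc[k] MonoidAlgebra k G',
        Nonempty (YDIso φ (E.arrowBimodule T).ad (E'.arrowBimodule T').ad),
      OneTypeIsomorphic (E.arrowBimodule T) (E'.arrowBimodule T')] ∧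
    -- the ramification system of an element system is central
    (E.toRSC u).IsCentral ∧
    -- the pointed modules are those of element systems, up to isomorphism
    (∀ (V : Type uV) [AddCommGroup V] [Module k V] (M : YDModule k (MonoidAlgebra k G) V),
      M.IsPointed ↔ ∃ (K : Type uV) (F : ESC k G K),
        Nonempty (YDIso (BialgEquiv.refl k (MonoidAlgebra k G)) M F.V)) ∧
    -- the Nichols algebras of pointed modules are those of element systems, up to isomorphism
    (∀ (V : Type uV) [AddCommGroup V] [Module k V] (M : YDModule k (MonoidAlgebra k G) V),
      M.IsPointed → ∃ (K : Type uV) (F : ESC k G K),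
        Nonempty (NicholsIso (BialgEquiv.refl k (MonoidAlgebra k G)) M F.V)) ∧
    -- the multiple Taft algebras are those of element systems, up to isomorphism
    (∀ (R : RSC.{uk, uG, uI} k G) (S : CosetReps R.u), R.IsCentral →
      ∃ (K : Type (max uG uI)) (F : ESC k G K), R.Iso (F.toRSC R.u) ∧
        OneTypeIsomorphic (R.arrowBimodule S) (F.arrowBimodule S)) ∧
    -- over a finite abelian group `G`, all modules are pointed and all ramifications are central,
    -- if `k` contains a primitive root of unity whose order is the exponent of `G`
    (Finite G → (∀ a b : G, a * b = b * a) → (∃ ζ : k, IsPrimitiveRoot ζ (Monoid.exponent G)) →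
      (∀ (V : Type uV) [AddCommGroup V] [Module k V] (M : YDModule k (MonoidAlgebra k G) V),
        M.IsPointed) ∧
      ∀ R : RSC.{uk, uG, uI} k G, R.IsCentral) := by
  refine ⟨?_, E.isCentral_toRSC u, fun V _ _ M => ⟨fun hM => ?_, ?_⟩, fun V _ _ M hM => ?_,
    fun R S hR => ⟨_, hR.esc, hR.iso_esc, hR.oneTypeIsomorphic_esc S⟩,
    fun _ hcomm ⟨ζ, hζ⟩ => ⟨fun V _ _ M => M.isPointed_of_finite hcomm hζ,
      RSC.isCentral_of_comm hcomm⟩⟩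
  · rw [← E.iso_iff_rsc_iso E' u u', ← E.iso_iff_ydIso E', ← E.iso_iff_nicholsIso E',
      ← E.iso_iff_ydIso_ad E' T T', ← E.iso_iff_oneTypeIsomorphic E' T T']
    simp
  · obtain ⟨K, b, hb⟩ := hM.exists_basis
    exact ⟨K, YDModule.exists_esc_of_basis b hb⟩
  · rintro ⟨K, F, ⟨ψ⟩⟩
    exact YDModule.isPointed_of_ydIso F ψ
  · obtain ⟨K, b, hb⟩ := hM.exists_basis
    obtain ⟨F, ⟨ψ⟩⟩ := YDModule.exists_esc_of_basis b hb
    exact ⟨K, F, ⟨YDModule.nicholsIso ψ⟩⟩
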